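/- Let $n\ge 1$ and let $A$ be a cluster algebra of type $\mathsf A_n$ over $\mathbb F_2$: it is the subalgebra of a purely transcendental extension $K$ of $\mathbb F_2$ generated by all cluster variables of all seeds mutation equivalent to an initial seed (the frozen variables and their inverses are also included), where the initial seed has $n$ mutable and finitely many frozen vertices, no mutable vertex of its ice quiver is isolated, and the mutable part of its quiver is mutation equivalent to an orientation of the Dynkin diagram $\mathsf A_n$. Points of the cluster variety over $\mathbb F_2$ are the homomorphisms $\varphi:A\to\mathbb F_2$; the cluster torus of a seed consists of the $\varphi$ that vanish on no cluster variable of this seed; the cluster manifold $\mathcal M_{\mathbb F_2}(A)$ is the union of all cluster tori. Let $P$ be the convex $(n+3)$-gon with vertices $0,1,\dots,n+2$ in clockwise order. The quiver of a triangulation of $P$ has the diagonals of the triangulation as vertices, and arrows between them that form counterclockwise cycles inside the triangles. A hexagonal move replaces a triangulation $T$ of $P$ by another one as follows: choose six vertices $v_0<\dots<v_5$ of $P$ that span a hexagon whose six sides are edges of $T$ (sides of $P$ or diagonals in $T$), and change the triangulation of this hexagon, with indices modulo $6$, either from the zig-zag $v_rv_{r+2},\,v_{r+2}v_{r-1},\,v_{r-1}v_{r+3}$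 to the zig-zag $v_rv_{r-2},\,v_{r-2}v_{r+1},\,v_{r+1}v_{r+3}$ or vice versa (zig-zag move), or from the inscribed triangle $v_rv_{r+2}v_{r+4}$ to the inscribed triangle $v_{r+1}v_{r+3}v_{r+5}$ (inscribed triangle move). Then: 1. Seeds of $A$ (up to relabelling of the mutable vertices) correspond to triangulations of $P$. That is, there are a bijection $\Sigma\mapsto T_\Sigma$ from seeds to triangulations and an injective assignment of elements of $K$ to the diagonals of $P$, such that for every seed $\Sigma$ the cluster variables of $\Sigma$ are exactly the elements assigned to the diagonals in $T_\Sigma$, and under this identification the mutable part of the quiver of $\Sigma$ is the quiver of $T_\Sigma$. (Hence mutations correspond to flips.) 2. The cluster torus over $\mathbb F_2$ of every seed is a single point of $\mathcal M_{\mathbb F_2}(A)$. For every correspondence as in 1, two seeds $\Sigma_1,\Sigma_2$ determine the same point of $\mathcal M_{\mathbb F_2}(A)$ if and only if $T_{\Sigma_1}$ and $T_{\Sigma_2}$ are connected by a finite (possibly empty) sequence of hexagonal moves. 3. For every triangulation $T$ of $P$ there is a unique colouring $c(T)$ of the vertices of $P$ by the three elements of $\mathbb P^1(\mathbb F_2)$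 such that vertex $0$ has colour $[1:0]$, vertex $n+2$ has colour $[0:1]$, and the endpoints of every side of $P$ and of every diagonal in $T$ have different colours. For two triangulations $T,T'$ of $P$ one has $c(T)=c(T')$ if and only if $T$ and $T'$ are connected by a finite (possibly empty) sequence of hexagonal moves. -/

import Mathlib

/-! ### Ice quivers and their mutations -/

/-- An ice quiver with set of mutable vertices `ι` and set of frozen vertices `κ`, without loops,
without directed `2`-cycles and without arrows between frozen vertices. It is recorded by the
integers `b i j = #{arrows i → j} - #{arrows j → i}`; as there are no `2`-cycles, the number of
arrows `i → j` is `max (b i j) 0`. -/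
structure IceQuiver (ι κ : Type*) where
  b : ι ⊕ κ → ι ⊕ κ → ℤ
  skew : ∀ i j, b i j = -b j i
  frozen : ∀ f g : κ, b (Sum.inr f) (Sum.inr g) = 0

namespace IceQuiver

variable {ι κ : Type*}

/-- Quiver mutation at the mutable vertex `k`: for each path `i → k → j` add an arrow `i → j`,
reverse all arrows at `k`, cancel `2`-cycles, and discard arrows between frozen vertices. -/
def mutate [DecidableEq ι] [DecidableEq κ] (Q : IceQuiver ι κ) (k : ι) : IceQuiver ι κ where
  b i j :=
    if i = Sum.inl k ∨ j = Sum.inl k then -Q.b i j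
    else if i.isRight ∧ j.isRight then 0
    else Q.b i j + (max (Q.b i (Sum.inl k)) 0 * max (Q.b (Sum.inl k) j) 0
      - max (Q.b j (Sum.inl k)) 0 * max (Q.b (Sum.inl k) i) 0)
  skew i j := by
    have h := Q.skew i j
    by_cases hi : i = Sum.inl k <;> by_cases hj : j = Sum.inl k <;>
      by_cases hi' : i.isRight <;> by_cases hj' : j.isRight <;> simp [hi, hj, hi', hj'] <;> grind
  frozen f g := by simp

/-- No mutable vertex is isolated. -/
def NoIsolatedMutable (Q : IceQuiver ι κ) : Prop :=
  ∀ i : ι, ∃ j, Q.b (Sum.inl i) j ≠ 0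

/-- The mutable part of `Q` is an orientation of the Dynkin diagram `A_n`
(the path with `n` vertices). -/
def IsDynkinA (n : ℕ) (Q : IceQuiver ι κ) : Prop :=
  ∃ e : Fin n ≃ ι, ∀ i j : Fin n, |Q.b (Sum.inl (e i)) (Sum.inl (e j))| =
    if i.val + 1 = j.val ∨ j.val + 1 = i.val then 1 else 0

/-- `Q` has cluster type `A_n`: some quiver obtained from `Q` by iterated mutations has an
orientation of the Dynkin diagram `A_n` as its mutable part. -/
def IsTypeA [DecidableEq ι] [DecidableEq κ] (n : ℕ) (Q : IceQuiver ι κ) : Prop :=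
  ∃ Q' : IceQuiver ι κ,
    Relation.ReflTransGen (fun Q₁ Q₂ : IceQuiver ι κ => ∃ k, Q₂ = Q₁.mutate k) Q Q' ∧
      Q'.IsDynkinA n

end IceQuiver

/-! ### Seeds, cluster algebras, cluster tori -/

/-- A (labelled, extended) seed over the field `F` in the ambient field `K`: a free generating
set of the field extension `K` of `F`, indexed by the vertices of an ice quiver. In particular
`K` is purely transcendental over `F`. -/
structure Seed (F K ι κ : Type*) [Field F] [Field K] [Algebra F K] where
  x : ι ⊕ κ → K
  quiver : IceQuiver ι κ
  algebraicIndependent : AlgebraicIndependent F x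
  adjoin_eq_top : IntermediateField.adjoin F (Set.range x) = ⊤

namespace Seed

variable {F K ι κ : Type*} [Field F] [Field K] [Algebra F K]

/-- `S'` is the mutation of `S` at `k`: the quiver is mutated at `k`, the variables other than
`x_k` are kept, and `x_k` is replaced by `x'_k`, determined by the exchange relation
`x'_k x_k = ∏_{k → i} x_i + ∏_{i → k} x_i` (products over arrows). -/
def IsMutation [DecidableEq ι] [DecidableEq κ] [Fintype ι] [Fintype κ] (k : ι)
    (S S' : Seed F K ι κ) : Prop :=
  S'.quiver = S.quiver.mutate k ∧
  (∀ i, i ≠ Sum.inl k → S'.x i = S.x i) ∧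
  S'.x (Sum.inl k) * S.x (Sum.inl k) =
    (∏ i, S.x i ^ (S.quiver.b (Sum.inl k) i).toNat) +
      ∏ i, S.x i ^ (S.quiver.b i (Sum.inl k)).toNat

/-- The labelled seeds that can be reached from `S₀` by iterated mutations. -/
def MutationClass [DecidableEq ι] [DecidableEq κ] [Fintype ι] [Fintype κ]
    (S₀ : Seed F K ι κ) : Type _ :=
  {S : Seed F K ι κ // Relation.ReflTransGen (fun S₁ S₂ => ∃ k, IsMutation k S₁ S₂) S₀ S}

/-- Two labelled seeds are the same up to the labelling of the mutable vertices. -/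
def IsRelabelling (S S' : Seed F K ι κ) : Prop :=
  ∃ σ : Equiv.Perm ι, (∀ i, S'.x i = S.x (Sum.map σ id i)) ∧
    ∀ i j, S'.quiver.b i j = S.quiver.b (Sum.map σ id i) (Sum.map σ id j)

/-- The set of (mutable) cluster variables of a seed. -/
def cluster (S : Seed F K ι κ) : Set K := Set.range fun i : ι => S.x (Sum.inl i)

variable [DecidableEq ι] [DecidableEq κ] [Fintype ι] [Fintype κ]

/-- The cluster algebra of `S₀` over `F`, with invertible frozen variables: the `F`-subalgebra
of `K` generated by all cluster variables of all seeds mutation equivalent to `S₀`, the frozen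
variables and the inverses of the frozen variables. -/
def clusterAlgebra (S₀ : Seed F K ι κ) : Subalgebra F K :=
  Algebra.adjoin F ((⋃ S : S₀.MutationClass, S.1.cluster) ∪
    (Set.range fun f : κ => S₀.x (Sum.inr f)) ∪ Set.range fun f : κ => (S₀.x (Sum.inr f))⁻¹)

/-- The `F`-points of the cluster variety. -/
abbrev ClusterVariety (S₀ : Seed F K ι κ) : Type _ := S₀.clusterAlgebra →ₐ[F] F

/-- The `F`-points of the cluster torus of a seed `S`: the points of the cluster variety at which
no cluster variable of `S` vanishes. -/
def clusterTorus (S₀ : Seed F K ι κ) (S : S₀.MutationClass) : Set S₀.ClusterVariety :=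
  {φ | ∀ a : S₀.clusterAlgebra, (a : K) ∈ S.1.cluster → φ a ≠ 0}

/-- The `F`-points of the cluster manifold: the union of all cluster tori. -/
def clusterManifold (S₀ : Seed F K ι κ) : Set S₀.ClusterVariety :=
  ⋃ S : S₀.MutationClass, S₀.clusterTorus S

end Seed

/-! ### Triangulations of the `(n+3)`-gon -/

/-- The vertices of the `(n+3)`-gon are `0, 1, …, n+2`, in clockwise order; its sides are the
pairs `{i, i+1}`, with indices modulo `n+3`. -/
def IsSide {n : ℕ} (e : Sym2 (Fin (n + 3))) : Prop := ∃ i, e = s(i, i + 1)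

/-- A diagonal of the `(n+3)`-gon: a pair of distinct vertices that is not a side. -/
def IsDiagonal {n : ℕ} (e : Sym2 (Fin (n + 3))) : Prop := ¬ e.IsDiag ∧ ¬ IsSide e

/-- Two chords of a polygon cross (in their interiors). -/
def Crosses {N : ℕ} (e f : Sym2 (Fin N)) : Prop :=
  ∃ a b c d : Fin N, a < b ∧ b < c ∧ c < d ∧
    ((e = s(a, c) ∧ f = s(b, d)) ∨ (e = s(b, d) ∧ f = s(a, c)))

/-- A triangulation of the `(n+3)`-gon: a maximal set of pairwise noncrossing diagonals. -/
@[ext]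
structure Triangulation (n : ℕ) where
  diagonals : Finset (Sym2 (Fin (n + 3)))
  isDiagonal : ∀ e ∈ diagonals, IsDiagonal e
  noncrossing : ∀ e ∈ diagonals, ∀ f ∈ diagonals, ¬ Crosses e f
  maximal : ∀ e, IsDiagonal e → (∀ f ∈ diagonals, ¬ Crosses e f) → e ∈ diagonals

namespace Triangulation

variable {n : ℕ}

/-- The edges of a triangulation: the sides of the polygon and the chosen diagonals. -/
def IsEdge (T : Triangulation n) (e : Sym2 (Fin (n + 3))) : Prop :=
  IsSide e ∨ e ∈ T.diagonals

/-- There is an arrow `e → f` in some triangle `i, j, k` (in clockwise order) of `T`. The three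
arrows `ij → ki → jk → ij` of the triangle form a counterclockwise `3`-cycle. -/
def HasArrow (T : Triangulation n) (e f : Sym2 (Fin (n + 3))) : Prop :=
  ∃ i j k : Fin (n + 3), i < j ∧ j < k ∧
    T.IsEdge s(i, j) ∧ T.IsEdge s(j, k) ∧ T.IsEdge s(k, i) ∧
    ((e = s(i, j) ∧ f = s(k, i)) ∨ (e = s(k, i) ∧ f = s(j, k)) ∨ (e = s(j, k) ∧ f = s(i, j)))

open Classical in
/-- The signed number of arrows from the diagonal `e` to the diagonal `f` in the quiver of the
triangulation `T` (two distinct diagonals lie in at most one common triangle of `T`). -/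
noncomputable def arrows (T : Triangulation n) (e f : Sym2 (Fin (n + 3))) : ℤ :=
  (if T.HasArrow e f then 1 else 0) - (if T.HasArrow f e then 1 else 0)

/-! ### Hexagonal moves -/

/-- A zig-zag triangulation of the hexagon, joining the antipodal vertices `r` and `r+3` by the
path `r, r+2, r-1, r+3`. -/
def zigzag (r : Fin 6) : Finset (Sym2 (Fin 6)) := {s(r, r + 2), s(r + 2, r - 1), s(r - 1, r + 3)}

/-- The other zig-zag triangulation of the hexagon joining `r` and `r+3`, by the path
`r, r-2, r+1, r+3`. -/
def zigzag' (r : Fin 6) : Finset (Sym2 (Fin 6)) := {s(r, r - 2), s(r - 2, r + 1), s(r + 1, r + 3)}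

/-- The triangle with vertices `r, r+2, r+4` inscribed in the hexagon. -/
def inscribed (r : Fin 6) : Finset (Sym2 (Fin 6)) := {s(r, r + 2), s(r + 2, r + 4), s(r + 4, r)}

/-- The triangulations `D`, `D'` of the hexagon are exchanged by a zig-zag move or by an
inscribed triangle move. -/
def IsHexagonExchange (D D' : Finset (Sym2 (Fin 6))) : Prop :=
  ∃ r : Fin 6, (D = zigzag r ∧ D' = zigzag' r) ∨ (D = zigzag' r ∧ D' = zigzag r) ∨
    (D = inscribed r ∧ D' = inscribed (r + 1))

/-- `T'` is obtained from `T` by a hexagonal move inside the hexagon with vertices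
`v 0 < ⋯ < v 5`, whose six sides are edges of `T`. -/
def HexagonalMove (T T' : Triangulation n) : Prop :=
  ∃ v : Fin 6 → Fin (n + 3), StrictMono v ∧ (∀ a, T.IsEdge s(v a, v (a + 1))) ∧
    ∃ D D' : Finset (Sym2 (Fin 6)), IsHexagonExchange D D' ∧
      D.image (Sym2.map v) ⊆ T.diagonals ∧
      T'.diagonals = (T.diagonals \ D.image (Sym2.map v)) ∪ D'.image (Sym2.map v)

/-- `T` and `T'` are connected by a finite (possibly empty) sequence of hexagonal moves. -/
def HexagonallyConnected (T T' : Triangulation n) : Prop :=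
  Relation.ReflTransGen HexagonalMove T T'

end Triangulation

/-! ### Colourings by the projective line -/

open scoped LinearAlgebra.Projectivization

/-- The point `[1 : 0]` of the projective line. -/
def projZero (F : Type*) [Field F] : ℙ F (Fin 2 → F) :=
  Projectivization.mk F ![1, 0] fun h => one_ne_zero (congrFun h 0)

/-- The point `[0 : 1]` of the projective line. -/
def projInfty (F : Type*) [Field F] : ℙ F (Fin 2 → F) :=
  Projectivization.mk F ![0, 1] fun h => one_ne_zero (congrFun h 1)

/-- The set of labellings `y_0, …, y_{n+2}` of the vertices of the `(n+3)`-gon by points of the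
projective line over `F` with `y_0 = [1 : 0]`, `y_{n+2} = [0 : 1]` and `y_i ≠ y_{i+1}`. -/
def polygonVariety (F : Type*) [Field F] (n : ℕ) : Set (Fin (n + 3) → ℙ F (Fin 2 → F)) :=
  {y | y 0 = projZero F ∧ y (Fin.last (n + 2)) = projInfty F ∧
    ∀ i : Fin (n + 2), y i.castSucc ≠ y i.succ}

/-- The elements of `polygonVariety F n` that are proper colourings of the graph formed by the
edges of the triangulation `T`. -/
def Triangulation.properColourings {n : ℕ} (F : Type*) [Field F] (T : Triangulation n) :
    Set (polygonVariety F n) :=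
  {y | ∀ i j, T.IsEdge s(i, j) → y.1 i ≠ y.1 j}

/-! ### The correspondence between seeds and triangulations -/

/-- The map `τ` from labelled seeds to triangulations of the `(n+3)`-gon is a correspondence of
seeds with triangulations: it induces a bijection from seeds up to relabelling to triangulations,
and there is an injective assignment `z` of elements of `K` to diagonals such that, for every
seed `S`, the variables of the cluster of `S` are, in some labelling `d`, the elements `z e` for
`e` a diagonal of `τ S`, and the mutable part of the quiver of `S` is the quiver of `τ S`.
Since `z` is injective, mutation at the `k`-th vertex replaces only the diagonal `d k`, i.e. it
is the flip of that diagonal. -/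
def IsSeedTriangulationCorrespondence {F K ι κ : Type*} [Field F] [Field K] [Algebra F K]
    [DecidableEq ι] [DecidableEq κ] [Fintype ι] [Fintype κ] {n : ℕ} (S₀ : Seed F K ι κ)
    (τ : S₀.MutationClass → Triangulation n) : Prop :=
  Function.Surjective τ ∧
  (∀ S S' : S₀.MutationClass, τ S = τ S' ↔ S.1.IsRelabelling S'.1) ∧
  ∃ z : Sym2 (Fin (n + 3)) → K, Set.InjOn z {e | IsDiagonal e} ∧
    ∀ S : S₀.MutationClass, ∃ d : ι → Sym2 (Fin (n + 3)),
      Function.Injective d ∧ Set.range d = ((τ S).diagonals : Set (Sym2 (Fin (n + 3)))) ∧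
      (∀ i, S.1.x (Sum.inl i) = z (d i)) ∧
      ∀ i j, S.1.quiver.b (Sum.inl i) (Sum.inl j) = (τ S).arrows (d i) (d j)

/-!
The first part is the standard description of cluster algebras of type `A`, with two additional
points: seeds carry frozen variables, and the ground field has characteristic `2`. Every orientation
of the Dynkin diagram is the quiver of a triangulation made of nested diagonals, mutations follow
flips (`IceQuiver.Realizes.mutate`), and all triangulations are connected by flips
(`Triangulation.flip_connected`); so some seed has the quiver of the fan triangulation at the vertex
`0`. The row of a frozen vertex in the exchange matrix of this seed consists of the shear coordinates
of a solution of the tropical Ptolemy relation, and shear coordinates of such a solution mutate like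
the quiver (`Triangulation.quadEntry_flip`). An ordinary solution of the Ptolemy relation on the chords
of the polygon, divided by the frozen monomials with these tropical exponents, satisfies the exchange
relations of all flips (`clusterFan_ptolemy`). It therefore assigns to each diagonal its cluster
variable, and the frozen rows are determined by the triangulation; this gives
`Seed.exists_correspondence`. The absence of isolated mutable vertices is what makes mutation possible
in characteristic `2`, where the right-hand side of an exchange relation with two equal monomials is
zero.

For the second part, a point of the cluster torus of a seed over `𝔽₂` takes the value `1` at all
variables of the seed, so there is at most one such point. It exists because all elements of the
cluster algebra are regular there: relative to any correspondence with triangulations, the cluster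
variables satisfy Ptolemy relations with monomial coefficients
(`IsSeedTriangulationCorrespondence.exists_ptolemy`), and every chord is reached from the edges of the
triangulation of the seed by such relations that divide only by variables of the seed
(`Triangulation.chord_induction`). The values can be written down. Modulo `2`, the determinants of pairs
of nonzero vectors of `𝔽₂²` satisfy the Ptolemy relation; hence, if `c` is a proper colouring with three
colours of the triangulation of the seed, the value at the variable of the chord `ij` is `1` if
`c i ≠ c j` and `0` otherwise. So two seeds have the same point if and only if their triangulations have
a common proper colouring.

For the third part, a triangulation is a binary tree (`TriTree`), and a proper colouring is determined
by its values at the endpoints of the root, each apex having the third colour. A hexagonal move does not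
change the colouring, as can be seen in the hexagon. Conversely, `TriTree.Proper.connected` joins two
trees with a common proper colouring by hexagonal moves, by induction on the size of the polygon and on
the distance of the two apices over the root. It uses that a polygon whose consecutive vertices have
different colours has a properly coloured triangulation as soon as its root has different colours and
all three colours occur (`TriTree.exists_tree`).
-/

/-! ### Cyclic order and crossing chords -/

/-- The vertices `a, b, c` are distinct and occur in this clockwise cyclic order. -/
def Cyc3 {N : ℕ} (a b c : Fin N) : Prop :=
  (a < b ∧ b < c) ∨ (b < c ∧ c < a) ∨ (c < a ∧ a < b)

/-- The vertices `a, b, c, d` are distinct and occur in this clockwise cyclic order. -/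
def Cyc4 {N : ℕ} (a b c d : Fin N) : Prop :=
  (a < b ∧ b < c ∧ c < d) ∨ (b < c ∧ c < d ∧ d < a) ∨ (c < d ∧ d < a ∧ a < b) ∨
    (d < a ∧ a < b ∧ b < c)

theorem Cyc3.rotate {N : ℕ} {a b c : Fin N} (h : Cyc3 a b c) : Cyc3 b c a := by
  unfold Cyc3 at *; omega

theorem Cyc4.rotate {N : ℕ} {a b c d : Fin N} (h : Cyc4 a b c d) : Cyc4 b c d a := by
  unfold Cyc4 at *; omega

theorem Cyc4.left {N : ℕ} {a b c d : Fin N} (h : Cyc4 a b c d) : Cyc3 a b c := by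
  unfold Cyc3 Cyc4 at *; omega

theorem Cyc4.right {N : ℕ} {a b c d : Fin N} (h : Cyc4 a b c d) : Cyc3 a c d := by
  unfold Cyc3 Cyc4 at *; omega

theorem Cyc3.trans {N : ℕ} {a b c d : Fin N} (h : Cyc3 a b c) (h' : Cyc3 a c d) :
    Cyc4 a b c d := by
  unfold Cyc3 Cyc4 at *; omega

theorem Cyc4.skip {N : ℕ} {a b c d : Fin N} (h : Cyc4 a b c d) : Cyc3 a b d :=
  h.rotate.rotate.rotate.left.rotate

/-- Two vertices of the open arc from `p` to `r` are comparable along this arc. -/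
theorem Cyc3.trichotomy {N : ℕ} {p q q' r : Fin N} (h : Cyc3 p q r) (h' : Cyc3 p q' r) :
    q = q' ∨ Cyc4 p q q' r ∨ Cyc4 p q' q r := by
  have : q = q' ∨ Cyc3 p q q' ∨ Cyc3 p q' q := by
    rw [Fin.ext_iff]
    unfold Cyc3 at *
    omega
  exact this.imp id (Or.imp (fun h1 => h1.trans h') fun h1 => h1.trans h)

theorem crosses_mk {N : ℕ} {a b c d : Fin N} :
    Crosses s(a, c) s(b, d) ↔ Cyc4 a b c d ∨ Cyc4 a d c b := by
  constructor
  · rintro ⟨p, q, r, s, h1, h2, h3, ⟨he, hf⟩ | ⟨he, hf⟩⟩ <;>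
    · simp only [Sym2.eq_iff] at he hf
      unfold Cyc4
      rcases he with ⟨rfl, rfl⟩ | ⟨rfl, rfl⟩ <;> rcases hf with ⟨rfl, rfl⟩ | ⟨rfl, rfl⟩ <;> omega
  · rintro ((h | h | h | h) | (h | h | h | h))
    · exact ⟨a, b, c, d, h.1, h.2.1, h.2.2, .inl ⟨rfl, rfl⟩⟩
    · exact ⟨b, c, d, a, h.1, h.2.1, h.2.2, .inr ⟨Sym2.eq_swap, rfl⟩⟩
    · exact ⟨c, d, a, b, h.1, h.2.1, h.2.2, .inl ⟨Sym2.eq_swap, Sym2.eq_swap⟩⟩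
    · exact ⟨d, a, b, c, h.1, h.2.1, h.2.2, .inr ⟨rfl, Sym2.eq_swap⟩⟩
    · exact ⟨a, d, c, b, h.1, h.2.1, h.2.2, .inl ⟨rfl, Sym2.eq_swap⟩⟩
    · exact ⟨d, c, b, a, h.1, h.2.1, h.2.2, .inr ⟨Sym2.eq_swap, Sym2.eq_swap⟩⟩
    · exact ⟨c, b, a, d, h.1, h.2.1, h.2.2, .inl ⟨Sym2.eq_swap, rfl⟩⟩
    · exact ⟨b, a, d, c, h.1, h.2.1, h.2.2, .inr ⟨rfl, rfl⟩⟩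

theorem Crosses.symm {N : ℕ} {e f : Sym2 (Fin N)} (h : Crosses e f) : Crosses f e := by
  obtain ⟨a, b, c, d, h1, h2, h3, h⟩ := h
  exact ⟨a, b, c, d, h1, h2, h3, h.symm.imp And.symm And.symm⟩

theorem Cyc4.ne_chords {N : ℕ} {a b c d : Fin N} (h : Cyc4 a b c d) :
    a ≠ b ∧ b ≠ c ∧ c ≠ d ∧ d ≠ a ∧ a ≠ c ∧ b ≠ d := by
  unfold Cyc4 at h
  simp only [ne_eq, Fin.ext_iff]
  omega

theorem isSide_mk {n : ℕ} {i j : Fin (n + 3)} : IsSide s(i, j) ↔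
    (i.val + 1 = j.val ∨ j.val + 1 = i.val ∨ (i.val = 0 ∧ j.val = n + 2) ∨
      (j.val = 0 ∧ i.val = n + 2)) := by
  have key : ∀ k : Fin (n + 3), (k + 1).val = if k.val = n + 2 then 0 else k.val + 1 := by
    intro k
    rw [Fin.val_add_one]
    simp [Fin.ext_iff]
  constructor
  · rintro ⟨k, hk⟩
    have := key k
    simp only [Sym2.eq_iff] at hk
    rcases hk with ⟨rfl, rfl⟩ | ⟨rfl, rfl⟩ <;> split_ifs at this <;> omega
  · intro h
    have hi := i.isLt
    have hj := j.isLt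
    rcases h with h | h | h | h
    · refine ⟨i, ?_⟩
      have : j = i + 1 := by ext; rw [key]; split_ifs <;> omega
      rw [this]
    · refine ⟨j, ?_⟩
      have : i = j + 1 := by ext; rw [key]; split_ifs <;> omega
      rw [this, Sym2.eq_swap]
    · refine ⟨j, ?_⟩
      have : i = j + 1 := by ext; rw [key]; split_ifs <;> omega
      rw [this, Sym2.eq_swap]
    · refine ⟨i, ?_⟩
      have : j = i + 1 := by ext; rw [key]; split_ifs <;> omega
      rw [this]

/-- A chord with a vertex strictly on either side of it is a diagonal. -/
theorem Cyc4.isDiagonal {n : ℕ} {a b c d : Fin (n + 3)} (h : Cyc4 a b c d) :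
    IsDiagonal s(a, c) := by
  unfold IsDiagonal
  rw [isSide_mk, Sym2.mk_isDiag_iff]
  unfold Cyc4 at h
  rw [Fin.ext_iff]
  omega

theorem not_crosses_of_isSide {n : ℕ} {e f : Sym2 (Fin (n + 3))} (he : IsSide e) :
    ¬ Crosses e f := by
  induction e with | _ a c
  induction f with | _ b d
  rw [isSide_mk] at he
  rw [crosses_mk]
  unfold Cyc4
  omega

namespace Triangulation

variable {n : ℕ} {T : Triangulation n}

theorem IsEdge.not_crosses {e f : Sym2 (Fin (n + 3))} (he : T.IsEdge e) (hf : T.IsEdge f) :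
    ¬ Crosses e f := by
  rcases he with he | he
  · exact not_crosses_of_isSide he
  · rcases hf with hf | hf
    · exact fun h => not_crosses_of_isSide hf h.symm
    · exact T.noncrossing e he f hf

theorem IsEdge.not_cyc4 {a b c d : Fin (n + 3)} (he : T.IsEdge s(a, c)) (hf : T.IsEdge s(b, d)) :
    ¬ Cyc4 a b c d := fun h => he.not_crosses hf (crosses_mk.2 (.inl h))

theorem IsEdge.symm {a b : Fin (n + 3)} (h : T.IsEdge s(a, b)) : T.IsEdge s(b, a) := by
  rwa [Sym2.eq_swap]

theorem IsEdge.ne {a b : Fin (n + 3)} (h : T.IsEdge s(a, b)) : a ≠ b := by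
  rintro rfl
  rcases h with h | h
  · rw [isSide_mk] at h
    omega
  · exact (T.isDiagonal _ h).1 (by simp)

theorem isEdge_of_not_crosses {e : Sym2 (Fin (n + 3))} (he : ¬ e.IsDiag)
    (h : ∀ f, T.IsEdge f → ¬ Crosses e f) : T.IsEdge e := by
  by_cases hs : IsSide e
  · exact .inl hs
  · exact .inr (T.maximal e ⟨he, hs⟩ fun f hf => h f (.inr hf))

theorem IsEdge.mem_diagonals {e : Sym2 (Fin (n + 3))} (h : T.IsEdge e) (hd : IsDiagonal e) :
    e ∈ T.diagonals := h.resolve_left hd.2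

/-- On each side of an edge of a triangulation that is not the outside of the polygon, there is a
triangle over this edge. -/
theorem IsEdge.exists_apex {i j l : Fin (n + 3)} (h : T.IsEdge s(i, j)) (hl : Cyc3 i l j) :
    ∃ k, Cyc3 i k j ∧ T.IsEdge s(i, k) ∧ T.IsEdge s(k, j) := by
  classical
  -- the apex is the last vertex before `j`, in clockwise order from `i`, that is joined to `i`
  let A : Finset (Fin (n + 3)) := {k | Cyc3 i k j ∧ T.IsEdge s(i, k)}
  have hA : A.Nonempty := by
    by_cases hi : i.val = n + 2
    · refine ⟨⟨0, by omega⟩, ?_⟩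
      simp only [A, Finset.mem_filter, Finset.mem_univ, true_and]
      refine ⟨?_, .inl (isSide_mk.2 (by simp; omega))⟩
      unfold Cyc3 at *
      simp only [Fin.lt_def] at *
      omega
    · have := i.isLt
      refine ⟨⟨i.val + 1, by omega⟩, ?_⟩
      simp only [A, Finset.mem_filter, Finset.mem_univ, true_and]
      refine ⟨?_, .inl (isSide_mk.2 (by simp))⟩
      unfold Cyc3 at *
      simp only [Fin.lt_def] at *
      omega
  obtain ⟨k, hk, hmax⟩ := A.exists_max_image
    (fun k => if i < k then k.val else k.val + (n + 3)) hA
  simp only [A, Finset.mem_filter, Finset.mem_univ, true_and] at hk hmax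
  refine ⟨k, hk.1, hk.2, isEdge_of_not_crosses ?_ ?_⟩
  · have := hk.1
    unfold Cyc3 at this
    rw [Sym2.mk_isDiag_iff]
    rintro rfl
    omega
  · have key : ∀ p q : Fin (n + 3), T.IsEdge s(p, q) → ¬ Cyc4 k p j q := by
      intro p q hpq hc
      have hikpj := (hk.1.rotate.rotate.trans hc.left.rotate.rotate).rotate
      rcases hc.right.rotate.trichotomy hk.1.rotate.rotate with rfl | hq | hq
      · have h4 := hmax p ⟨hikpj.right, hpq.symm⟩
        have h5 := hikpj.left
        unfold Cyc3 at h5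
        split_ifs at h4 <;> omega
      · exact h.not_cyc4 hpq (hikpj.right.trans hq.rotate.rotate.right)
      · exact hk.2.not_cyc4 hpq.symm (hq.rotate.left.trans hikpj.left)
    intro f hf hc
    induction f with | _ p q
    rcases crosses_mk.1 hc with hc | hc
    · exact key p q hf hc
    · exact key q p hf.symm hc

theorem apex_unique {p q q' r : Fin (n + 3)} (h : Cyc3 p q r) (h' : Cyc3 p q' r)
    (hpq : T.IsEdge s(p, q)) (hqr : T.IsEdge s(q, r)) (hpq' : T.IsEdge s(p, q'))
    (hqr' : T.IsEdge s(q', r)) : q = q' := by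
  rcases h.trichotomy h' with h | h | h
  · exact h
  · exact absurd h (hpq'.not_cyc4 hqr)
  · exact absurd h (hpq.not_cyc4 hqr')

/-- The vertices `a, b, c, d`, in clockwise order, form a quadrilateral that consists of two
triangles of `T` with the common side `ac`. -/
structure Quad (T : Triangulation n) (a b c d : Fin (n + 3)) : Prop where
  cyc : Cyc4 a b c d
  ab : T.IsEdge s(a, b)
  bc : T.IsEdge s(b, c)
  cd : T.IsEdge s(c, d)
  da : T.IsEdge s(d, a)
  ac : T.IsEdge s(a, c)

theorem Quad.rotate {a b c d : Fin (n + 3)} (h : T.Quad a b c d) : T.Quad c d a b :=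
  ⟨h.cyc.rotate.rotate, h.cd, h.da, h.ab, h.bc, h.ac.symm⟩

theorem Quad.mem {a b c d : Fin (n + 3)} (h : T.Quad a b c d) : s(a, c) ∈ T.diagonals :=
  h.ac.mem_diagonals h.cyc.isDiagonal

theorem exists_quad {e : Sym2 (Fin (n + 3))} (he : e ∈ T.diagonals) :
    ∃ a b c d, T.Quad a b c d ∧ e = s(a, c) := by
  induction e with | _ a c
  have hd := T.isDiagonal _ he
  unfold IsDiagonal at hd
  rw [isSide_mk, Sym2.mk_isDiag_iff, Fin.ext_iff] at hd
  have ha := a.isLt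
  have hc := c.isLt
  have key : ∀ a c : Fin (n + 3), s(a, c) ∈ T.diagonals →
      a < c → ¬ a.val + 1 = c.val → ¬ (a.val = 0 ∧ c.val = n + 2) →
      ∃ b d, T.Quad a b c d := by
    intro a c he h1 h2 h3
    have hc := c.isLt
    obtain ⟨b, hb, hab, hbc⟩ := IsEdge.exists_apex (i := a) (j := c) (l := ⟨a + 1, by omega⟩)
      (.inr he) (by unfold Cyc3; simp only [Fin.lt_def]; omega)
    have : ∃ l : Fin (n + 3), Cyc3 c l a := by
      by_cases h0 : a.val = 0
      · exact ⟨⟨n + 2, by omega⟩, by unfold Cyc3; simp only [Fin.lt_def]; omega⟩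
      · exact ⟨⟨0, by omega⟩, by unfold Cyc3; simp only [Fin.lt_def]; omega⟩
    obtain ⟨l, hl⟩ := this
    obtain ⟨d, hd, hcd, hda⟩ := IsEdge.exists_apex (T := T) (i := c) (j := a)
      (.inr (by rwa [Sym2.eq_swap])) hl
    exact ⟨b, d, by unfold Cyc3 Cyc4 at *; omega, hab, hbc, hcd, hda, .inr he⟩
  rcases lt_trichotomy a c with h | h | h
  · obtain ⟨b, d, hq⟩ := key a c he h (by omega) (by omega)
    exact ⟨a, b, c, d, hq, rfl⟩
  · rw [Fin.ext_iff] at h; omega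
  · obtain ⟨b, d, hq⟩ := key c a (by rwa [Sym2.eq_swap]) h (by omega) (by omega)
    exact ⟨c, b, a, d, hq, Sym2.eq_swap⟩

theorem Quad.unique {a b c d b' d' : Fin (n + 3)} (h : T.Quad a b c d) (h' : T.Quad a b' c d') :
    b = b' ∧ d = d' := by
  have h1 := h.cyc
  have h2 := h'.cyc
  constructor
  · exact apex_unique (p := a) (r := c) (by unfold Cyc3 Cyc4 at *; omega)
      (by unfold Cyc3 Cyc4 at *; omega) h.ab h.bc h'.ab h'.bc
  · exact apex_unique (p := c) (r := a) (by unfold Cyc3 Cyc4 at *; omega)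
      (by unfold Cyc3 Cyc4 at *; omega) h.cd h.da h'.cd h'.da

/-- A chord that crosses `bd` but none of the sides of the quadrilateral `abcd` is `ac`. -/
theorem eq_of_crosses_of_not_crosses {N : ℕ} {a b c d : Fin N} (h : Cyc4 a b c d)
    {f : Sym2 (Fin N)} (hf : Crosses s(b, d) f) (hab : ¬ Crosses s(a, b) f)
    (hbc : ¬ Crosses s(b, c) f) (hcd : ¬ Crosses s(c, d) f) (hda : ¬ Crosses s(d, a) f) :
    f = s(a, c) := by
  have key : ∀ p q : Fin N, Cyc4 b p d q → ¬ Crosses s(a, b) s(p, q) →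
    ¬ Crosses s(b, c) s(p, q) → ¬ Crosses s(c, d) s(p, q) → ¬ Crosses s(d, a) s(p, q) →
    p = c ∧ q = a := by
    intro p q hc h1 h2 h3 h4
    rw [crosses_mk] at h1 h2 h3 h4
    have hbcdq := h.rotate.left.trans hc.right
    have hdabp := h.rotate.right.rotate.trans hc.left.rotate.rotate
    constructor
    · rcases hc.left.trichotomy h.rotate.left with h' | h' | h'
      · exact h'
      · exact absurd (.inl (h'.left.trans hbcdq.skip)) h2
      · exact absurd (.inl (h'.rotate.left.trans hbcdq.rotate.left)) h3
    · rcases hc.right.rotate.trichotomy h.rotate.right.rotate with h' | h' | h'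
      · exact h'
      · exact absurd (.inr (h'.left.trans hdabp.skip)) h4
      · exact absurd (.inr (h'.rotate.left.trans hdabp.rotate.left)) h1
  induction f with | _ p q
  rcases crosses_mk.1 hf with hf | hf
  · obtain ⟨rfl, rfl⟩ := key p q hf hab hbc hcd hda
    exact Sym2.eq_swap
  · rw [Sym2.eq_swap (a := p)] at hab hbc hcd hda
    obtain ⟨rfl, rfl⟩ := key q p hf hab hbc hcd hda
    rfl

/-- The flip of the diagonal `ac` of the quadrilateral `abcd`. -/
def flip (T : Triangulation n) {a b c d : Fin (n + 3)} (h : T.Quad a b c d) :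
    Triangulation n where
  diagonals := insert s(b, d) (T.diagonals.erase s(a, c))
  isDiagonal e he := by
    rcases Finset.mem_insert.1 he with rfl | he
    · exact h.cyc.rotate.isDiagonal
    · exact T.isDiagonal e (Finset.mem_of_mem_erase he)
  noncrossing := by
    have key : ∀ f ∈ T.diagonals.erase s(a, c), ¬ Crosses s(b, d) f := by
      intro f hf hc
      have hf' : T.IsEdge f := .inr (Finset.mem_of_mem_erase hf)
      exact Finset.ne_of_mem_erase hf (eq_of_crosses_of_not_crosses h.cyc hc
        (h.ab.not_crosses hf') (h.bc.not_crosses hf') (h.cd.not_crosses hf')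
        (h.da.not_crosses hf'))
    intro e he f hf
    rcases Finset.mem_insert.1 he with rfl | he <;> rcases Finset.mem_insert.1 hf with rfl | hf
    · rw [crosses_mk]
      unfold Cyc4
      omega
    · exact key f hf
    · exact fun hc => key e he hc.symm
    · exact T.noncrossing e (Finset.mem_of_mem_erase he) f (Finset.mem_of_mem_erase hf)
  maximal := by
    intro e he hf
    by_contra hne
    simp only [Finset.mem_insert, Finset.mem_erase, not_or, not_and] at hne hf
    have hside : ∀ x y, T.IsEdge s(x, y) → s(x, y) ≠ s(a, c) → ¬ Crosses s(x, y) e := by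
      rintro x y (hxy | hxy) hxy' hc
      · exact not_crosses_of_isSide hxy hc
      · exact hf _ (.inr ⟨hxy', hxy⟩) hc.symm
    obtain ⟨h1, h2, h3, h4, h5, h6⟩ := h.cyc.ne_chords
    have hab := hside _ _ h.ab (by simp [h2, h5])
    have hbc := hside _ _ h.bc (by simp [h1.symm, h5.symm])
    have hcd := hside _ _ h.cd (by simp [h4, h3.symm, h5.symm])
    have hda := hside _ _ h.da (by simp [h4, h3.symm, h5])
    -- if `e` crosses `ac`, it is `bd`; otherwise it crosses no diagonal of `T`
    by_cases hx : Crosses e s(a, c)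
    · exact hne.1 (eq_of_crosses_of_not_crosses h.cyc.rotate
        (by rw [Sym2.eq_swap]; exact hx.symm) hbc hcd hda hab)
    · have hxT : ∀ f ∈ T.diagonals, ¬ Crosses e f := by
        intro f hfT
        by_cases hfe : f = s(a, c)
        · exact hfe ▸ hx
        · exact hf f (.inr ⟨hfe, hfT⟩)
      have heT := T.maximal e he hxT
      by_cases hea : e = s(a, c)
      · subst hea
        exact hf _ (.inl rfl) (crosses_mk.2 (.inl h.cyc))
      · exact hne.2 hea heT

end Triangulation

/-! ### The quiver of a triangulation, and flips -/

/-- The indicator function of the chord `e`. -/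
def chordIndicator {N : ℕ} (e f : Sym2 (Fin N)) : ℤ := if f = e then 1 else 0

/-- For a function `g` on chords, the contribution `g(pq) - g(qr)` of the triangle `pqr` to the
entry at `pr` of the row of the exchange matrix determined by `g`. -/
def triangleEntry {N : ℕ} (g : Sym2 (Fin N) → ℤ) (p q r : Fin N) : ℤ := g s(p, q) - g s(q, r)

/-- The entry at the diagonal `ac` of the quadrilateral `abcd` of the row of the exchange matrix
determined by the function `g` on chords; this is a shear coordinate. -/
def quadEntry {N : ℕ} (g : Sym2 (Fin N) → ℤ) (a b c d : Fin N) : ℤ :=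
  triangleEntry g a b c + triangleEntry g c d a

theorem quadEntry_rotate {N : ℕ} (g : Sym2 (Fin N) → ℤ) (a b c d : Fin N) :
    quadEntry g b c d a = -quadEntry g a b c d := by
  unfold quadEntry triangleEntry
  ring

theorem quadEntry_rotate_rotate {N : ℕ} (g : Sym2 (Fin N) → ℤ) (a b c d : Fin N) :
    quadEntry g c d a b = quadEntry g a b c d := by
  rw [quadEntry_rotate, quadEntry_rotate, neg_neg]

namespace Triangulation

variable {n : ℕ} {T : Triangulation n}

theorem hasArrow_iff {e f : Sym2 (Fin (n + 3))} : T.HasArrow e f ↔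
    ∃ i j k, Cyc3 i j k ∧ T.IsEdge s(i, j) ∧ T.IsEdge s(j, k) ∧ T.IsEdge s(k, i) ∧
      e = s(i, j) ∧ f = s(k, i) := by
  constructor
  · rintro ⟨i, j, k, h1, h2, hij, hjk, hki, ⟨he, hf⟩ | ⟨he, hf⟩ | ⟨he, hf⟩⟩
    · exact ⟨i, j, k, .inl ⟨h1, h2⟩, hij, hjk, hki, he, hf⟩
    · exact ⟨k, i, j, .inr (.inl ⟨h1, h2⟩), hki, hij, hjk, he, hf⟩
    · exact ⟨j, k, i, .inr (.inr ⟨h1, h2⟩), hjk, hki, hij, he, hf⟩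
  · rintro ⟨i, j, k, h | h | h, hij, hjk, hki, he, hf⟩
    · exact ⟨i, j, k, h.1, h.2, hij, hjk, hki, .inl ⟨he, hf⟩⟩
    · exact ⟨j, k, i, h.1, h.2, hjk, hki, hij, .inr (.inl ⟨he, hf⟩)⟩
    · exact ⟨k, i, j, h.1, h.2, hki, hij, hjk, .inr (.inr ⟨he, hf⟩)⟩

theorem Quad.hasArrow_left {a b c d : Fin (n + 3)} (h : T.Quad a b c d)
    {e : Sym2 (Fin (n + 3))} : T.HasArrow e s(a, c) ↔ e = s(a, b) ∨ e = s(c, d) := by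
  rw [hasArrow_iff]
  constructor
  · rintro ⟨i, j, k, hc, hij, hjk, hki, rfl, hf⟩
    rcases Sym2.eq_iff.1 hf with ⟨rfl, rfl⟩ | ⟨rfl, rfl⟩
    · rw [apex_unique hc.rotate.rotate.rotate h.cyc.right.rotate hij hjk h.cd h.da]
      exact .inr rfl
    · rw [apex_unique hc h.cyc.left hij hjk h.ab h.bc]
      exact .inl rfl
  · rintro (rfl | rfl)
    · exact ⟨a, b, c, h.cyc.left, h.ab, h.bc, h.ac.symm, rfl, Sym2.eq_swap⟩
    · exact ⟨c, d, a, h.cyc.right.rotate, h.cd, h.da, h.ac, rfl, rfl⟩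

theorem Quad.hasArrow_right {a b c d : Fin (n + 3)} (h : T.Quad a b c d)
    {e : Sym2 (Fin (n + 3))} : T.HasArrow s(a, c) e ↔ e = s(b, c) ∨ e = s(d, a) := by
  rw [hasArrow_iff]
  constructor
  · rintro ⟨i, j, k, hc, hij, hjk, hki, hf, rfl⟩
    rcases Sym2.eq_iff.1 hf with ⟨rfl, rfl⟩ | ⟨rfl, rfl⟩
    · rw [apex_unique hc.rotate h.cyc.right.rotate hjk hki h.cd h.da]
      exact .inr rfl
    · rw [apex_unique hc.rotate h.cyc.left hjk hki h.ab h.bc]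
      exact .inl rfl
  · rintro (rfl | rfl)
    · exact ⟨c, a, b, h.cyc.left.rotate.rotate, h.ac.symm, h.ab, h.bc, Sym2.eq_swap, rfl⟩
    · exact ⟨a, c, d, h.cyc.right, h.ac, h.cd, h.da, rfl, rfl⟩

/-- The rows of the exchange matrix of a triangulation are determined by the indicator functions
of its diagonals. -/
theorem Quad.arrows_eq {a b c d : Fin (n + 3)} (h : T.Quad a b c d) (e : Sym2 (Fin (n + 3))) :
    T.arrows e s(a, c) = quadEntry (chordIndicator e) a b c d := by
  obtain ⟨h1, h2, h3, h4, h5, h6⟩ := h.cyc.ne_chords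
  have h7 : s(a, b) ≠ s(c, d) := by simp [h5, h4.symm]
  have h8 : s(b, c) ≠ s(d, a) := by simp [h6, h1.symm]
  unfold arrows quadEntry triangleEntry chordIndicator
  simp only [h.hasArrow_left, h.hasArrow_right]
  simp only [eq_comm (a := e)]
  by_cases hab : s(a, b) = e <;> by_cases hcd : s(c, d) = e <;> by_cases hbc : s(b, c) = e <;>
    by_cases hda : s(d, a) = e <;> simp [hab, hcd, hbc, hda] <;> grind

theorem arrows_skew (T : Triangulation n) (e f : Sym2 (Fin (n + 3))) :
    T.arrows e f = -T.arrows f e := by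
  unfold arrows
  ring

theorem flip_isEdge {a b c d : Fin (n + 3)} (h : T.Quad a b c d) {e : Sym2 (Fin (n + 3))} :
    (T.flip h).IsEdge e ↔ e = s(b, d) ∨ (T.IsEdge e ∧ e ≠ s(a, c)) := by
  unfold IsEdge flip
  simp only [Finset.mem_insert, Finset.mem_erase]
  have := h.cyc.isDiagonal.2
  constructor
  · rintro (he | he | he)
    · exact .inr ⟨.inl he, fun h' => this (h' ▸ he)⟩
    · exact .inl he
    · exact .inr ⟨.inr he.2, he.1⟩
  · tauto

theorem Quad.flip {a b c d : Fin (n + 3)} (h : T.Quad a b c d) : (T.flip h).Quad b c d a := by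
  obtain ⟨h1, h2, h3, h4, h5, h6⟩ := h.cyc.ne_chords
  refine ⟨h.cyc.rotate, ?_, ?_, ?_, ?_, ?_⟩ <;> rw [flip_isEdge]
  · exact .inr ⟨h.bc, by simp [h1.symm, h5.symm]⟩
  · exact .inr ⟨h.cd, by simp [h5.symm, h4]⟩
  · exact .inr ⟨h.da, by simp [h4, h3.symm]⟩
  · exact .inr ⟨h.ab, by simp [h2, h5]⟩
  · exact .inl rfl

theorem flip_flip {a b c d : Fin (n + 3)} (h : T.Quad a b c d) : (T.flip h).flip h.flip = T := by
  ext e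
  have h1 := h.mem
  have h2 : s(b, d) ∉ T.diagonals := fun hbd =>
    T.noncrossing _ h1 _ hbd (crosses_mk.2 (.inl h.cyc))
  simp only [Triangulation.flip, Finset.mem_insert, Finset.mem_erase, Sym2.eq_swap (a := c)]
  grind

/-- The contribution of a triangle to a row of the exchange matrix changes under a flip by the
rule of quiver mutation, provided that the row is given by a function `g` satisfying the tropical
Ptolemy relation on the quadrilateral of the flip. -/
theorem triangleEntry_flip {a b c d : Fin (n + 3)} (h : T.Quad a b c d)
    {g : Sym2 (Fin (n + 3)) → ℤ}
    (hg : g s(a, c) + g s(b, d) = min (g s(a, b) + g s(c, d)) (g s(b, c) + g s(d, a)))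
    {p q r : Fin (n + 3)} (hc : Cyc3 p q r) (hpq : (T.flip h).IsEdge s(p, q))
    (hqr : (T.flip h).IsEdge s(q, r)) (hpr : (T.flip h).IsEdge s(p, r)) (hne : s(p, r) ≠ s(b, d)) :
    ∃ q₀, Cyc3 p q₀ r ∧ T.IsEdge s(p, q₀) ∧ T.IsEdge s(q₀, r) ∧
      ((triangleEntry (chordIndicator s(a, c)) p q₀ r = 0 ∧
        triangleEntry g p q r = triangleEntry g p q₀ r) ∨
      (s(p, q₀) = s(a, c) ∧ triangleEntry (chordIndicator s(a, c)) p q₀ r = 1 ∧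
        triangleEntry g p q r = triangleEntry g p q₀ r + max (quadEntry g a b c d) 0) ∨
      (s(q₀, r) = s(a, c) ∧ triangleEntry (chordIndicator s(a, c)) p q₀ r = -1 ∧
        triangleEntry g p q r = triangleEntry g p q₀ r - max (-quadEntry g a b c d) 0)) := by
  obtain ⟨h1, h2, h3, h4, h5, h6⟩ := h.cyc.ne_chords
  have hF := h.flip
  have hF' := hF.rotate
  by_cases hpq' : s(p, q) = s(b, d)
  · rcases Sym2.eq_iff.1 hpq' with ⟨rfl, rfl⟩ | ⟨rfl, rfl⟩
    · obtain rfl : r = a := apex_unique hc.rotate hF.cyc.right.rotate hqr hpr.symm hF.cd hF.da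
      refine ⟨c, h.cyc.left.rotate, h.bc, h.ac.symm, .inr (.inr ⟨Sym2.eq_swap, ?_, ?_⟩)⟩
      · simp [triangleEntry, chordIndicator, h1.symm, h5.symm]
      · unfold quadEntry triangleEntry
        rw [Sym2.eq_swap (a := c) (b := r)]
        omega
    · obtain rfl : r = c := apex_unique hc.rotate hF'.cyc.right.rotate hqr hpr.symm hF'.cd hF'.da
      refine ⟨a, h.cyc.right.rotate.rotate, h.da, h.ac, .inr (.inr ⟨rfl, ?_, ?_⟩)⟩
      · simp [triangleEntry, chordIndicator, h4, h3.symm]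
      · unfold quadEntry triangleEntry
        rw [Sym2.eq_swap (a := p) (b := q)]
        omega
  by_cases hqr' : s(q, r) = s(b, d)
  · rcases Sym2.eq_iff.1 hqr' with ⟨rfl, rfl⟩ | ⟨rfl, rfl⟩
    · obtain rfl : p = a := apex_unique hc.rotate.rotate hF.cyc.right.rotate hpr.symm hpq
        hF.cd hF.da
      refine ⟨c, h.cyc.right, h.ac, h.cd, .inr (.inl ⟨rfl, ?_, ?_⟩)⟩
      · simp [triangleEntry, chordIndicator, h5.symm, h4]
      · unfold quadEntry triangleEntry
        omega
    · obtain rfl : p = c := apex_unique hc.rotate.rotate hF'.cyc.right.rotate hpr.symm hpq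
        hF'.cd hF'.da
      refine ⟨a, h.cyc.left.rotate.rotate, h.ac.symm, h.ab, .inr (.inl ⟨Sym2.eq_swap, ?_, ?_⟩)⟩
      · simp [triangleEntry, chordIndicator, h5, h2]
      · unfold quadEntry triangleEntry
        rw [Sym2.eq_swap (a := q) (b := r), Sym2.eq_swap (a := p) (b := a)]
        omega
  have e1 := (flip_isEdge h).1 hpq
  have e2 := (flip_isEdge h).1 hqr
  refine ⟨q, hc, (e1.resolve_left hpq').1, (e2.resolve_left hqr').1, .inl ⟨?_, rfl⟩⟩
  simp only [triangleEntry, chordIndicator, (e1.resolve_left hpq').2, (e2.resolve_left hqr').2,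
    if_false, sub_zero]

/-- Rows of the exchange matrix given by solutions of the tropical Ptolemy relation obey the
rule of quiver mutation under flips. -/
theorem quadEntry_flip {a b c d : Fin (n + 3)} (h : T.Quad a b c d)
    {g : Sym2 (Fin (n + 3)) → ℤ}
    (hg : g s(a, c) + g s(b, d) = min (g s(a, b) + g s(c, d)) (g s(b, c) + g s(d, a)))
    {p q r s : Fin (n + 3)} (hQ : (T.flip h).Quad p q r s) (hne : s(p, r) ≠ s(b, d)) :
    ∃ q₀ s₀, T.Quad p q₀ r s₀ ∧ quadEntry g p q r s = quadEntry g p q₀ r s₀ +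
      (max (quadEntry g a b c d) 0 * max (quadEntry (chordIndicator s(a, c)) p q₀ r s₀) 0
        - max (-quadEntry (chordIndicator s(a, c)) p q₀ r s₀) 0 *
          max (-quadEntry g a b c d) 0) := by
  obtain ⟨q₀, hq, hpq, hqr, hqq⟩ := triangleEntry_flip h hg hQ.cyc.left hQ.ab hQ.bc hQ.ac hne
  obtain ⟨s₀, hs, hrs, hsp, hss⟩ := triangleEntry_flip h hg hQ.cyc.right.rotate hQ.cd hQ.da
    hQ.ac.symm (by rwa [Sym2.eq_swap])
  have hcyc : Cyc4 p q₀ r s₀ := hq.trans hs.rotate.rotate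
  obtain ⟨h1, h2, h3, h4, h5, h6⟩ := hcyc.ne_chords
  have hpr : T.IsEdge s(p, r) := (((flip_isEdge h).1 hQ.ac).resolve_left hne).1
  refine ⟨q₀, s₀, ⟨hcyc, hpq, hqr, hrs, hsp, hpr⟩, ?_⟩
  rw [quadEntry, quadEntry.eq_1 g p, quadEntry.eq_1 (chordIndicator s(a, c))]
  rcases hqq with ⟨x, y⟩ | ⟨w, x, y⟩ | ⟨w, x, y⟩ <;> rcases hss with ⟨x', y'⟩ | ⟨w', x', y'⟩ | ⟨w', x', y'⟩
  · simp [x, x', y, y']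
  · simp [x, x', y, y']; ring
  · simp [x, x', y, y']; ring
  · simp [x, x', y, y']; ring
  · rw [← w', Sym2.eq_iff] at w; grind
  · rw [← w', Sym2.eq_iff] at w; grind
  · simp [x, x', y, y']; ring
  · rw [← w', Sym2.eq_iff] at w; grind
  · rw [← w', Sym2.eq_iff] at w; grind

/-! ### The fan triangulation and connectedness under flips -/

theorem eq_of_subset {T' : Triangulation n} (h : T.diagonals ⊆ T'.diagonals) : T = T' := by
  ext e
  exact ⟨fun he => h he, fun he => T.maximal e (T'.isDiagonal e he) fun f hf =>
    T'.noncrossing e he f (h hf)⟩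

/-- `T'` is obtained from `T` by a flip. -/
def FlipStep (T T' : Triangulation n) : Prop :=
  ∃ (a b c d : Fin (n + 3)) (h : T.Quad a b c d), T' = T.flip h

theorem FlipStep.symm {T' : Triangulation n} (h : FlipStep T T') : FlipStep T' T := by
  obtain ⟨a, b, c, d, h, rfl⟩ := h
  exact ⟨b, c, d, a, h.flip, (flip_flip h).symm⟩

open Classical in
/-- The triangulation by all diagonals at the vertex `0`. -/
noncomputable def fan (n : ℕ) : Triangulation n where
  diagonals := {e | IsDiagonal e ∧ 0 ∈ e}
  isDiagonal e he := by
    simp only [Finset.mem_filter] at he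
    exact he.2.1
  noncrossing e he f hf := by
    rintro ⟨a, b, c, d, h1, h2, h3, ⟨rfl, rfl⟩ | ⟨rfl, rfl⟩⟩ <;>
    · simp only [Finset.mem_filter, Finset.mem_univ, true_and, Sym2.mem_iff, Fin.ext_iff,
        Fin.val_zero] at he hf
      omega
  maximal e he hf := by
    simp only [Finset.mem_filter, Finset.mem_univ, true_and] at hf ⊢
    refine ⟨he, ?_⟩
    by_contra h0
    have key : ∀ p q : Fin (n + 3), p < q → e = s(p, q) → False := by
      rintro p q hpq rfl
      have hp := p.isLt
      have hq := q.isLt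
      simp only [Sym2.mem_iff, not_or, Fin.ext_iff, Fin.val_zero] at h0
      have h1 := he.2
      rw [isSide_mk] at h1
      have hc : Cyc4 0 p ⟨p + 1, by omega⟩ q := by
        left
        simp only [Fin.lt_def, Fin.val_zero]
        omega
      exact hf s(0, ⟨p + 1, by omega⟩) ⟨hc.isDiagonal, by simp⟩ (crosses_mk.2 (.inr hc.rotate))
    induction e with | _ p q
    rcases lt_trichotomy p q with h | h | h
    · exact key p q h rfl
    · exact he.1 (by simp [h])
    · exact key q p h Sym2.eq_swap

theorem eq_fan (h : ∀ k, k ≠ 0 → T.IsEdge s(0, k)) : T = fan n := by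
  refine (eq_of_subset fun e he => ?_).symm
  simp only [fan, Finset.mem_filter, Finset.mem_univ, true_and] at he
  obtain ⟨k, rfl⟩ := Sym2.mem_iff_exists.1 he.2
  refine (h k ?_).mem_diagonals he.1
  rintro rfl
  exact he.1.1 (by simp)

/-- A triangulation that is not the fan at `0` has a flip creating a new diagonal at `0`. -/
theorem exists_quad_zero (h : T ≠ fan n) : ∃ b c d, T.Quad b c d 0 := by
  classical
  have h' := mt eq_fan h
  push Not at h'
  obtain ⟨k, hk0, hk⟩ := h'
  have hk0' : 0 < k.val := Nat.pos_of_ne_zero fun h => hk0 (Fin.ext h)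
  -- `q` is the first vertex after `k` that is joined to `0`
  let A : Finset (Fin (n + 3)) := {q | k < q ∧ T.IsEdge s(0, q)}
  have hlast : Fin.last (n + 2) ∈ A := by
    simp only [A, Finset.mem_filter, Finset.mem_univ, true_and]
    have h1 : T.IsEdge s(0, Fin.last (n + 2)) := .inl (isSide_mk.2 (by simp))
    refine ⟨lt_of_le_of_ne (Fin.le_last k) ?_, h1⟩
    rintro rfl
    exact hk h1
  obtain ⟨q, hq, hmin⟩ := A.exists_min_image id ⟨_, hlast⟩
  simp only [A, Finset.mem_filter, Finset.mem_univ, true_and, id] at hq hmin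
  obtain ⟨p, hp, h0p, hpq⟩ := hq.2.exists_apex (l := k) (.inl ⟨by rwa [Fin.lt_def], hq.1⟩)
  have hp' : 0 < p ∧ p < q := by
    unfold Cyc3 at hp
    simp only [Fin.lt_def, Fin.val_zero] at *
    omega
  have hpk : p < k := by
    by_contra hkp
    rcases lt_or_eq_of_le (not_lt.1 hkp) with hlt | rfl
    · exact absurd (hmin p ⟨hlt, h0p⟩) (not_le.2 hp'.2)
    · exact hk h0p
  obtain ⟨c, hc, hpc, hcq⟩ := hpq.exists_apex (l := k) (.inl ⟨hpk, hq.1⟩)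
  exact ⟨p, c, q, hc.trans hp.rotate, hpc, hcq, hq.2.symm, h0p, hpq⟩

/-- Each flip that creates a diagonal at `0` destroys none, so that iterating such flips ends in the
fan. -/
theorem flip_connected_fan (T : Triangulation n) : Relation.ReflTransGen FlipStep T (fan n) := by
  classical
  induction hm : Finset.card {k | ¬ T.IsEdge s(0, k)} using Nat.strong_induction_on
    generalizing T with
  | _ m ih =>
  by_cases hT : T = fan n
  · rw [hT]
  obtain ⟨b, c, d, h⟩ := exists_quad_zero hT
  refine .head ⟨b, c, d, 0, h, rfl⟩ (ih _ ?_ (T.flip h) rfl)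
  rw [← hm]
  apply Finset.card_lt_card
  rw [Finset.ssubset_iff_of_subset]
  · refine ⟨c, ?_, ?_⟩
    · simp only [Finset.mem_filter, Finset.mem_univ, true_and]
      exact fun h0 => h.ac.not_cyc4 h0.symm h.cyc
    · simp only [Finset.mem_filter, Finset.mem_univ, true_and, not_not, flip_isEdge]
      exact .inl Sym2.eq_swap
  · intro k
    simp only [Finset.mem_filter, Finset.mem_univ, true_and, flip_isEdge]
    intro h1 h2
    refine h1 (.inr ⟨h2, ?_⟩)
    obtain ⟨-, -, h3, h4, -, -⟩ := h.cyc.ne_chords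
    simp [h4, h3.symm]

theorem flip_connected (T T' : Triangulation n) : Relation.ReflTransGen FlipStep T T' := by
  have : Std.Symm (FlipStep (n := n)) := ⟨fun _ _ h => h.symm⟩
  exact (flip_connected_fan T).trans (Std.Symm.symm _ _ (flip_connected_fan T'))

end Triangulation

/-! ### Quivers of triangulations under mutation -/

namespace IceQuiver

variable {ι κ : Type*} {n : ℕ}

/-- The mutable part of `Q` is the quiver of the triangulation `T`, the mutable vertex `i`
corresponding to the diagonal `δ i`. -/
structure Realizes (Q : IceQuiver ι κ) (T : Triangulation n) (δ : ι → Sym2 (Fin (n + 3))) :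
    Prop where
  injective : Function.Injective δ
  range_eq : Set.range δ = (T.diagonals : Set (Sym2 (Fin (n + 3))))
  b_eq : ∀ i j, Q.b (Sum.inl i) (Sum.inl j) = T.arrows (δ i) (δ j)

/-- The row of the frozen vertex `f` in the exchange matrix of `Q` is the one determined by the
function `g` on the edges of `T`. -/
def RowRealizes (Q : IceQuiver ι κ) (T : Triangulation n) (δ : ι → Sym2 (Fin (n + 3))) (f : κ)
    (g : Sym2 (Fin (n + 3)) → ℤ) : Prop :=
  ∀ k a b c d, T.Quad a b c d → δ k = s(a, c) →
    Q.b (Sum.inr f) (Sum.inl k) = quadEntry g a b c d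

theorem b_self (Q : IceQuiver ι κ) (i : ι ⊕ κ) : Q.b i i = 0 := by
  have := Q.skew i i
  omega

theorem Realizes.mem {Q : IceQuiver ι κ} {T : Triangulation n} {δ : ι → Sym2 (Fin (n + 3))}
    (h : Q.Realizes T δ) (i : ι) : δ i ∈ T.diagonals := by
  rw [← Finset.mem_coe, ← h.range_eq]
  exact Set.mem_range_self i

theorem Realizes.mutate_range [DecidableEq ι] {Q : IceQuiver ι κ} {T : Triangulation n}
    {δ : ι → Sym2 (Fin (n + 3))} (hQ : Q.Realizes T δ) {k : ι} {a b c d : Fin (n + 3)}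
    (h : T.Quad a b c d) (hk : δ k = s(a, c)) :
    Set.range (Function.update δ k s(b, d)) =
      ((T.flip h).diagonals : Set (Sym2 (Fin (n + 3)))) := by
  ext e
  simp only [Triangulation.flip, Finset.coe_insert, Finset.coe_erase, Set.mem_insert_iff,
    Set.mem_sdiff, Set.mem_singleton_iff, ← hQ.range_eq, ← hk]
  constructor
  · rintro ⟨i, rfl⟩
    by_cases hi : i = k
    · simp [hi]
    · right
      rw [Function.update_of_ne hi]
      exact ⟨⟨i, rfl⟩, hQ.injective.ne hi⟩
  · rintro (rfl | ⟨⟨i, rfl⟩, hi⟩)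
    · exact ⟨k, by simp⟩
    · exact ⟨i, Function.update_of_ne (fun h => hi (by rw [h])) _ _⟩

variable [DecidableEq ι] [DecidableEq κ]

theorem mutate_b_right (Q : IceQuiver ι κ) (k : ι) (i : ι ⊕ κ) :
    (Q.mutate k).b i (Sum.inl k) = -Q.b i (Sum.inl k) := by
  simp [mutate]

theorem mutate_b_left (Q : IceQuiver ι κ) (k : ι) (i : ι ⊕ κ) :
    (Q.mutate k).b (Sum.inl k) i = -Q.b (Sum.inl k) i := by
  simp [mutate]

theorem mutate_b_of_ne (Q : IceQuiver ι κ) {k j : ι} {i : ι ⊕ κ} (hi : i ≠ Sum.inl k)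
    (hj : j ≠ k) : (Q.mutate k).b i (Sum.inl j) = Q.b i (Sum.inl j) +
      (max (Q.b i (Sum.inl k)) 0 * max (Q.b (Sum.inl k) (Sum.inl j)) 0
      - max (Q.b (Sum.inl j) (Sum.inl k)) 0 * max (Q.b (Sum.inl k) i) 0) := by
  simp [mutate, hi, hj]

theorem mutate_mutate (Q : IceQuiver ι κ) (k : ι) : (Q.mutate k).mutate k = Q := by
  obtain ⟨b, hs, hf⟩ := Q
  simp only [mutate, IceQuiver.mk.injEq]
  funext i j
  by_cases hi : i = Sum.inl k
  · simp [hi]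
  by_cases hj : j = Sum.inl k
  · simp [hj]
  by_cases hij : i.isRight ∧ j.isRight
  · obtain ⟨i, rfl⟩ := Sum.isRight_iff.1 hij.1
    obtain ⟨j, rfl⟩ := Sum.isRight_iff.1 hij.2
    simp [hf]
  · have h1 := hs i (Sum.inl k)
    have h2 := hs j (Sum.inl k)
    simp only [hi, hj, hij, or_self, if_false, or_true, true_or, if_true]
    rw [h1, h2]
    ring_nf

variable {Q : IceQuiver ι κ} {T : Triangulation n} {δ : ι → Sym2 (Fin (n + 3))}

/-- A row given by a solution of the tropical Ptolemy relation mutates under flips by the rule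
of quiver mutation. -/
theorem Realizes.row_mutate (hQ : Q.Realizes T δ) {k : ι} {a b c d : Fin (n + 3)}
    (h : T.Quad a b c d) (hk : δ k = s(a, c)) {g : Sym2 (Fin (n + 3)) → ℤ}
    (hg : g s(a, c) + g s(b, d) = min (g s(a, b) + g s(c, d)) (g s(b, c) + g s(d, a)))
    {i : ι ⊕ κ} (hi : i ≠ Sum.inl k)
    (hrow : ∀ j a b c d, T.Quad a b c d → δ j = s(a, c) →
      Q.b i (Sum.inl j) = quadEntry g a b c d) :
    ∀ j p q r s, (T.flip h).Quad p q r s → Function.update δ k s(b, d) j = s(p, r) →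
      (Q.mutate k).b i (Sum.inl j) = quadEntry g p q r s := by
  intro j p q r s hq hjk
  by_cases hjk' : j = k
  · subst hjk'
    rw [mutate_b_right, hrow j _ _ _ _ h hk]
    rw [Function.update_self] at hjk
    rcases Sym2.eq_iff.1 hjk with ⟨rfl, rfl⟩ | ⟨rfl, rfl⟩
    · obtain ⟨rfl, rfl⟩ := h.flip.unique hq
      exact (quadEntry_rotate g _ _ _ _).symm
    · obtain ⟨rfl, rfl⟩ := h.flip.rotate.unique hq
      exact neg_eq_iff_eq_neg.2 (quadEntry_rotate g _ _ _ _)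
  · rw [Function.update_of_ne hjk'] at hjk
    have hne : s(p, r) ≠ s(b, d) := by
      intro hpr
      have := hQ.mem j
      rw [hjk, hpr] at this
      exact T.noncrossing _ h.mem _ this (crosses_mk.2 (.inl h.cyc))
    obtain ⟨q₀, s₀, h0, he⟩ := Triangulation.quadEntry_flip h hg hq hne
    rw [he, mutate_b_of_ne _ hi hjk', hrow j _ _ _ _ h0 hjk, hrow k _ _ _ _ h hk,
      hQ.b_eq, Q.skew (Sum.inl j), hQ.b_eq, hk, hjk, h0.arrows_eq, Q.skew (Sum.inl k) i,
      hrow k _ _ _ _ h hk]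

theorem RowRealizes.mutate {f : κ} {g : Sym2 (Fin (n + 3)) → ℤ} (hrow : Q.RowRealizes T δ f g)
    (hQ : Q.Realizes T δ) {k : ι} {a b c d : Fin (n + 3)}
    (h : T.Quad a b c d) (hk : δ k = s(a, c))
    (hg : g s(a, c) + g s(b, d) = min (g s(a, b) + g s(c, d)) (g s(b, c) + g s(d, a))) :
    (Q.mutate k).RowRealizes (T.flip h) (Function.update δ k s(b, d)) f g :=
  hQ.row_mutate h hk hg (by simp) hrow

/-- Mutation at a mutable vertex of the quiver of a triangulation is the flip of the
corresponding diagonal. -/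
theorem Realizes.mutate (hQ : Q.Realizes T δ) {k : ι} {a b c d : Fin (n + 3)}
    (h : T.Quad a b c d) (hk : δ k = s(a, c)) :
    (Q.mutate k).Realizes (T.flip h) (Function.update δ k s(b, d)) := by
  have hbd : s(b, d) ∉ T.diagonals := fun hbd =>
    T.noncrossing _ h.mem _ hbd (crosses_mk.2 (.inl h.cyc))
  have hrange := hQ.mutate_range h hk
  have main : ∀ i j, i ≠ k → (Q.mutate k).b (Sum.inl i) (Sum.inl j) =
      (T.flip h).arrows (Function.update δ k s(b, d) i) (Function.update δ k s(b, d) j) := by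
    intro i j hi
    have hmem : Function.update δ k s(b, d) j ∈ (T.flip h).diagonals := by
      rw [← Finset.mem_coe, ← hrange]
      exact Set.mem_range_self j
    obtain ⟨p, q, r, s, hq, hj⟩ := Triangulation.exists_quad hmem
    have hac : δ i ≠ s(a, c) := hk ▸ hQ.injective.ne hi
    have hbd' : δ i ≠ s(b, d) := fun h' => hbd (h' ▸ hQ.mem i)
    rw [Function.update_of_ne hi, hj, hq.arrows_eq]
    refine hQ.row_mutate h hk ?_ (by simpa using hi) ?_ j _ _ _ _ hq hj
    · -- the indicator of a diagonal other than `ac` and `bd` satisfies the tropical relation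
      have h1 := h.cyc.ne_chords
      simp only [chordIndicator, hac.symm, hbd'.symm, if_false]
      have h2 : s(a, b) ≠ s(b, c) := by simp; grind
      have h3 : s(a, b) ≠ s(d, a) := by simp; grind
      have h4 : s(c, d) ≠ s(b, c) := by simp; grind
      have h5 : s(c, d) ≠ s(d, a) := by simp; grind
      generalize s(a, b) = u, s(b, c) = v, s(c, d) = w, s(d, a) = x at h2 h3 h4 h5 ⊢
      by_cases hu : u = δ i <;> by_cases hv : v = δ i <;> by_cases hw : w = δ i <;>
        by_cases hx : x = δ i <;> simp_all
    · intro j p q r s hq hj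
      rw [hQ.b_eq, hj, hq.arrows_eq]
  refine ⟨?_, hrange, ?_⟩
  · intro i j hij
    by_cases hi : i = k <;> by_cases hj : j = k
    · rw [hi, hj]
    · subst hi
      rw [Function.update_self, Function.update_of_ne hj] at hij
      exact absurd (hij ▸ hQ.mem j) hbd
    · subst hj
      rw [Function.update_self, Function.update_of_ne hi] at hij
      exact absurd (hij ▸ hQ.mem i) hbd
    · rw [Function.update_of_ne hi, Function.update_of_ne hj] at hij
      exact hQ.injective hij
  · intro i j
    by_cases hi : i = k
    · by_cases hj : j = k
      · rw [hi, hj, b_self]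
        unfold Triangulation.arrows
        ring
      · rw [IceQuiver.skew, main j i hj]
        exact (Triangulation.arrows_skew _ _ _).symm
    · exact main i j hi

end IceQuiver

/-! ### A triangulation for each orientation of the Dynkin diagram -/

section Zigzag

variable {n : ℕ} {l : ℕ → ℕ}

theorem zigzag_le (hl : ∀ t < n, l (t + 1) = l t ∨ l (t + 1) + 1 = l t) {s t : ℕ} (hst : s ≤ t)
    (ht : t ≤ n) : l t ≤ l s ∧ l s + s ≤ l t + t := by
  induction t, hst using Nat.le_induction with
  | base => exact ⟨le_rfl, le_rfl⟩
  | succ t hst ih =>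
    have := hl t (by omega)
    have := ih (by omega)
    omega

theorem zigzag_bound (hl : ∀ t < n, l (t + 1) = l t ∨ l (t + 1) + 1 = l t) (hn : l n = 0) {t : ℕ}
    (ht : t ≤ n) : l t + t ≤ n := by
  have := zigzag_le hl ht le_rfl
  omega

/-- The chord joining `l t` to `l t + t + 2`. If `l` decreases by `0` or `1` in each step, these
chords are nested, and consecutive ones have a common endpoint. -/
def zigzagChord (n : ℕ) (l : ℕ → ℕ) (t : ℕ) : Sym2 (Fin (n + 3)) :=
  s(Fin.ofNat (n + 3) (l t), Fin.ofNat (n + 3) (l t + t + 2))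

theorem zigzagChord_eq (hl : ∀ t < n, l (t + 1) = l t ∨ l (t + 1) + 1 = l t) (hn : l n = 0) {t : ℕ}
    (ht : t ≤ n) : zigzagChord n l t =
      s(⟨l t, by have := zigzag_bound hl hn ht; omega⟩,
        ⟨l t + t + 2, by have := zigzag_bound hl hn ht; omega⟩) := by
  have := zigzag_bound hl hn ht
  unfold zigzagChord
  congr 2 <;> ext
  · exact Nat.mod_eq_of_lt (by omega)
  · exact Nat.mod_eq_of_lt (by omega)

theorem mk_eq_zigzagChord (hl : ∀ t < n, l (t + 1) = l t ∨ l (t + 1) + 1 = l t) (hn : l n = 0)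
    {t : ℕ} (ht : t ≤ n) {p q : Fin (n + 3)} (hp : p.val = l t) (hq : q.val = l t + t + 2) :
    s(p, q) = zigzagChord n l t := by
  rw [zigzagChord_eq hl hn ht]
  congr 2 <;> ext
  · exact hp
  · exact hq

theorem zigzagChord_inj (hl : ∀ t < n, l (t + 1) = l t ∨ l (t + 1) + 1 = l t) (hn : l n = 0)
    {s t : ℕ} (hs : s ≤ n) (ht : t ≤ n) (h : zigzagChord n l s = zigzagChord n l t) : s = t := by
  rw [zigzagChord_eq hl hn hs, zigzagChord_eq hl hn ht] at h
  simp only [Sym2.eq_iff, Fin.ext_iff] at h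
  omega

/-- The triangulation by the nested diagonals `zigzagChord n l t`. -/
def zigzagTriangulation (hl : ∀ t < n, l (t + 1) = l t ∨ l (t + 1) + 1 = l t) (hn : l n = 0) :
    Triangulation n where
  diagonals := (Finset.range n).image (zigzagChord n l)
  isDiagonal e he := by
    obtain ⟨t, ht, rfl⟩ := Finset.mem_image.1 he
    rw [Finset.mem_range] at ht
    have := zigzag_bound hl hn ht.le
    rw [zigzagChord_eq hl hn ht.le, IsDiagonal, isSide_mk]
    simp only [Sym2.mk_isDiag_iff, Fin.ext_iff]
    omega
  noncrossing e he f hf := by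
    obtain ⟨s, hs, rfl⟩ := Finset.mem_image.1 he
    obtain ⟨t, ht, rfl⟩ := Finset.mem_image.1 hf
    rw [Finset.mem_range] at hs ht
    rw [zigzagChord_eq hl hn hs.le, zigzagChord_eq hl hn ht.le, crosses_mk]
    unfold Cyc4
    simp only [Fin.lt_def]
    rcases le_total s t with h | h
    · have := zigzag_le hl h ht.le
      omega
    · have := zigzag_le hl h hs.le
      omega
  maximal e he hf := by
    have key : ∀ p q : Fin (n + 3), p < q → e = s(p, q) →
        e ∈ (Finset.range n).image (zigzagChord n l) := by
      rintro p q hpq rfl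
      have hd := he.2
      rw [isSide_mk] at hd
      have hp := p.isLt
      have hq := q.isLt
      -- compare with the shortest chord of the chain (prolonged by a side) that encloses `e`
      have hex : ∃ t, t ≤ n ∧ l t ≤ p.val ∧ q.val ≤ l t + t + 2 := ⟨n, le_rfl, by omega, by omega⟩
      classical
      obtain ⟨ht, htp, htq⟩ := Nat.find_spec hex
      have hmin := fun s => Nat.find_min hex (m := s)
      generalize Nat.find hex = t at *
      have hmem : p.val = l t → q.val = l t + t + 2 → t < n →
          s(p, q) ∈ (Finset.range n).image (zigzagChord n l) := fun h1 h2 h3 =>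
        Finset.mem_image.2 ⟨t, Finset.mem_range.2 h3, (mk_eq_zigzagChord hl hn ht h1 h2).symm⟩
      have htn : p.val = l t → q.val = l t + t + 2 → t < n := by
        intro h1 h2
        refine lt_of_le_of_ne ht fun h3 => ?_
        subst h3
        omega
      rcases t with _ | t
      · have h1 : p.val = l 0 := by omega
        have h2 : q.val = l 0 + 0 + 2 := by omega
        exact hmem h1 h2 (htn h1 h2)
      · have hlt := hl t (by omega)
        have := hmin t (by omega)
        have hc := hf (zigzagChord n l t) (Finset.mem_image.2 ⟨t, Finset.mem_range.2 (by omega), rfl⟩)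
        rw [zigzagChord_eq hl hn (by omega), crosses_mk] at hc
        have hb := zigzag_bound hl hn (t := t) (by omega)
        rw [Fin.lt_def] at hpq
        rcases hlt with hlt | hlt
        · have h2 : q.val = l (t + 1) + (t + 1) + 2 := by omega
          have h1 : p.val = l (t + 1) := by
            by_contra h1
            refine hc (.inr (.inr (.inr (.inr ?_))))
            simp only [Fin.lt_def]
            omega
          exact hmem h1 h2 (htn h1 h2)
        · have h1 : p.val = l (t + 1) := by omega
          have h2 : q.val = l (t + 1) + (t + 1) + 2 := by
            by_contra h2
            refine hc (.inl (.inl ?_))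
            simp only [Fin.lt_def]
            omega
          exact hmem h1 h2 (htn h1 h2)
    induction e with | _ p q
    rcases lt_trichotomy p q with h | h | h
    · exact key p q h rfl
    · exact absurd he.1 (by simp [h])
    · exact key q p h Sym2.eq_swap

theorem zigzagTriangulation_isEdge (hl : ∀ t < n, l (t + 1) = l t ∨ l (t + 1) + 1 = l t)
    (hn : l n = 0) {t : ℕ} (ht : t ≤ n) :
    (zigzagTriangulation hl hn).IsEdge (zigzagChord n l t) := by
  rcases lt_or_eq_of_le ht with h | rfl
  · exact .inr (Finset.mem_image.2 ⟨t, Finset.mem_range.2 h, rfl⟩)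
  · rw [zigzagChord_eq hl hn ht]
    exact .inl (isSide_mk.2 (by simp [hn]))

theorem zigzagTriangulation_arrows (hl : ∀ t < n, l (t + 1) = l t ∨ l (t + 1) + 1 = l t)
    (hn : l n = 0) {s t : ℕ} (hs : s < n) (hts : t < s) :
    (zigzagTriangulation hl hn).arrows (zigzagChord n l s) (zigzagChord n l t) =
      if s = t + 1 then (if l (t + 1) = l t then -1 else 1) else 0 := by
  have ht : t < n := by omega
  have hbt := zigzag_bound hl hn ht.le
  have hbt' := zigzag_bound hl hn (t := t + 1) ht
  have hbs := zigzag_bound hl hn hs.le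
  have hE := zigzagTriangulation_isEdge hl hn ht.le
  have hE' := zigzagTriangulation_isEdge hl hn (t := t + 1) ht
  rw [zigzagChord_eq hl hn ht.le] at hE
  obtain ⟨b, hb, hab, hbc⟩ := hE.exists_apex (l := ⟨l t + 1, by omega⟩) (by
    left; simp only [Fin.lt_def]; omega)
  have hmono := zigzag_le hl (s := t) (t := s) hts.le hs.le
  have hst := zigzagChord_inj hl hn hs.le (t := t + 1) ht
  have hst' : s = t + 1 → zigzagChord n l s = zigzagChord n l (t + 1) := by rintro rfl; rfl
  rw [zigzagChord_eq hl hn (t := t + 1) ht] at hE' hst hst'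
  rw [zigzagChord_eq hl hn ht.le]
  have hb' : l t < b.val ∧ b.val < l t + t + 2 := by
    unfold Cyc3 at hb
    simp only [Fin.lt_def] at hb
    omega
  have n1 : ∀ p q : Fin (n + 3), l t ≤ p.val → q.val ≤ l t + t + 2 → p.val < q.val →
      s(p, q) ≠ zigzagChord n l s := by
    intro p q h1 h2 h3 h4
    rw [zigzagChord_eq hl hn hs.le, Sym2.eq_iff] at h4
    simp only [Fin.ext_iff] at h4
    omega
  have nside : ∀ p q : Fin (n + 3), p.val + 1 = q.val → s(p, q) ≠ zigzagChord n l s := by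
    intro p q h1 h4
    rw [zigzagChord_eq hl hn hs.le, Sym2.eq_iff] at h4
    simp only [Fin.ext_iff] at h4
    omega
  -- the next chord of the chain has the new endpoint `l t + t + 3` or `l t - 1`
  rcases hl t ht with h | h
  · have e1 : s((⟨l t + t + 3, by omega⟩ : Fin (n + 3)), ⟨l t, by omega⟩) =
        s(⟨l (t + 1), by omega⟩, ⟨l (t + 1) + (t + 1) + 2, by omega⟩) :=
      Sym2.eq_iff.2 (.inr ⟨Fin.ext (by simp only []; omega), Fin.ext (by simp only []; omega)⟩)
    have hq : (zigzagTriangulation hl hn).Quad ⟨l t, by omega⟩ b ⟨l t + t + 2, by omega⟩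
        ⟨l t + t + 3, by omega⟩ := by
      refine ⟨.inl ⟨?_, ?_, ?_⟩, hab, hbc, .inl (isSide_mk.2 (by simp)), e1 ▸ hE', hE⟩ <;>
      · simp only [Fin.lt_def]
        omega
    rw [hq.arrows_eq, quadEntry, triangleEntry, triangleEntry, e1]
    simp only [chordIndicator]
    rw [if_neg (n1 _ _ le_rfl hb'.2.le hb'.1), if_neg (n1 _ _ hb'.1.le le_rfl hb'.2),
      if_neg (nside ⟨l t + t + 2, by omega⟩ ⟨l t + t + 3, by omega⟩ rfl), if_pos h]
    by_cases hs' : s = t + 1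
    · rw [if_pos (hst' hs').symm, if_pos hs']
      rfl
    · rw [if_neg fun h' => hs' (hst h'.symm), if_neg hs']
      rfl
  · have e1 : s((⟨l t + t + 2, by omega⟩ : Fin (n + 3)), ⟨l (t + 1), by omega⟩) =
        s(⟨l (t + 1), by omega⟩, ⟨l (t + 1) + (t + 1) + 2, by omega⟩) :=
      Sym2.eq_iff.2 (.inr ⟨Fin.ext (by simp only []; omega), rfl⟩)
    have hq : (zigzagTriangulation hl hn).Quad ⟨l t, by omega⟩ b ⟨l t + t + 2, by omega⟩
        ⟨l (t + 1), by omega⟩ := by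
      refine ⟨.inr (.inr (.inr ⟨?_, ?_, ?_⟩)), hab, hbc, e1 ▸ hE',
        .inl (isSide_mk.2 (.inl h)), hE⟩ <;>
      · simp only [Fin.lt_def]
        omega
    rw [hq.arrows_eq, quadEntry, triangleEntry, triangleEntry, e1]
    simp only [chordIndicator]
    rw [if_neg (n1 _ _ le_rfl hb'.2.le hb'.1), if_neg (n1 _ _ hb'.1.le le_rfl hb'.2),
      if_neg (nside ⟨l (t + 1), by omega⟩ ⟨l t, by omega⟩ h),
      if_neg (show ¬ l (t + 1) = l t by omega)]
    by_cases hs' : s = t + 1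
    · rw [if_pos (hst' hs').symm, if_pos hs']
      rfl
    · rw [if_neg fun h' => hs' (hst h'.symm), if_neg hs']
      rfl

end Zigzag

/-- Each orientation of the Dynkin diagram `A_n` is the quiver of a triangulation. -/
theorem IceQuiver.IsDynkinA.exists_realizes {ι κ : Type*} {n : ℕ} {Q : IceQuiver ι κ}
    (h : Q.IsDynkinA n) : ∃ (T : Triangulation n) (δ : ι → Sym2 (Fin (n + 3))),
      Q.Realizes T δ := by
  classical
  obtain ⟨e, he⟩ := h
  -- the chain of diagonals grows to the left in step `t` if the `t`-th arrow points to `e t`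
  let step : ℕ → ℕ := fun t => if ht : t + 1 < n then
    if Q.b (Sum.inl (e ⟨t + 1, ht⟩)) (Sum.inl (e ⟨t, by omega⟩)) = 1 then 1 else 0 else 0
  have hstep : ∀ t, step t ≤ 1 := by
    intro t
    simp only [step]
    split_ifs <;> omega
  let l : ℕ → ℕ := fun t => ∑ s ∈ Finset.Ico t n, step s
  have hl0 : ∀ t < n, l t = step t + l (t + 1) := fun t ht => Finset.sum_eq_sum_Ico_succ_bot ht _
  have hl : ∀ t < n, l (t + 1) = l t ∨ l (t + 1) + 1 = l t := by
    intro t ht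
    have := hl0 t ht
    have := hstep t
    omega
  have hn : l n = 0 := by simp [l]
  let T := zigzagTriangulation hl hn
  have hlt : ∀ i j : Fin n, j < i → Q.b (Sum.inl (e i)) (Sum.inl (e j)) =
      T.arrows (zigzagChord n l i) (zigzagChord n l j) := by
    intro i j hij
    rw [zigzagTriangulation_arrows hl hn i.isLt hij]
    have hb := he i j
    by_cases hij' : i.val = j.val + 1
    · have hi : i = ⟨j.val + 1, by omega⟩ := Fin.ext hij'
      rw [if_pos (by omega), abs_eq zero_le_one] at hb
      rw [if_pos hij']
      have h1 := hl0 j j.isLt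
      have h2 : step j = if Q.b (Sum.inl (e i)) (Sum.inl (e j)) = 1 then 1 else 0 := by
        simp only [step]
        rw [dif_pos (by omega)]
        simp only [hi, Fin.eta]
      rcases hb with hb | hb
      · rw [if_pos hb] at h2
        rw [hb, if_neg (by omega)]
      · rw [hb] at h2 ⊢
        rw [if_neg (by norm_num)] at h2
        rw [if_pos (by omega)]
    · rw [if_neg (by omega), abs_eq_zero] at hb
      rw [if_neg hij', hb]
  refine ⟨T, fun k => zigzagChord n l (e.symm k), ?_, ?_, ?_⟩
  · intro i j hij
    exact e.symm.injective (Fin.ext (zigzagChord_inj hl hn (e.symm i).isLt.le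
      (e.symm j).isLt.le hij))
  · ext f
    simp only [T, zigzagTriangulation, Finset.coe_image, Finset.coe_range, Set.mem_range,
      Set.mem_image, Set.mem_Iio]
    constructor
    · rintro ⟨k, rfl⟩
      exact ⟨e.symm k, (e.symm k).isLt, rfl⟩
    · rintro ⟨t, ht, rfl⟩
      exact ⟨e ⟨t, ht⟩, by simp⟩
  · intro i j
    obtain ⟨i, rfl⟩ := e.surjective i
    obtain ⟨j, rfl⟩ := e.surjective j
    simp only [Equiv.symm_apply_apply]
    rcases lt_trichotomy j i with h | h | h
    · exact hlt i j h
    · rw [h, IceQuiver.b_self, Triangulation.arrows, sub_self]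
    · rw [Q.skew, hlt j i h, T.arrows_skew (zigzagChord n l i)]

/-! ### Mutations of seeds -/

theorem IceQuiver.NoIsolatedMutable.mutate {ι κ : Type*} [DecidableEq ι] [DecidableEq κ]
    {Q : IceQuiver ι κ} (h : Q.NoIsolatedMutable) (k : ι) : (Q.mutate k).NoIsolatedMutable := by
  intro i
  obtain ⟨j, hj⟩ := h i
  by_cases hik : i = k
  · subst hik
    exact ⟨j, by rwa [mutate_b_left, neg_ne_zero]⟩
  by_cases hk : Q.b (Sum.inl k) (Sum.inl i) = 0
  · -- if `i` is not joined to `k`, then no arrow at `i` changes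
    have hk' : Q.b (Sum.inl i) (Sum.inl k) = 0 := by rw [Q.skew, hk, neg_zero]
    refine ⟨j, ?_⟩
    have hjk : j ≠ Sum.inl k := by
      rintro rfl
      exact hj hk'
    rw [IceQuiver.skew, mutate_b_of_ne _ hjk hik, hk, hk', Q.skew j]
    simpa using hj
  · refine ⟨Sum.inl k, ?_⟩
    rw [mutate_b_right, Q.skew, neg_neg]
    exact hk

namespace Seed

variable {F K ι κ : Type*} [Field F] [Field K] [Algebra F K]

theorem x_ne_zero (S : Seed F K ι κ) (i : ι ⊕ κ) : S.x i ≠ 0 := S.algebraicIndependent.ne_zero i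

variable [Fintype ι] [Fintype κ]

open Classical in
/-- A product of powers of the variables of a seed is the value of a monomial. -/
theorem prod_pow_eq_aeval (S : Seed F K ι κ) (u : ι ⊕ κ → ℕ) :
    ∏ i, S.x i ^ u i =
      MvPolynomial.aeval S.x (MvPolynomial.monomial (Finsupp.equivFunOnFinite.symm u) (1 : F)) := by
  rw [MvPolynomial.aeval_monomial, map_one, one_mul, Finsupp.prod_fintype _ _ (by simp)]
  rfl

/-- Two different monomials in the variables of a seed do not add up to zero, in any
characteristic. -/
theorem prod_pow_add_prod_pow_ne_zero (S : Seed F K ι κ) {u v : ι ⊕ κ → ℕ} (h : u ≠ v) :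
    ∏ i, S.x i ^ u i + ∏ i, S.x i ^ v i ≠ 0 := by
  classical
  rw [prod_pow_eq_aeval, prod_pow_eq_aeval, ← map_add]
  intro h0
  have h1 := (injective_iff_map_eq_zero _).1 S.algebraicIndependent _ h0
  have h2 := congrArg (MvPolynomial.coeff (Finsupp.equivFunOnFinite.symm u)) h1
  rw [MvPolynomial.coeff_add, MvPolynomial.coeff_monomial, MvPolynomial.coeff_monomial, if_pos rfl,
    if_neg fun h' => h (Finsupp.equivFunOnFinite.symm.injective h'.symm)] at h2
  simp at h2

/-- `n` elements that generate a field of transcendence degree `n` are algebraically independent. -/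
theorem algebraicIndependent_of_adjoin_eq_top (S : Seed F K ι κ) {x : ι ⊕ κ → K}
    (hx : IntermediateField.adjoin F (Set.range x) = ⊤) : AlgebraicIndependent F x := by
  have hS : ∀ {x : ι ⊕ κ → K}, IntermediateField.adjoin F (Set.range x) = ⊤ →
      Algebra.IsAlgebraic (Algebra.adjoin F (Set.range x)) K := by
    intro x hx
    constructor
    intro a
    have ha : a ∈ IntermediateField.adjoin F (Set.range x) := hx ▸ IntermediateField.mem_top
    obtain ⟨r, hr, s, hs, rfl⟩ := IntermediateField.mem_adjoin_iff_div.1 ha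
    rw [div_eq_mul_inv]
    exact (isAlgebraic_algebraMap (⟨r, hr⟩ : Algebra.adjoin F (Set.range x))).mul
      (isAlgebraic_algebraMap (⟨s, hs⟩ : Algebra.adjoin F (Set.range x))).inv
  have h0 := S.algebraicIndependent.isTranscendenceBasis_iff_isAlgebraic.2 (hS S.adjoin_eq_top)
  have := hS hx
  exact (Algebra.IsAlgebraic.isTranscendenceBasis_of_lift_le_trdeg_of_finite F x h0.lift_cardinalMk_eq_trdeg.le).1

variable [DecidableEq ι] [DecidableEq κ]

/-- A seed can be mutated at each vertex that is not isolated. At an isolated vertex `k`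
the exchange relation `x'_k x_k = 1 + 1` would give `x'_k = 0` in characteristic `2`. -/
theorem exists_isMutation (S : Seed F K ι κ) {k : ι} (hk : ∃ j, S.quiver.b (Sum.inl k) j ≠ 0) :
    ∃ S' : Seed F K ι κ, IsMutation k S S' := by
  obtain ⟨j, hj⟩ := hk
  set P : K := (∏ i, S.x i ^ (S.quiver.b (Sum.inl k) i).toNat) +
      ∏ i, S.x i ^ (S.quiver.b i (Sum.inl k)).toNat with hP
  -- the two monomials have different exponents at `j`
  have hP0 : P ≠ 0 := by
    refine S.prod_pow_add_prod_pow_ne_zero fun h => hj ?_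
    have h1 := congrFun h j
    have h2 := S.quiver.skew (Sum.inl k) j
    omega
  let x : ι ⊕ κ → K := Function.update S.x (Sum.inl k) (P / S.x (Sum.inl k))
  have hxk : x (Sum.inl k) = P / S.x (Sum.inl k) := Function.update_self _ _ _
  have hx : ∀ i, i ≠ Sum.inl k → x i = S.x i := fun i hi => Function.update_of_ne hi _ _
  have hxk0 : x (Sum.inl k) ≠ 0 := by
    rw [hxk]
    exact div_ne_zero hP0 (S.x_ne_zero _)
  have hmem : ∀ i, x i ∈ IntermediateField.adjoin F (Set.range x) := fun i =>
    IntermediateField.subset_adjoin _ _ ⟨i, rfl⟩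
  have htop : IntermediateField.adjoin F (Set.range x) = ⊤ := by
    rw [eq_top_iff, ← S.adjoin_eq_top, IntermediateField.adjoin_le_iff]
    have hne : ∀ i, i ≠ Sum.inl k → S.x i ∈ IntermediateField.adjoin F (Set.range x) :=
      fun i hi => hx i hi ▸ hmem i
    rintro _ ⟨i, rfl⟩
    by_cases hi : i = Sum.inl k
    · subst hi
      have hPm : P ∈ IntermediateField.adjoin F (Set.range x) := by
        refine add_mem (prod_mem fun i _ => ?_) (prod_mem fun i _ => ?_) <;>
        · by_cases hi : i = Sum.inl k
          · rw [hi, S.quiver.b_self, Int.toNat_zero, pow_zero]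
            exact one_mem _
          · exact pow_mem (hne i hi) _
      have : S.x (Sum.inl k) = P / x (Sum.inl k) := by
        rw [hxk, div_div_cancel₀ hP0]
      rw [this]
      exact div_mem hPm (hmem _)
    · exact hne i hi
  refine ⟨⟨x, S.quiver.mutate k, S.algebraicIndependent_of_adjoin_eq_top htop, htop⟩,
    rfl, hx, ?_⟩
  change x (Sum.inl k) * _ = _
  rw [hxk, div_mul_cancel₀ _ (S.x_ne_zero _)]

theorem IsMutation.symm {k : ι} {S S' : Seed F K ι κ} (h : IsMutation k S S') :
    IsMutation k S' S := by
  obtain ⟨h1, h2, h3⟩ := h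
  refine ⟨by rw [h1, IceQuiver.mutate_mutate], fun i hi => (h2 i hi).symm, ?_⟩
  rw [mul_comm, h3, add_comm]
  congr 1 <;> refine Finset.prod_congr rfl fun i _ => ?_ <;> by_cases hi : i = Sum.inl k
  · rw [hi, IceQuiver.b_self, IceQuiver.b_self]
    simp
  · rw [h2 i hi, h1, IceQuiver.mutate_b_left, S.quiver.skew i]
  · rw [hi, IceQuiver.b_self, IceQuiver.b_self]
    simp
  · rw [h2 i hi, h1, IceQuiver.mutate_b_right, S.quiver.skew (Sum.inl k)]

/-- A mutation changes the mutated variable, as its square is not a polynomial in the other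
variables. -/
theorem IsMutation.x_ne {k : ι} {S S' : Seed F K ι κ} (h : IsMutation k S S') :
    S'.x (Sum.inl k) ≠ S.x (Sum.inl k) := by
  intro hk
  have h3 := h.2.2
  rw [hk, ← pow_two, prod_pow_eq_aeval, prod_pow_eq_aeval, ← map_add,
    ← MvPolynomial.aeval_X (R := F) S.x, ← map_pow] at h3
  have h4 := congrArg (MvPolynomial.coeff (Finsupp.single (Sum.inl k) 2)) (S.algebraicIndependent h3)
  rw [MvPolynomial.coeff_X_pow, if_pos rfl, MvPolynomial.coeff_add, MvPolynomial.coeff_monomial,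
    MvPolynomial.coeff_monomial, if_neg, if_neg, add_zero] at h4
  · exact one_ne_zero h4
  · intro h5
    have := DFunLike.congr_fun h5 (Sum.inl k)
    simp [IceQuiver.b_self] at this
  · intro h5
    have := DFunLike.congr_fun h5 (Sum.inl k)
    simp [IceQuiver.b_self] at this

/-- Two labelled seeds are mutation equivalent. -/
def MutationEquivalent (S S' : Seed F K ι κ) : Prop :=
  Relation.ReflTransGen (fun S₁ S₂ => ∃ k, IsMutation k S₁ S₂) S S'

theorem MutationEquivalent.symm {S S' : Seed F K ι κ} (h : MutationEquivalent S S') :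
    MutationEquivalent S' S := by
  have : Std.Symm (fun S₁ S₂ : Seed F K ι κ => ∃ k, IsMutation k S₁ S₂) :=
    ⟨fun _ _ ⟨k, h⟩ => ⟨k, h.symm⟩⟩
  exact Relation.ReflTransGen.stdSymm.symm _ _ h

theorem MutationEquivalent.noIsolatedMutable {S S' : Seed F K ι κ} (h : MutationEquivalent S S')
    (hS : S.quiver.NoIsolatedMutable) : S'.quiver.NoIsolatedMutable := by
  induction h with
  | refl => exact hS
  | tail _ h ih =>
    obtain ⟨k, hk⟩ := h
    rw [hk.1]
    exact ih.mutate k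

theorem MutationEquivalent.x_inr {S S' : Seed F K ι κ} (h : MutationEquivalent S S') (f : κ) :
    S'.x (Sum.inr f) = S.x (Sum.inr f) := by
  induction h with
  | refl => rfl
  | tail _ h ih =>
    obtain ⟨k, hk⟩ := h
    rw [hk.2.1 _ (by simp), ih]

theorem exists_mutationEquivalent_of_quiver {S : Seed F K ι κ} (hS : S.quiver.NoIsolatedMutable)
    {Q : IceQuiver ι κ}
    (h : Relation.ReflTransGen (fun Q₁ Q₂ : IceQuiver ι κ => ∃ k, Q₂ = Q₁.mutate k) S.quiver Q) :
    ∃ S', MutationEquivalent S S' ∧ S'.quiver = Q := by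
  induction h with
  | refl => exact ⟨S, .refl, rfl⟩
  | tail _ h ih =>
    obtain ⟨S', hS', rfl⟩ := ih
    obtain ⟨k, rfl⟩ := h
    obtain ⟨S'', h''⟩ := S'.exists_isMutation (hS'.noIsolatedMutable hS k)
    exact ⟨S'', hS'.tail ⟨k, h''⟩, h''.1⟩

end Seed

/-! ### Exchange relations in terms of triangulations -/

/-- A function equal to `1` on the sides is recovered at an edge `e` of the triangulation from its
values at the diagonals. -/
theorem prod_pow_indicator {n : ℕ} {T : Triangulation n} {ι M : Type*} [Fintype ι] [CommMonoid M]
    {δ : ι → Sym2 (Fin (n + 3))} (hinj : Function.Injective δ)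
    (hrange : Set.range δ = (T.diagonals : Set (Sym2 (Fin (n + 3)))))
    {w : Sym2 (Fin (n + 3)) → M} (hw : ∀ e, IsSide e → w e = 1) {e : Sym2 (Fin (n + 3))}
    (he : T.IsEdge e) : ∏ i, w (δ i) ^ (if δ i = e then 1 else 0) = w e := by
  classical
  rcases he with he | he
  · rw [hw e he]
    refine Finset.prod_eq_one fun i _ => ?_
    by_cases hi : δ i = e
    · rw [hi, hw e he, one_pow]
    · rw [if_neg hi, pow_zero]
  · rw [← Finset.mem_coe, ← hrange] at he
    obtain ⟨k, rfl⟩ := he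
    rw [Finset.prod_eq_single k]
    · rw [if_pos rfl, pow_one]
    · intro i _ hi
      rw [if_neg (hinj.ne hi), pow_zero]
    · simp

namespace Triangulation.Quad

variable {n : ℕ} {T : Triangulation n} {a b c d : Fin (n + 3)}

/-- The arrows leaving the diagonal `ac`. -/
theorem arrows_toNat (h : T.Quad a b c d) (e : Sym2 (Fin (n + 3))) :
    (T.arrows s(a, c) e).toNat =
      (if e = s(b, c) then 1 else 0) + (if e = s(d, a) then 1 else 0) := by
  obtain ⟨h1, h2, h3, h4, h5, h6⟩ := h.cyc.ne_chords
  have e1 : s(a, b) ≠ s(b, c) := by simp [h2, h5]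
  have e2 : s(a, b) ≠ s(d, a) := by simp [h4.symm, h6]
  have e3 : s(c, d) ≠ s(b, c) := by simp [h2.symm, h6.symm]
  have e4 : s(c, d) ≠ s(d, a) := by simp [h3, h5.symm]
  have e5 : s(b, c) ≠ s(d, a) := by simp [h6, h1.symm]
  unfold arrows
  simp only [h.hasArrow_left, h.hasArrow_right]
  generalize s(a, b) = u, s(b, c) = v, s(c, d) = w, s(d, a) = x at *
  by_cases hu : e = u <;> by_cases hv : e = v <;> by_cases hw : e = w <;>
    by_cases hx : e = x <;> simp_all

/-- The arrows arriving at the diagonal `ac`. -/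
theorem arrows_toNat' (h : T.Quad a b c d) (e : Sym2 (Fin (n + 3))) :
    (T.arrows e s(a, c)).toNat =
      (if e = s(a, b) then 1 else 0) + (if e = s(c, d) then 1 else 0) := by
  obtain ⟨h1, h2, h3, h4, h5, h6⟩ := h.cyc.ne_chords
  have e1 : s(a, b) ≠ s(b, c) := by simp [h2, h5]
  have e2 : s(a, b) ≠ s(d, a) := by simp [h4.symm, h6]
  have e3 : s(c, d) ≠ s(b, c) := by simp [h2.symm, h6.symm]
  have e4 : s(c, d) ≠ s(d, a) := by simp [h3, h5.symm]
  have e5 : s(a, b) ≠ s(c, d) := by simp [h5, h4.symm]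
  unfold arrows
  simp only [h.hasArrow_left, h.hasArrow_right]
  generalize s(a, b) = u, s(b, c) = v, s(c, d) = w, s(d, a) = x at *
  by_cases hu : e = u <;> by_cases hv : e = v <;> by_cases hw : e = w <;>
    by_cases hx : e = x <;> simp_all

end Triangulation.Quad

/-- The exchange relation of the mutation at a diagonal `ac` with quadrilateral `abcd`, where the
variables of the seed are the values at diagonals of a function `w` equal to `1` on the sides. -/
theorem Seed.IsMutation.exchange {F K ι κ : Type*} [Field F] [Field K] [Algebra F K]
    [Fintype ι] [Fintype κ] [DecidableEq ι] [DecidableEq κ] {n : ℕ} {T : Triangulation n}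
    {δ : ι → Sym2 (Fin (n + 3))} {S S' : Seed F K ι κ} {k : ι} (hS : IsMutation k S S')
    (hT : S.quiver.Realizes T δ) {w : Sym2 (Fin (n + 3)) → K} (hw : ∀ e, IsSide e → w e = 1)
    (hx : ∀ i, S.x (Sum.inl i) = w (δ i)) {a b c d : Fin (n + 3)} (h : T.Quad a b c d)
    (hk : δ k = s(a, c)) :
    S'.x (Sum.inl k) * w s(a, c) =
      w s(b, c) * w s(d, a) *
        ∏ f, S.x (Sum.inr f) ^ (S.quiver.b (Sum.inl k) (Sum.inr f)).toNat +
      w s(a, b) * w s(c, d) *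
        ∏ f, S.x (Sum.inr f) ^ (S.quiver.b (Sum.inr f) (Sum.inl k)).toNat := by
  rw [← hk, ← hx, hS.2.2, Fintype.prod_sum_type, Fintype.prod_sum_type]
  simp only [hT.b_eq, hk, h.arrows_toNat, h.arrows_toNat', hx, pow_add, Finset.prod_mul_distrib]
  rw [prod_pow_indicator hT.injective hT.range_eq hw h.ab,
    prod_pow_indicator hT.injective hT.range_eq hw h.bc,
    prod_pow_indicator hT.injective hT.range_eq hw h.cd,
    prod_pow_indicator hT.injective hT.range_eq hw h.da]

/-! ### Ptolemy relations with coefficients -/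

/-- `minUpTo G i t = min (G i) … (G (i + t))`. -/
def minUpTo (G : ℕ → ℤ) (i : ℕ) : ℕ → ℤ
  | 0 => G i
  | t + 1 => min (minUpTo G i t) (G (i + t + 1))

/-- The minimum of `G` on the half-open interval from `i` to `j`, where `i < j`. -/
def minIco (G : ℕ → ℤ) (i j : ℕ) : ℤ := minUpTo G i (j - i - 1)

theorem minIco_succ (G : ℕ → ℤ) (i : ℕ) : minIco G i (i + 1) = G i := by
  simp [minIco, minUpTo]

theorem minIco_split (G : ℕ → ℤ) {i j k : ℕ} (hij : i < j) (hjk : j < k) :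
    minIco G i k = min (minIco G i j) (minIco G j k) := by
  have key : ∀ k', j < k' → ∀ i', i' < k' → minIco G i' (k' + 1) = min (minIco G i' k') (G k') := by
    intro k' _ i' hi
    unfold minIco
    obtain ⟨t, rfl⟩ : ∃ t, k' = i' + t + 1 := ⟨k' - i' - 1, by omega⟩
    rw [show i' + t + 1 + 1 - i' - 1 = t + 1 by omega, show i' + t + 1 - i' - 1 = t by omega]
    rfl
  induction k, hjk using Nat.le_induction with
  | base =>
    rw [minIco_succ]
    unfold minIco
    obtain ⟨t, rfl⟩ : ∃ t, j = i + t + 1 := ⟨j - i - 1, by omega⟩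
    rw [show (i + t + 1).succ - i - 1 = t + 1 by omega, show i + t + 1 - i - 1 = t by omega]
    rfl
  | succ k hk ih => rw [key k hk i (by omega), key k hk j (by omega), ih, min_assoc]

/-- The solution of the tropical Ptolemy relation that vanishes on the chords at the vertex `0`
and takes the value `G i` on the side from `i` to `i + 1`. -/
def tropicalFan {N : ℕ} (G : ℕ → ℤ) (e : Sym2 (Fin N)) : ℤ :=
  if e.inf.val = 0 then 0 else minIco G e.inf e.sup

theorem tropicalFan_mk {N : ℕ} (G : ℕ → ℤ) {i j : Fin N} (h : i < j) :
    tropicalFan G s(i, j) = if i.val = 0 then 0 else minIco G i j := by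
  simp [tropicalFan, h.le]

/-- A relation for cyclically ordered quadruples that is invariant under rotation may be checked
on increasing quadruples. -/
theorem Cyc4.induction {N : ℕ} {P : Fin N → Fin N → Fin N → Fin N → Prop}
    (hrot : ∀ a b c d, P a b c d → P b c d a)
    (h : ∀ a b c d, a < b → b < c → c < d → P a b c d) {a b c d : Fin N} (hc : Cyc4 a b c d) :
    P a b c d := by
  rcases hc with hc | hc | hc | hc
  · exact h _ _ _ _ hc.1 hc.2.1 hc.2.2
  · exact hrot _ _ _ _ (hrot _ _ _ _ (hrot _ _ _ _ (h _ _ _ _ hc.1 hc.2.1 hc.2.2)))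
  · exact hrot _ _ _ _ (hrot _ _ _ _ (h _ _ _ _ hc.1 hc.2.1 hc.2.2))
  · exact hrot _ _ _ _ (h _ _ _ _ hc.1 hc.2.1 hc.2.2)

theorem tropicalFan_ptolemy {N : ℕ} (G : ℕ → ℤ) {a b c d : Fin N} (h : Cyc4 a b c d) :
    tropicalFan G s(a, c) + tropicalFan G s(b, d) =
      min (tropicalFan G s(a, b) + tropicalFan G s(c, d))
        (tropicalFan G s(b, c) + tropicalFan G s(d, a)) := by
  refine h.induction (P := fun a b c d => tropicalFan G s(a, c) + tropicalFan G s(b, d) =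
      min (tropicalFan G s(a, b) + tropicalFan G s(c, d))
        (tropicalFan G s(b, c) + tropicalFan G s(d, a))) ?_ ?_
  · intro a b c d h
    rw [Sym2.eq_swap (a := c) (b := a), Sym2.eq_swap (a := a) (b := b), add_comm, h, min_comm,
      add_comm (tropicalFan G s(a, b)), Sym2.eq_swap (a := b) (b := a)]
  · intro a b c d hab hbc hcd
    rw [Sym2.eq_swap (a := d), tropicalFan_mk G hab, tropicalFan_mk G hbc, tropicalFan_mk G hcd,
      tropicalFan_mk G (hab.trans hbc), tropicalFan_mk G (hbc.trans hcd),
      tropicalFan_mk G ((hab.trans hbc).trans hcd)]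
    rw [Fin.lt_def] at hab hbc hcd
    have hb : b.val ≠ 0 := by omega
    have hc : c.val ≠ 0 := by omega
    rw [if_neg hb, if_neg hb, if_neg hc, minIco_split G hbc hcd]
    by_cases ha : a.val = 0
    · simp only [ha, if_true]
      omega
    · simp only [ha, if_false]
      rw [minIco_split G hab (hbc.trans hcd), minIco_split G hab hbc, minIco_split G hbc hcd]
      omega

section Field

variable {K : Type*} [Field K] {N : ℕ}

/-- The solution of the Ptolemy relation with prescribed values `y i` on the chords from `0` to
`i` and `M i` on the sides from `i` to `i + 1`; these chords and sides are the edges of the fan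
triangulation at `0`. -/
def ptolemyFan (y M : ℕ → K) (e : Sym2 (Fin N)) : K :=
  if e.inf.val = 0 then y e.sup else
    y e.inf * y e.sup * ∑ s ∈ Finset.Ico e.inf.val e.sup.val, M s / (y s * y (s + 1))

theorem ptolemyFan_mk (y M : ℕ → K) {i j : Fin N} (h : i < j) :
    ptolemyFan y M s(i, j) = if i.val = 0 then y j else
      y i * y j * ∑ s ∈ Finset.Ico i.val j.val, M s / (y s * y (s + 1)) := by
  simp [ptolemyFan, h.le]

theorem ptolemyFan_ptolemy (y M : ℕ → K) {a b c d : Fin N} (h : Cyc4 a b c d) :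
    ptolemyFan y M s(a, c) * ptolemyFan y M s(b, d) =
      ptolemyFan y M s(a, b) * ptolemyFan y M s(c, d) +
        ptolemyFan y M s(b, c) * ptolemyFan y M s(d, a) := by
  refine h.induction (P := fun a b c d => ptolemyFan y M s(a, c) * ptolemyFan y M s(b, d) =
      ptolemyFan y M s(a, b) * ptolemyFan y M s(c, d) +
        ptolemyFan y M s(b, c) * ptolemyFan y M s(d, a)) ?_ ?_
  · intro a b c d h
    rw [Sym2.eq_swap (a := c) (b := a), mul_comm, h]
    ring
  · intro a b c d hab hbc hcd
    rw [Sym2.eq_swap (a := d), ptolemyFan_mk y M hab, ptolemyFan_mk y M hbc, ptolemyFan_mk y M hcd,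
      ptolemyFan_mk y M (hab.trans hbc), ptolemyFan_mk y M (hbc.trans hcd),
      ptolemyFan_mk y M ((hab.trans hbc).trans hcd)]
    rw [Fin.lt_def] at hab hbc hcd
    have hb : b.val ≠ 0 := by omega
    have hc : c.val ≠ 0 := by omega
    rw [if_neg hb, if_neg hb, if_neg hc, ← Finset.sum_Ico_consecutive _ hbc.le hcd.le]
    by_cases ha : a.val = 0
    · simp only [ha, if_true]
      ring
    · simp only [ha, if_false]
      rw [← Finset.sum_Ico_consecutive _ hab.le (hbc.trans hcd).le,
        ← Finset.sum_Ico_consecutive _ hab.le hbc.le,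
        ← Finset.sum_Ico_consecutive _ hbc.le hcd.le]
      ring

/-- A Laurent monomial. -/
def laurentMonomial {κ : Type*} [Fintype κ] (x : κ → K) (v : κ → ℤ) : K := ∏ f, x f ^ v f

theorem laurentMonomial_mul {κ : Type*} [Fintype κ] {x : κ → K} (hx : ∀ f, x f ≠ 0) (v w : κ → ℤ) :
    laurentMonomial x v * laurentMonomial x w = laurentMonomial x (fun f => v f + w f) := by
  simp only [laurentMonomial, ← Finset.prod_mul_distrib]
  exact Finset.prod_congr rfl fun f _ => (zpow_add₀ (hx f) _ _).symm

/-- Cluster variables with coefficients: the solution `ptolemyFan` of the Ptolemy relation,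
divided by the frozen monomials whose exponents solve the tropical Ptolemy relation. -/
def clusterFan {κ : Type*} [Fintype κ] (x : κ → K) (y : ℕ → K) (G : κ → ℕ → ℤ)
    (e : Sym2 (Fin N)) : K :=
  ptolemyFan y (fun i => laurentMonomial x fun f => G f i) e *
    laurentMonomial x fun f => -tropicalFan (G f) e

theorem clusterFan_ptolemy {κ : Type*} [Fintype κ] {x : κ → K} (hx : ∀ f, x f ≠ 0) (y : ℕ → K)
    (G : κ → ℕ → ℤ) {a b c d : Fin N} (h : Cyc4 a b c d) :
    clusterFan x y G s(b, d) * clusterFan x y G s(a, c) =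
      clusterFan x y G s(b, c) * clusterFan x y G s(d, a) *
        ∏ f, x f ^ (-quadEntry (tropicalFan (G f)) a b c d).toNat +
      clusterFan x y G s(a, b) * clusterFan x y G s(c, d) *
        ∏ f, x f ^ (quadEntry (tropicalFan (G f)) a b c d).toNat := by
  have hp := ptolemyFan_ptolemy y (fun i => laurentMonomial x fun f => G f i) h
  have key : ∀ (X Y : K) (e e' : Sym2 (Fin N)), X * laurentMonomial x (fun f => -tropicalFan (G f) e) *
      (Y * laurentMonomial x fun f => -tropicalFan (G f) e') =
      X * Y * laurentMonomial x fun f => -(tropicalFan (G f) e + tropicalFan (G f) e') := by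
    intro X Y e e'
    rw [mul_mul_mul_comm, laurentMonomial_mul hx]
    simp only [neg_add]
  have key' : ∀ u : κ → ℕ, ∏ f, x f ^ u f = laurentMonomial x fun f => (u f : ℤ) := by
    intro u
    simp [laurentMonomial]
  simp only [clusterFan, key, key']
  simp only [mul_assoc _ (laurentMonomial x _) (laurentMonomial x _), laurentMonomial_mul hx]
  rw [mul_comm (ptolemyFan y _ s(b, d)), hp, add_mul, add_comm]
  have ht := fun f => tropicalFan_ptolemy (G f) h
  congr 2 <;> congr 1 <;> funext f <;> have := ht f <;> unfold quadEntry triangleEntry <;> omega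

end Field

/-! ### Cluster variables as functions on chords -/

/-- The seed `S` is given by the triangulation `T`, its cluster variables being the values at the
diagonals of `T` of the function `z`, and the rows of the frozen vertices in the exchange matrix
being given by the functions `g f`. -/
structure Seed.Matches {F K ι κ : Type*} [Field F] [Field K] [Algebra F K] {n : ℕ}
    (S : Seed F K ι κ) (z : Sym2 (Fin (n + 3)) → K) (g : κ → Sym2 (Fin (n + 3)) → ℤ)
    (T : Triangulation n) (δ : ι → Sym2 (Fin (n + 3))) : Prop where
  realizes : S.quiver.Realizes T δ
  x_inl : ∀ i, S.x (Sum.inl i) = z (δ i)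
  row : ∀ f, S.quiver.RowRealizes T δ f (g f)

namespace Seed

variable {F K ι κ : Type*} [Field F] [Field K] [Algebra F K] {n : ℕ}

/-- For a seed with the quiver of the fan triangulation, parameters of `clusterFan` can be chosen
such that this function is `1` on the sides and gives the variables of the seed. -/
theorem exists_matches_fan [Fintype κ] (S : Seed F K ι κ) {δ : ι → Sym2 (Fin (n + 3))}
    (hT : S.quiver.Realizes (Triangulation.fan n) δ) :
    ∃ (y : ℕ → K) (G : κ → ℕ → ℤ),
      (∀ e : Sym2 (Fin (n + 3)), IsSide e → clusterFan (fun f => S.x (Sum.inr f)) y G e = 1) ∧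
      S.Matches (clusterFan (fun f => S.x (Sum.inr f)) y G) (fun f => tropicalFan (G f))
        (Triangulation.fan n) δ := by
  classical
  set x : κ → K := fun f => S.x (Sum.inr f) with hx
  have hx0 : ∀ f, x f ≠ 0 := fun f => S.x_ne_zero _
  let y : ℕ → K := fun j => if h : ∃ k, δ k = s(0, Fin.ofNat (n + 3) j) then
    S.x (Sum.inl h.choose) else 1
  let β : κ → ℕ → ℤ := fun f j => if h : ∃ k, δ k = s(0, Fin.ofNat (n + 3) j) then
    S.quiver.b (Sum.inr f) (Sum.inl h.choose) else 0
  -- the shear coordinate of `tropicalFan (G f)` at the diagonal from `0` to `j` is the difference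
  -- of the values of `G f` at `j` and `j - 1`
  let G : κ → ℕ → ℤ := fun f j => ∑ i ∈ Finset.range (j + 1), β f i
  have hofNat : ∀ j : Fin (n + 3), Fin.ofNat (n + 3) j.val = j := fun j =>
    Fin.ext (Nat.mod_eq_of_lt j.isLt)
  have hy0 : ∀ j, y j ≠ 0 := by
    intro j
    simp only [y]
    split_ifs with h
    · exact S.x_ne_zero _
    · exact one_ne_zero
  have hy : ∀ k (j : Fin (n + 3)), δ k = s(0, j) → y j = S.x (Sum.inl k) := by
    intro k j hk
    have h : ∃ k, δ k = s(0, Fin.ofNat (n + 3) j) := ⟨k, by rw [hofNat, hk]⟩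
    simp only [y]
    rw [dif_pos h]
    congr 2
    apply hT.injective
    rw [h.choose_spec, hofNat, hk]
  have hβ : ∀ f k (j : Fin (n + 3)), δ k = s(0, j) → β f j = S.quiver.b (Sum.inr f) (Sum.inl k) := by
    intro f k j hk
    have h : ∃ k, δ k = s(0, Fin.ofNat (n + 3) j) := ⟨k, by rw [hofNat, hk]⟩
    simp only [β]
    rw [dif_pos h]
    congr 2
    apply hT.injective
    rw [h.choose_spec, hofNat, hk]
  have hyside : ∀ j : Fin (n + 3), IsSide s(0, j) → y j = 1 := by
    intro j hj
    simp only [y]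
    rw [dif_neg]
    rintro ⟨k, hk⟩
    rw [hofNat] at hk
    exact ((Triangulation.fan n).isDiagonal _ (hT.mem k)).2 (hk ▸ hj)
  have hz0 : ∀ j : Fin (n + 3), 0 < j → clusterFan x y G s(0, j) = y j := by
    intro j hj
    rw [clusterFan, ptolemyFan_mk _ _ hj]
    simp [tropicalFan_mk _ hj, laurentMonomial]
  have hdiag : ∀ k, ∃ j : Fin (n + 3), 0 < j ∧ δ k = s(0, j) := by
    intro k
    have hk := hT.mem k
    simp only [Triangulation.fan, Finset.mem_filter, Finset.mem_univ, true_and] at hk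
    obtain ⟨j, hj⟩ := Sym2.mem_iff_exists.1 hk.2
    refine ⟨j, ?_, hj⟩
    have h1 := hk.1.1
    rw [hj, Sym2.mk_isDiag_iff] at h1
    exact Fin.pos_of_ne_zero (Ne.symm h1)
  refine ⟨y, G, ?_, hT, ?_, ?_⟩
  · intro e he
    have key : ∀ i j : Fin (n + 3), i < j → IsSide s(i, j) → clusterFan x y G s(i, j) = 1 := by
      intro i j hij h
      by_cases hi : i.val = 0
      · obtain rfl : i = 0 := Fin.ext hi
        rw [hz0 j hij, hyside j h]
      · rw [isSide_mk] at h
        have hj : j.val = i.val + 1 := by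
          rw [Fin.lt_def] at hij
          omega
        rw [clusterFan, ptolemyFan_mk _ _ hij, if_neg hi, hj, Nat.Ico_succ_singleton,
          Finset.sum_singleton, mul_div_cancel₀ _ (mul_ne_zero (hy0 _) (hy0 _)),
          laurentMonomial_mul hx0]
        simp [tropicalFan_mk _ hij, hi, hj, minIco_succ, laurentMonomial]
    induction e with | _ i j
    rcases lt_trichotomy i j with h | rfl | h
    · exact key i j h he
    · rw [isSide_mk] at he
      omega
    · rw [Sym2.eq_swap] at he ⊢
      exact key j i h he
  · intro i
    obtain ⟨j, hj0, hj⟩ := hdiag i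
    rw [hj, hz0 j hj0, hy i j hj]
  · intro f k a b c d hq hk
    have main : ∀ b c d, (Triangulation.fan n).Quad 0 b c d → δ k = s(0, c) →
        S.quiver.b (Sum.inr f) (Sum.inl k) = quadEntry (tropicalFan (G f)) 0 b c d := by
      intro b c d hq hk
      have hcyc : 0 < b.val ∧ b < c ∧ c < d := by
        have := hq.cyc
        unfold Cyc4 at this
        simp only [Fin.lt_def, Fin.val_zero] at this ⊢
        omega
      obtain ⟨hb, hbc, hcd⟩ := hcyc
      have hside : ∀ i j : Fin (n + 3), 0 < i.val → i < j → (Triangulation.fan n).IsEdge s(i, j) →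
          j.val = i.val + 1 := by
        intro i j hi hij h
        rw [Fin.lt_def] at hij
        rcases h with h | h
        · rw [isSide_mk] at h
          omega
        · simp only [Triangulation.fan, Finset.mem_filter, Finset.mem_univ, true_and,
            Sym2.mem_iff, Fin.ext_iff, Fin.val_zero] at h
          omega
      have h1 := hside b c hb hbc hq.bc
      have h2 := hside c d (hb.trans hbc) hcd hq.cd
      have hb0 : (0 : Fin (n + 3)) < b := hb
      rw [quadEntry, triangleEntry, triangleEntry, Sym2.eq_swap (a := d), tropicalFan_mk _ hb0,
        tropicalFan_mk _ hbc, tropicalFan_mk _ hcd,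
        tropicalFan_mk _ ((hb0.trans hbc).trans hcd), ← hβ f k c hk]
      have hb' : b.val ≠ 0 := hb.ne'
      have hc' : c.val ≠ 0 := by omega
      simp only [hb', hc', if_false, Fin.val_zero, if_true, h2, minIco_succ]
      rw [h1, minIco_succ]
      have : G f (b.val + 1) = G f b.val + β f (b.val + 1) := Finset.sum_range_succ _ _
      rw [this]
      ring
    obtain ⟨j, hj0, hj⟩ := hdiag k
    rcases Sym2.eq_iff.1 (hk.symm.trans hj) with ⟨rfl, rfl⟩ | ⟨rfl, rfl⟩
    · exact main b c d hq hk
    · rw [← quadEntry_rotate_rotate]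
      exact main d a b hq.rotate (hk.trans Sym2.eq_swap)

variable [Fintype ι] [Fintype κ] [DecidableEq ι] [DecidableEq κ]

/-- If the cluster variables of a seed are given by `clusterFan`, then so are those of a mutation
of this seed, the triangulation being changed by a flip. -/
theorem Matches.mutate {S S' : Seed F K ι κ} {x : κ → K} {y : ℕ → K} {G : κ → ℕ → ℤ}
    {T : Triangulation n} {δ : ι → Sym2 (Fin (n + 3))}
    (hM : S.Matches (clusterFan x y G) (fun f => tropicalFan (G f)) T δ)
    (hx : ∀ f, S.x (Sum.inr f) = x f)
    (hw : ∀ e : Sym2 (Fin (n + 3)), IsSide e → clusterFan x y G e = 1) {k : ι}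
    (hS : IsMutation k S S') {a b c d : Fin (n + 3)} (h : T.Quad a b c d) (hk : δ k = s(a, c)) :
    S'.Matches (clusterFan x y G) (fun f => tropicalFan (G f)) (T.flip h)
      (Function.update δ k s(b, d)) := by
  refine ⟨?_, ?_, ?_⟩
  · rw [hS.1]
    exact hM.realizes.mutate h hk
  · intro i
    by_cases hi : i = k
    · subst hi
      rw [Function.update_self]
      have h1 := hS.exchange hM.realizes hw hM.x_inl h hk
      have hb : ∀ f, S.quiver.b (Sum.inr f) (Sum.inl i) = quadEntry (tropicalFan (G f)) a b c d :=
        fun f => hM.row f i a b c d h hk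
      simp only [S.quiver.skew (Sum.inl i), hb, hx] at h1
      have hx0 : ∀ f, x f ≠ 0 := fun f => hx f ▸ S.x_ne_zero _
      rw [← clusterFan_ptolemy hx0 y G h.cyc] at h1
      refine mul_right_cancel₀ ?_ h1
      rw [← hk, ← hM.x_inl]
      exact S.x_ne_zero _
    · rw [Function.update_of_ne hi, hS.2.1 _ (by simpa using hi), hM.x_inl]
  · intro f
    rw [hS.1]
    exact (hM.row f).mutate hM.realizes h hk (tropicalFan_ptolemy _ h.cyc)

end Seed

/-! ### The correspondence between seeds and triangulations -/

namespace Triangulation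

variable {n : ℕ}

theorem not_crosses_self {N : ℕ} (e : Sym2 (Fin N)) : ¬ Crosses e e := by
  rintro ⟨a, b, c, d, h1, h2, h3, ⟨h4, h5⟩ | ⟨h4, h5⟩⟩ <;>
  · rw [h5, Sym2.eq_iff] at h4
    simp only [Fin.lt_def, Fin.ext_iff] at *
    omega

/-- Pairwise noncrossing diagonals can be completed to a triangulation. -/
theorem exists_triangulation (D : Finset (Sym2 (Fin (n + 3)))) (hd : ∀ e ∈ D, IsDiagonal e)
    (hc : ∀ e ∈ D, ∀ f ∈ D, ¬ Crosses e f) : ∃ T : Triangulation n, D ⊆ T.diagonals := by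
  classical
  let A : Finset (Finset (Sym2 (Fin (n + 3)))) :=
    {E | D ⊆ E ∧ (∀ e ∈ E, IsDiagonal e) ∧ ∀ e ∈ E, ∀ f ∈ E, ¬ Crosses e f}
  have hDA : D ∈ A := by
    simp only [A, Finset.mem_filter, Finset.mem_univ, true_and]
    exact ⟨subset_rfl, hd, hc⟩
  obtain ⟨E, hE, hmax⟩ := A.exists_max_image Finset.card ⟨D, hDA⟩
  simp only [A, Finset.mem_filter, Finset.mem_univ, true_and] at hE hmax
  refine ⟨⟨E, hE.2.1, hE.2.2, fun e he hf => ?_⟩, hE.1⟩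
  by_contra hne
  have := hmax (insert e E) ⟨hE.1.trans (Finset.subset_insert _ _), ?_, ?_⟩
  · rw [Finset.card_insert_of_notMem hne] at this
    omega
  · intro f hf'
    rcases Finset.mem_insert.1 hf' with rfl | hf'
    · exact he
    · exact hE.2.1 f hf'
  · intro f hf' f' hf''
    rcases Finset.mem_insert.1 hf' with rfl | h1 <;> rcases Finset.mem_insert.1 hf'' with rfl | h2
    · exact not_crosses_self _
    · exact hf f' h2
    · exact fun h => hf f h1 h.symm
    · exact hE.2.2 f h1 f' h2

theorem exists_mem_mem {e f : Sym2 (Fin (n + 3))} (he : IsDiagonal e) (hf : IsDiagonal f)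
    (h : ¬ Crosses e f) : ∃ T : Triangulation n, e ∈ T.diagonals ∧ f ∈ T.diagonals := by
  obtain ⟨T, hT⟩ := exists_triangulation {e, f} (by simp [he, hf]) (by
    simp only [Finset.mem_insert, Finset.mem_singleton, forall_eq_or_imp, forall_eq]
    exact ⟨⟨not_crosses_self e, h⟩, fun h' => h h'.symm, not_crosses_self f⟩)
  exact ⟨T, hT (by simp), hT (by simp)⟩

theorem exists_quad_of_cyc4 {a b c d : Fin (n + 3)} (h : Cyc4 a b c d) :
    ∃ T : Triangulation n, T.Quad a b c d := by
  classical
  let E : Finset (Sym2 (Fin (n + 3))) := {s(a, b), s(b, c), s(c, d), s(d, a), s(a, c)}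
  obtain ⟨T, hT⟩ := exists_triangulation {e ∈ E | IsDiagonal e}
    (fun e he => (Finset.mem_filter.1 he).2) (by
      intro e he f hf
      replace he := (Finset.mem_filter.1 he).1
      replace hf := (Finset.mem_filter.1 hf).1
      simp only [E, Finset.mem_insert, Finset.mem_singleton] at he hf
      rcases he with rfl | rfl | rfl | rfl | rfl <;> rcases hf with rfl | rfl | rfl | rfl | rfl <;>
        rw [crosses_mk] <;> unfold Cyc4 at * <;> omega)
  have key : ∀ x y, s(x, y) ∈ E → x ≠ y → T.IsEdge s(x, y) := by
    intro x y hxy hne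
    by_cases hs : IsSide s(x, y)
    · exact .inl hs
    · exact .inr (hT (Finset.mem_filter.2 ⟨hxy, by simpa using hne, hs⟩))
  obtain ⟨h1, h2, h3, h4, h5, -⟩ := h.ne_chords
  exact ⟨T, h, key _ _ (by simp [E]) h1, key _ _ (by simp [E]) h2, key _ _ (by simp [E]) h3,
    key _ _ (by simp [E]) h4, key _ _ (by simp [E]) h5⟩

end Triangulation

namespace Seed

variable {F K ι κ : Type*} [Field F] [Field K] [Algebra F K] {n : ℕ}

/-- Seeds given by the same triangulation and the same functions differ by a relabelling. -/
theorem Matches.isRelabelling {S S' : Seed F K ι κ} {z : Sym2 (Fin (n + 3)) → K}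
    {g : κ → Sym2 (Fin (n + 3)) → ℤ} {T : Triangulation n} {δ δ' : ι → Sym2 (Fin (n + 3))}
    (h : S.Matches z g T δ) (h' : S'.Matches z g T δ')
    (hx : ∀ f, S'.x (Sum.inr f) = S.x (Sum.inr f)) : S.IsRelabelling S' := by
  let σ : Equiv.Perm ι := (Equiv.ofInjective δ' h'.realizes.injective).trans
    ((Equiv.setCongr (h'.realizes.range_eq.trans h.realizes.range_eq.symm)).trans
      (Equiv.ofInjective δ h.realizes.injective).symm)
  have hσ : ∀ i, δ (σ i) = δ' i := fun i =>
    Equiv.apply_ofInjective_symm h.realizes.injective _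
  have hrow : ∀ f i, S'.quiver.b (Sum.inr f) (Sum.inl i) =
      S.quiver.b (Sum.inr f) (Sum.inl (σ i)) := by
    intro f i
    obtain ⟨a, b, c, d, hq, he⟩ := Triangulation.exists_quad (h'.realizes.mem i)
    rw [h'.row f i a b c d hq he, h.row f (σ i) a b c d hq ((hσ i).trans he)]
  refine ⟨σ, ?_, ?_⟩
  · rintro (i | f)
    · rw [h'.x_inl, ← hσ, ← h.x_inl]
      rfl
    · exact hx f
  · rintro (i | f) (j | f')
    · simp only [Sum.map_inl]
      rw [h'.realizes.b_eq, h.realizes.b_eq, hσ, hσ]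
    · rw [IceQuiver.skew, hrow, S.quiver.skew, neg_neg]
      rfl
    · exact hrow f j
    · simp [IceQuiver.frozen]

variable [Fintype ι] [Fintype κ] [DecidableEq ι] [DecidableEq κ]

/-- Along flips, seeds can be mutated from one triangulation to another. -/
theorem exists_of_flips {P : Seed F K ι κ → Triangulation n → (ι → Sym2 (Fin (n + 3))) → Prop}
    (hP : ∀ S T δ, P S T δ → S.quiver.Realizes T δ)
    {S₁ : Seed F K ι κ} (hiso : S₁.quiver.NoIsolatedMutable)
    (hflip : ∀ S S' T δ, MutationEquivalent S₁ S → P S T δ → ∀ k, IsMutation k S S' →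
      ∀ a b c d, ∀ h : T.Quad a b c d, δ k = s(a, c) →
        P S' (T.flip h) (Function.update δ k s(b, d)))
    {T₁ : Triangulation n} {δ₁ : ι → Sym2 (Fin (n + 3))} (h₁ : P S₁ T₁ δ₁)
    (T : Triangulation n) : ∃ S δ, MutationEquivalent S₁ S ∧ P S T δ := by
  induction Triangulation.flip_connected T₁ T with
  | refl => exact ⟨S₁, δ₁, .refl, h₁⟩
  | tail _ h ih =>
    obtain ⟨S, δ, hS, hPS⟩ := ih
    obtain ⟨a, b, c, d, h, rfl⟩ := h
    obtain ⟨k, hk⟩ : s(a, c) ∈ Set.range δ := by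
      rw [(hP _ _ _ hPS).range_eq]
      exact h.mem
    obtain ⟨S', hS'⟩ := S.exists_isMutation (hS.noIsolatedMutable hiso k)
    exact ⟨S', _, hS.tail ⟨k, hS'⟩, hflip S S' _ δ hS hPS k hS' a b c d h hk⟩

/-- In a cluster algebra of type `A_n`, the cluster variables can be assigned to diagonals, in such
a way that each seed is given by a triangulation and each triangulation comes from a seed. -/
theorem exists_matches {S₀ : Seed F K ι κ} (hA : S₀.quiver.IsTypeA n)
    (hiso : S₀.quiver.NoIsolatedMutable) :
    ∃ (z : Sym2 (Fin (n + 3)) → K) (g : κ → Sym2 (Fin (n + 3)) → ℤ),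
      (∀ S, MutationEquivalent S₀ S → ∃ T δ, S.Matches z g T δ) ∧
      (∀ T, ∃ S δ, MutationEquivalent S₀ S ∧ S.Matches z g T δ) ∧
      (∀ S S' T δ, MutationEquivalent S₀ S → S.Matches z g T δ → ∀ k, IsMutation k S S' →
        ∀ a b c d, ∀ h : T.Quad a b c d, δ k = s(a, c) →
          S'.Matches z g (T.flip h) (Function.update δ k s(b, d))) := by
  obtain ⟨Q, hQ, hD⟩ := hA
  obtain ⟨S₁, hS₁, rfl⟩ := exists_mutationEquivalent_of_quiver hiso hQ
  obtain ⟨T₁, δ₁, h₁⟩ := hD.exists_realizes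
  obtain ⟨S₂, δ₂, hS₂, h₂⟩ := exists_of_flips (P := fun S T δ => S.quiver.Realizes T δ)
    (fun _ _ _ h => h) (hS₁.noIsolatedMutable hiso) (by
      intro S S' T δ _ hR k hS a b c d h hk
      rw [hS.1]
      exact hR.mutate h hk) h₁ (Triangulation.fan n)
  replace hS₂ : MutationEquivalent S₀ S₂ := hS₁.trans hS₂
  obtain ⟨y, G, hside, hM⟩ := S₂.exists_matches_fan h₂
  have hflip : ∀ S S' T δ, MutationEquivalent S₂ S → S.Matches
      (clusterFan (fun f => S₂.x (Sum.inr f)) y G) (fun f => tropicalFan (G f)) T δ →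
      ∀ k, IsMutation k S S' → ∀ a b c d, ∀ h : T.Quad a b c d, δ k = s(a, c) →
      S'.Matches (clusterFan (fun f => S₂.x (Sum.inr f)) y G) (fun f => tropicalFan (G f))
        (T.flip h) (Function.update δ k s(b, d)) :=
    fun S S' T δ hS hM k hk a b c d h hδ =>
      hM.mutate (fun f => hS.x_inr f) hside hk h hδ
  refine ⟨_, _, ?_, ?_, fun S S' T δ hS => hflip S S' T δ (hS₂.symm.trans hS)⟩
  · intro S hS
    replace hS : MutationEquivalent S₂ S := hS₂.symm.trans hS
    induction hS with
    | refl => exact ⟨_, _, hM⟩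
    | tail hS h ih =>
      obtain ⟨T, δ, hT⟩ := ih
      obtain ⟨k, hk⟩ := h
      obtain ⟨a, b, c, d, hq, hac⟩ := Triangulation.exists_quad (hT.realizes.mem k)
      exact ⟨_, _, hflip _ _ T δ hS hT k hk a b c d hq hac⟩
  · intro T
    obtain ⟨S, δ, hS, hT⟩ := exists_of_flips (P := fun S T δ => S.Matches _ _ T δ)
      (fun _ _ _ h => h.realizes) (hS₂.noIsolatedMutable hiso) hflip hM T
    exact ⟨S, δ, hS₂.trans hS, hT⟩

/-- Seeds up to relabelling correspond to triangulations. -/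
theorem exists_correspondence {S₀ : Seed F K ι κ} (hA : S₀.quiver.IsTypeA n)
    (hiso : S₀.quiver.NoIsolatedMutable) :
    ∃ τ : S₀.MutationClass → Triangulation n, IsSeedTriangulationCorrespondence S₀ τ := by
  obtain ⟨z, g, hST, hTS, hflip⟩ := exists_matches (n := n) hA hiso
  have hinj : Set.InjOn z {e | IsDiagonal e} := by
    intro e he f hf hef
    by_cases hc : Crosses e f
    · -- the variables at crossing diagonals are exchanged by a mutation
      exfalso
      obtain ⟨a, b, c, d, h1, h2, h3, h⟩ := hc
      have main : ∀ a b c d : Fin (n + 3), Cyc4 a b c d → z s(a, c) = z s(b, d) → False := by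
        intro a b c d hcyc hz
        obtain ⟨T, hq⟩ := Triangulation.exists_quad_of_cyc4 hcyc
        obtain ⟨S, δ, hS, hM⟩ := hTS T
        obtain ⟨k, hk⟩ : s(a, c) ∈ Set.range δ := by
          rw [hM.realizes.range_eq]
          exact hq.mem
        obtain ⟨S', hS'⟩ := S.exists_isMutation (hS.noIsolatedMutable hiso k)
        have hM' := hflip S S' T δ hS hM k hS' a b c d hq hk
        refine hS'.x_ne ?_
        rw [hM'.x_inl, hM.x_inl, Function.update_self, hk, hz]
      rcases h with ⟨rfl, rfl⟩ | ⟨rfl, rfl⟩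
      · exact main a b c d (.inl ⟨h1, h2, h3⟩) hef
      · exact main a b c d (.inl ⟨h1, h2, h3⟩) hef.symm
    · -- the variables at noncrossing diagonals belong to a common cluster
      obtain ⟨T, heT, hfT⟩ := Triangulation.exists_mem_mem he hf hc
      obtain ⟨S, δ, hS, hM⟩ := hTS T
      rw [← Finset.mem_coe, ← hM.realizes.range_eq] at heT hfT
      obtain ⟨i, rfl⟩ := heT
      obtain ⟨j, rfl⟩ := hfT
      rw [← hM.x_inl, ← hM.x_inl] at hef
      rw [Sum.inl_injective (S.algebraicIndependent.injective hef)]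
  -- hence the triangulation of a seed is determined by its cluster
  have hdiag : ∀ {S : Seed F K ι κ} {T δ}, Matches S z g T δ →
      (T.diagonals : Set (Sym2 (Fin (n + 3)))) = {e | IsDiagonal e ∧ z e ∈ S.cluster} := by
    intro S T δ hM
    ext e
    constructor
    · intro he
      refine ⟨T.isDiagonal e he, ?_⟩
      rw [← hM.realizes.range_eq] at he
      obtain ⟨i, rfl⟩ := he
      exact ⟨i, hM.x_inl i⟩
    · rintro ⟨he, i, hi⟩
      have hi' : z (δ i) = z e := (hM.x_inl i).symm.trans hi
      rw [← hinj (T.isDiagonal _ (hM.realizes.mem i)) he hi']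
      exact hM.realizes.mem i
  have huniq : ∀ {S S' : Seed F K ι κ} {T T' δ δ'}, Matches S z g T δ → Matches S' z g T' δ' →
      S.cluster = S'.cluster → T = T' := by
    intro S S' T T' δ δ' hM hM' hSS
    ext e
    rw [← Finset.mem_coe, ← Finset.mem_coe, hdiag hM, hdiag hM', hSS]
  choose! τ δ hτ using fun S : S₀.MutationClass => hST S.1 S.2
  refine ⟨τ, ?_, ?_, z, hinj, fun S => ⟨δ S, (hτ S).realizes.injective, (hτ S).realizes.range_eq,
    (hτ S).x_inl, (hτ S).realizes.b_eq⟩⟩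
  · intro T
    obtain ⟨S, δ', hS, hM⟩ := hTS T
    exact ⟨⟨S, hS⟩, huniq (hτ ⟨S, hS⟩) hM rfl⟩
  · intro S S'
    constructor
    · intro h
      have hS := hτ S
      rw [h] at hS
      refine hS.isRelabelling (hτ S') fun f => ?_
      rw [MutationEquivalent.x_inr S'.2, MutationEquivalent.x_inr S.2]
    · rintro ⟨σ, hσ, -⟩
      refine huniq (hτ S) (hτ S') ?_
      ext v
      constructor
      · rintro ⟨i, rfl⟩
        refine ⟨σ.symm i, ?_⟩
        simp [hσ]
      · rintro ⟨i, rfl⟩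
        exact ⟨σ i, (hσ (Sum.inl i)).symm⟩

end Seed

/-! ### Ptolemy relations for an arbitrary correspondence -/

/-- For every correspondence of seeds with triangulations, the assignment of variables to diagonals,
extended by `1` to the sides, satisfies Ptolemy relations whose coefficients are monomials in the
frozen variables: mutation at `ac` exchanges this diagonal for the one other diagonal that crosses
no edge but `ac`. -/
theorem IsSeedTriangulationCorrespondence.exists_ptolemy {F K ι κ : Type*} [Field F] [Field K]
    [Algebra F K] [DecidableEq ι] [DecidableEq κ] [Fintype ι] [Fintype κ] {n : ℕ}
    {S₀ : Seed F K ι κ} (hiso : S₀.quiver.NoIsolatedMutable)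
    {τ : S₀.MutationClass → Triangulation n} (hτ : IsSeedTriangulationCorrespondence S₀ τ) :
    ∃ w : Sym2 (Fin (n + 3)) → K, (∀ e, IsSide e → w e = 1) ∧
      (∀ S : S₀.MutationClass, S.1.cluster = w '' (τ S).diagonals) ∧
      ∀ a b c d, Cyc4 a b c d →
        ∃ p ∈ Submonoid.closure (Set.range fun f : κ => S₀.x (Sum.inr f)),
        ∃ q ∈ Submonoid.closure (Set.range fun f : κ => S₀.x (Sum.inr f)),
          w s(b, d) * w s(a, c) = w s(b, c) * w s(d, a) * p + w s(a, b) * w s(c, d) * q := by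
  classical
  obtain ⟨hsurj, -, z, hinj, hz⟩ := hτ
  have hside : ∀ {T : Triangulation n} {e}, e ∈ T.diagonals → ¬ IsSide e := fun {T} {e} he =>
    (T.isDiagonal e he).2
  refine ⟨fun e => if IsSide e then 1 else z e, fun e he => if_pos he, ?_, ?_⟩
  · intro S
    obtain ⟨δ, hδ, hrange, hx, -⟩ := hz S
    ext v
    rw [← hrange]
    constructor
    · rintro ⟨i, rfl⟩
      refine ⟨δ i, ⟨i, rfl⟩, ?_⟩
      have hi : δ i ∈ (τ S).diagonals := by
        rw [← Finset.mem_coe, ← hrange]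
        exact ⟨i, rfl⟩
      simp only [hside hi, if_false, hx]
    · rintro ⟨_, ⟨i, rfl⟩, rfl⟩
      have hi : δ i ∈ (τ S).diagonals := by
        rw [← Finset.mem_coe, ← hrange]
        exact ⟨i, rfl⟩
      exact ⟨i, by simp only [hside hi, if_false, hx]⟩
  · intro a b c d hcyc
    obtain ⟨T, hq⟩ := Triangulation.exists_quad_of_cyc4 hcyc
    obtain ⟨S, rfl⟩ := hsurj T
    obtain ⟨δ, hδ, hrange, hx, hb⟩ := hz S
    obtain ⟨k, hk⟩ : s(a, c) ∈ Set.range δ := by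
      rw [hrange]
      exact hq.mem
    have hmem : ∀ i, δ i ∈ (τ S).diagonals := by
      intro i
      rw [← Finset.mem_coe, ← hrange]
      exact ⟨i, rfl⟩
    obtain ⟨S', hS'⟩ := S.1.exists_isMutation
      (Seed.MutationEquivalent.noIsolatedMutable S.2 hiso k)
    obtain ⟨δ', hδ', hrange', hx', -⟩ := hz ⟨S', Relation.ReflTransGen.tail S.2 ⟨k, hS'⟩⟩
    set T' := τ ⟨S', Relation.ReflTransGen.tail S.2 ⟨k, hS'⟩⟩
    have hmem' : ∀ i, δ' i ∈ T'.diagonals := by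
      intro i
      rw [← Finset.mem_coe, ← hrange']
      exact ⟨i, rfl⟩
    have hne : ∀ i, i ≠ k → δ' i = δ i := by
      intro i hi
      refine hinj (T'.isDiagonal _ (hmem' i)) ((τ S).isDiagonal _ (hmem i)) ?_
      rw [← hx', ← hx]
      exact hS'.2.1 _ (by simpa using hi)
    have hk' : δ' k ≠ δ k := by
      intro h
      refine hS'.x_ne ?_
      rw [hx, ← h]
      exact hx' k
    -- the new diagonal crosses `ac` but no other edge of the triangulation
    have hnc : ∀ e, (τ S).IsEdge e → e ≠ s(a, c) → ¬ Crosses e (δ' k) := by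
      rintro e (he | he) hne'
      · exact not_crosses_of_isSide he
      · rw [← Finset.mem_coe, ← hrange] at he
        obtain ⟨i, rfl⟩ := he
        have hik : i ≠ k := fun h => hne' (h ▸ hk)
        rw [← hne i hik]
        exact T'.noncrossing _ (hmem' i) _ (hmem' k)
    have hcross : Crosses s(c, a) (δ' k) := by
      by_contra hnot
      have : δ' k ∈ (τ S).diagonals := by
        refine (τ S).maximal _ (T'.isDiagonal _ (hmem' k)) fun f hf hc => ?_
        by_cases hfe : f = s(a, c)
        · rw [hfe, Sym2.eq_swap] at hc
          exact hnot hc.symm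
        · exact hnc f (.inr hf) hfe hc.symm
      rw [← Finset.mem_coe, ← hrange] at this
      obtain ⟨i, hi⟩ := this
      by_cases hik : i = k
      · exact hk' (hik ▸ hi.symm)
      · rw [← hne i hik] at hi
        exact hik (hδ' hi)
    obtain ⟨h1, h2, h3, h4, h5, h6⟩ := hcyc.ne_chords
    have hbd : δ' k = s(b, d) := Triangulation.eq_of_crosses_of_not_crosses hcyc.rotate hcross
      (hnc _ hq.bc (by simp [h1.symm, h5.symm])) (hnc _ hq.cd (by simp [h4, h5.symm]))
      (hnc _ hq.da (by simp [h4, h3.symm])) (hnc _ hq.ab (by simp [h2, h5]))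
    have hbdside : ¬ IsSide s(b, d) := hcyc.rotate.isDiagonal.2
    have hex := hS'.exchange (w := fun e => if IsSide e then 1 else z e) ⟨hδ, hrange, hb⟩
      (fun e he => if_pos he) (fun i => by simp only [hside (hmem i), if_false, hx]) hq hk
    have hxk : S'.x (Sum.inl k) = if IsSide s(b, d) then 1 else z s(b, d) := by
      rw [if_neg hbdside, ← hbd]
      exact hx' k
    rw [hxk] at hex
    have hmon : ∀ u : κ → ℕ, ∏ f, S.1.x (Sum.inr f) ^ u f ∈
        Submonoid.closure (Set.range fun f : κ => S₀.x (Sum.inr f)) := by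
      intro u
      refine Submonoid.prod_mem _ fun f _ => Submonoid.pow_mem _ ?_ _
      rw [Seed.MutationEquivalent.x_inr S.2]
      exact Submonoid.subset_closure ⟨f, rfl⟩
    exact ⟨_, hmon _, _, hmon _, hex⟩

/-! ### Induction on the number of crossings -/

/-- A chord that does not cross the diagonal `ac` of a quadrilateral `abcd` but crosses the side `ab`
also crosses the other diagonal. -/
theorem Cyc4.crosses_of_crosses {N : ℕ} {a b c d : Fin N} (h : Cyc4 a b c d) {f : Sym2 (Fin N)}
    (hab : Crosses s(a, b) f) (hac : ¬ Crosses s(a, c) f) : Crosses s(b, d) f := by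
  have key : ∀ p q, Cyc4 a p b q → ¬ Cyc4 a p c q → Cyc4 b q d p := by
    intro p q h1 h2
    have hapc : Cyc3 a p c := (h1.left.trans h.left).skip
    have hbdp : Cyc3 b d p := (h.rotate.right.trans h1.rotate.rotate.right).skip
    refine Cyc3.trans ?_ hbdp
    rcases Cyc3.trichotomy h1.rotate.rotate.left h.rotate.skip with rfl | h3 | h3
    · exact h.rotate.left
    · exact (h3.left.trans h.rotate.left).skip
    · exact absurd (hapc.trans h3.rotate.rotate.rotate.right) h2
  induction f with | _ p q
  rw [crosses_mk] at *
  push Not at hac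
  rcases hab with h' | h'
  · exact .inr (key p q h' hac.1)
  · exact .inl (key q p h' hac.2)

theorem Cyc4.crosses_of_crosses' {N : ℕ} {a b c d : Fin N} (h : Cyc4 a b c d) {f : Sym2 (Fin N)}
    (hbc : Crosses s(b, c) f) (hac : ¬ Crosses s(a, c) f) : Crosses s(b, d) f := by
  have key : ∀ p q, Cyc4 b p c q → ¬ Cyc4 a p c q → Cyc4 b p d q := by
    intro p q h1 h2
    have hacp : Cyc3 c a p := (h.rotate.rotate.right.trans h1.rotate.rotate.right).skip
    have hbpd : Cyc3 b p d := (h1.left.trans h.rotate.left).skip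
    refine hbpd.trans ?_
    rcases Cyc3.trichotomy h1.rotate.rotate.left h.rotate.rotate.right with rfl | h3 | h3
    · exact h.rotate.right
    · exact absurd (h3.left.trans hacp).rotate.rotate h2
    · exact (h.rotate.right.trans h3.rotate.rotate.rotate.right).skip
  induction f with | _ p q
  rw [crosses_mk] at *
  push Not at hac
  rcases hbc with h' | h'
  · exact .inl (key p q h' hac.1)
  · exact .inr (key q p h' hac.2)

/-- Every chord can be reached from the edges of a triangulation `T` by passing from the sides of a
quadrilateral and its diagonal in `T` to the other diagonal. -/
theorem Triangulation.chord_induction {n : ℕ} (T : Triangulation n)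
    {P : Sym2 (Fin (n + 3)) → Prop} (hedge : ∀ e, T.IsEdge e → P e)
    (hstep : ∀ a b c d, Cyc4 a b c d → s(a, c) ∈ T.diagonals → P s(a, b) → P s(b, c) →
      P s(c, d) → P s(d, a) → P s(b, d)) (e : Sym2 (Fin (n + 3))) (he : ¬ e.IsDiag) : P e := by
  classical
  induction hm : Finset.card {f ∈ T.diagonals | Crosses e f} using Nat.strong_induction_on
    generalizing e with
  | _ m ih =>
  by_cases hT : T.IsEdge e
  · exact hedge e hT
  obtain ⟨f, hf, hef⟩ : ∃ f ∈ T.diagonals, Crosses e f := by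
    by_contra hno
    push Not at hno
    refine hT (T.isEdge_of_not_crosses he ?_)
    rintro f (hf | hf) hc
    · exact not_crosses_of_isSide hf hc.symm
    · exact hno f hf hc
  have key : ∀ a b c d, Cyc4 a b c d → f = s(a, c) → e = s(b, d) → P e := by
    rintro a b c d h rfl rfl
    have hlt : ∀ g : Sym2 (Fin (n + 3)), (∀ f ∈ T.diagonals, Crosses g f → Crosses s(b, d) f) →
        ¬ Crosses g s(a, c) →
        Finset.card {f ∈ T.diagonals | Crosses g f} < m := by
      intro g h1 h2
      rw [← hm]
      apply Finset.card_lt_card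
      rw [Finset.ssubset_iff_of_subset]
      · exact ⟨s(a, c), by simp [hf, hef], by simp [h2]⟩
      · intro f' hf'
        rw [Finset.mem_filter] at hf' ⊢
        exact ⟨hf'.1, h1 f' hf'.1 hf'.2⟩
    have hac : ∀ f ∈ T.diagonals, ¬ Crosses s(a, c) f := fun f' hf' => T.noncrossing _ hf _ hf'
    have hca : ∀ f ∈ T.diagonals, ¬ Crosses s(c, a) f := fun f' hf' => by
      rw [Sym2.eq_swap]
      exact hac f' hf'
    have hdb : ∀ {f}, Crosses s(d, b) f → Crosses s(b, d) f := fun h => by rwa [Sym2.eq_swap]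
    have hnc : ∀ x y z : Fin (n + 3), ¬ Crosses s(x, y) s(y, z) := by
      intro x y z hc
      rw [crosses_mk] at hc
      unfold Cyc4 at hc
      omega
    have hnc' : ∀ x y z : Fin (n + 3), ¬ Crosses s(x, y) s(x, z) := by
      intro x y z hc
      rw [Sym2.eq_swap] at hc
      exact hnc _ _ _ hc
    obtain ⟨h1, h2, h3, h4, -, -⟩ := h.ne_chords
    refine hstep a b c d h hf (ih _ (hlt _ ?_ ?_) _ ?_ rfl) (ih _ (hlt _ ?_ ?_) _ ?_ rfl)
      (ih _ (hlt _ ?_ ?_) _ ?_ rfl) (ih _ (hlt _ ?_ ?_) _ ?_ rfl)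
    · exact fun f' hf' hc => h.crosses_of_crosses hc (hac f' hf')
    · exact hnc' _ _ _
    · simpa using h1
    · exact fun f' hf' hc => h.crosses_of_crosses' hc (hac f' hf')
    · rw [Sym2.eq_swap (a := a)]
      exact hnc _ _ _
    · simpa using h2
    · exact fun f' hf' hc => hdb (h.rotate.rotate.crosses_of_crosses hc (hca f' hf'))
    · rw [Sym2.eq_swap (a := a)]
      exact hnc' _ _ _
    · simpa using h3
    · exact fun f' hf' hc => hdb (h.rotate.rotate.crosses_of_crosses' hc (hca f' hf'))
    · exact hnc _ _ _
    · simpa using h4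
  obtain ⟨a, b, c, d, h1, h2, h3, ⟨h4, h5⟩ | ⟨h4, h5⟩⟩ := hef
  · have hcyc : Cyc4 a b c d := .inl ⟨h1, h2, h3⟩
    exact key b c d a hcyc.rotate h5 (h4.trans Sym2.eq_swap)
  · exact key a b c d (.inl ⟨h1, h2, h3⟩) h5 h4

/-! ### The Laurent phenomenon and the point of a cluster torus -/

namespace Seed

variable {F K ι κ : Type*} [Field F] [Field K] [Algebra F K]

/-- The element `a` of the field `K` of rational functions in the variables of `S` is regular at
the point where all variables are `1`, and takes the value `v` there. -/
def HasValueAtOne (S : Seed F K ι κ) (a : K) (v : F) : Prop :=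
  ∃ p q : MvPolynomial (ι ⊕ κ) F, MvPolynomial.eval 1 q ≠ 0 ∧
    a * MvPolynomial.aeval S.x q = MvPolynomial.aeval S.x p ∧
    v * MvPolynomial.eval 1 q = MvPolynomial.eval 1 p

namespace HasValueAtOne

variable {S : Seed F K ι κ} {a b : K} {v w : F}

theorem unique (h : S.HasValueAtOne a v) (h' : S.HasValueAtOne a w) : v = w := by
  obtain ⟨p, q, hq, h1, h2⟩ := h
  obtain ⟨p', q', hq', h1', h2'⟩ := h'
  have h3 : p * q' = p' * q := by
    apply S.algebraicIndependent
    rw [map_mul, map_mul, ← h1, ← h1']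
    ring
  have h4 := congrArg (MvPolynomial.eval 1) h3
  rw [map_mul, map_mul, ← h2, ← h2'] at h4
  refine mul_right_cancel₀ (mul_ne_zero hq hq') ?_
  linear_combination h4

theorem algebraMap (v : F) : S.HasValueAtOne (algebraMap F K v) v :=
  ⟨MvPolynomial.C v, 1, by simp, by simp, by simp⟩

theorem one : S.HasValueAtOne 1 1 := ⟨1, 1, by simp, by simp, by simp⟩

theorem x (i : ι ⊕ κ) : S.HasValueAtOne (S.x i) 1 :=
  ⟨MvPolynomial.X i, 1, by simp, by simp, by simp⟩

theorem add (ha : S.HasValueAtOne a v) (hb : S.HasValueAtOne b w) :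
    S.HasValueAtOne (a + b) (v + w) := by
  obtain ⟨p, q, hq, h1, h2⟩ := ha
  obtain ⟨p', q', hq', h1', h2'⟩ := hb
  refine ⟨p * q' + p' * q, q * q', by rw [map_mul]; exact mul_ne_zero hq hq', ?_, ?_⟩
  · rw [map_mul, map_add, map_mul, map_mul, ← h1, ← h1']
    ring
  · rw [map_mul, map_add, map_mul, map_mul, ← h2, ← h2']
    ring

theorem mul (ha : S.HasValueAtOne a v) (hb : S.HasValueAtOne b w) :
    S.HasValueAtOne (a * b) (v * w) := by
  obtain ⟨p, q, hq, h1, h2⟩ := ha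
  obtain ⟨p', q', hq', h1', h2'⟩ := hb
  refine ⟨p * p', q * q', by rw [map_mul]; exact mul_ne_zero hq hq', ?_, ?_⟩
  · rw [map_mul, map_mul, ← h1, ← h1']
    ring
  · rw [map_mul, map_mul, ← h2, ← h2']
    ring

theorem of_mul_x {i : ι ⊕ κ} (h : S.HasValueAtOne (a * S.x i) v) : S.HasValueAtOne a v := by
  obtain ⟨p, q, hq, h1, h2⟩ := h
  refine ⟨p, MvPolynomial.X i * q, by simpa using hq, ?_, by simpa using h2⟩
  rw [map_mul, MvPolynomial.aeval_X, ← mul_assoc, h1]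

theorem of_mem_closure {s : Set K} (hs : ∀ a ∈ s, S.HasValueAtOne a 1)
    (ha : a ∈ Submonoid.closure s) : S.HasValueAtOne a 1 := by
  induction ha using Submonoid.closure_induction with
  | mem a ha => exact hs a ha
  | one => exact one
  | mul a b _ _ ha hb => simpa using ha.mul hb

end HasValueAtOne

/-- If all elements of a subalgebra are regular at the point where the variables of `S` are `1`,
then evaluation at this point is a homomorphism. -/
theorem exists_evalAtOne (S : Seed F K ι κ) {A : Subalgebra F K}
    (hA : ∀ a ∈ A, ∃ v, S.HasValueAtOne a v) :
    ∃ φ : A →ₐ[F] F, ∀ a : A, S.HasValueAtOne a (φ a) := by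
  choose! ev hev using hA
  have h : ∀ (a : A) v, S.HasValueAtOne (a : K) v → ev a = v := fun a v hv =>
    (hev a a.2).unique hv
  exact ⟨{
    toFun := fun a => ev a
    map_one' := h 1 1 .one
    map_mul' := fun a b => h _ _ ((hev a a.2).mul (hev b b.2))
    map_zero' := h 0 0 (by simpa using HasValueAtOne.algebraMap (S := S) 0)
    map_add' := fun a b => h _ _ ((hev a a.2).add (hev b b.2))
    commutes' := fun v => h _ v (.algebraMap v) }, fun a => hev a a.2⟩

/-- A homomorphism that takes the value `1` at the variables of a seed is determined on all
elements that are regular at the corresponding point. -/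
theorem HasValueAtOne.eq_apply {S : Seed F K ι κ} {A : Subalgebra F K} {φ : A →ₐ[F] F}
    (hx : ∀ i, ∃ h : S.x i ∈ A, φ ⟨S.x i, h⟩ = 1) {a : A} {v : F}
    (h : S.HasValueAtOne (a : K) v) : φ a = v := by
  obtain ⟨p, q, hq, h1, h2⟩ := h
  choose hxA hφ using hx
  let ψ : MvPolynomial (ι ⊕ κ) F →ₐ[F] A := MvPolynomial.aeval fun i => ⟨S.x i, hxA i⟩
  have hψ : ∀ p, ((ψ p : A) : K) = MvPolynomial.aeval S.x p := by
    intro p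
    have : A.val.comp ψ = MvPolynomial.aeval S.x := by
      ext i
      simp [ψ]
    exact DFunLike.congr_fun this p
  have hφψ : ∀ p, φ (ψ p) = MvPolynomial.eval 1 p := by
    intro p
    have : φ.comp ψ = MvPolynomial.aeval (1 : ι ⊕ κ → F) := by
      ext i
      simp [ψ, hφ]
    rw [← MvPolynomial.coe_aeval_eq_eval]
    exact DFunLike.congr_fun this p
  have h3 : a * ψ q = ψ p := by
    apply Subtype.ext
    rw [← hψ p] at h1
    rw [← h1, ← hψ q]
    rfl
  have h4 := congrArg φ h3
  rw [map_mul, hφψ, hφψ, ← h2] at h4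
  exact mul_right_cancel₀ hq h4

end Seed

/-- The function on chords that is `0` on chords with endpoints of the same colour and `1` on the
other chords. -/
def colourSeparation {N : ℕ} {C : Type*} [DecidableEq C] (c : Fin N → C) (e : Sym2 (Fin N)) :
    ZMod 2 := if (e.map c).IsDiag then 0 else 1

theorem colourSeparation_mk {N : ℕ} {C : Type*} [DecidableEq C] (c : Fin N → C) (i j : Fin N) :
    colourSeparation c s(i, j) = if c i = c j then 0 else 1 := by
  simp [colourSeparation]

/-- The function on chords defined by a colouring with three colours satisfies the Ptolemy relation
over `𝔽₂`: the three colours are the nonzero vectors of a plane over `𝔽₂`, and the function is the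
determinant of the vectors at the endpoints. -/
theorem colourSeparation_ptolemy {N : ℕ} (c : Fin N → Fin 3) (i j k l : Fin N) :
    colourSeparation c s(j, l) * colourSeparation c s(i, k) =
      colourSeparation c s(j, k) * colourSeparation c s(l, i) +
        colourSeparation c s(i, j) * colourSeparation c s(k, l) := by
  simp only [colourSeparation_mk]
  generalize c i = x, c j = y, c k = z, c l = w
  revert x y z w
  decide

/-! ### Cluster tori over the field with two elements -/

theorem colourSeparation_eq_one_of_ne {N : ℕ} {C : Type*} [DecidableEq C] {c : Fin N → C}
    {i j : Fin N} (h : c i ≠ c j) : colourSeparation c s(i, j) = 1 := by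
  rw [colourSeparation_mk, if_neg h]

section Torus

variable {K ι κ : Type*} [Field K] [Algebra (ZMod 2) K] [DecidableEq ι] [DecidableEq κ] [Fintype ι]
  [Fintype κ] {n : ℕ} {S₀ : Seed (ZMod 2) K ι κ}

theorem Seed.hasValueAtOne_inr (S : S₀.MutationClass) (f : κ) :
    S.1.HasValueAtOne (S₀.x (Sum.inr f)) 1 := by
  have h := Seed.MutationEquivalent.x_inr S.2 f
  rw [← h]
  exact .x _

/-- At the point where all variables of a seed are `1`, the cluster variable of a chord takes the
value `1` or `0` according to whether a colouring that is proper on the triangulation of the seed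
separates the endpoints of the chord. -/
theorem IsSeedTriangulationCorrespondence.exists_hasValueAtOne
    (hiso : S₀.quiver.NoIsolatedMutable) {τ : S₀.MutationClass → Triangulation n}
    (hτ : IsSeedTriangulationCorrespondence S₀ τ) :
    ∃ w : Sym2 (Fin (n + 3)) → K,
      (∀ S : S₀.MutationClass, S.1.cluster = w '' (τ S).diagonals) ∧
      ∀ (S : S₀.MutationClass) (c : Fin (n + 3) → Fin 3),
        (∀ i j, (τ S).IsEdge s(i, j) → c i ≠ c j) →
        ∀ e, ¬ e.IsDiag → S.1.HasValueAtOne (w e) (colourSeparation c e) := by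
  obtain ⟨w, hside, hcl, hpt⟩ := hτ.exists_ptolemy hiso
  refine ⟨w, hcl, fun S c hc e he => ?_⟩
  have hfr : ∀ p ∈ Submonoid.closure (Set.range fun f : κ => S₀.x (Sum.inr f)),
      S.1.HasValueAtOne p 1 := by
    intro p hp
    refine Seed.HasValueAtOne.of_mem_closure ?_ hp
    rintro _ ⟨f, rfl⟩
    exact Seed.hasValueAtOne_inr S f
  have hvar : ∀ e ∈ (τ S).diagonals, ∃ k, w e = S.1.x k := by
    intro e he
    have : w e ∈ S.1.cluster := by
      rw [hcl]
      exact ⟨e, he, rfl⟩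
    obtain ⟨i, hi⟩ := this
    exact ⟨_, hi.symm⟩
  refine (τ S).chord_induction (P := fun e => S.1.HasValueAtOne (w e) (colourSeparation c e))
    ?_ ?_ e he
  · intro e he
    have hsep : colourSeparation c e = 1 := by
      induction e with | _ i j
      exact colourSeparation_eq_one_of_ne (hc i j he)
    rw [hsep]
    rcases he with he | he
    · rw [hside e he]
      exact .one
    · obtain ⟨k, hk⟩ := hvar e he
      rw [hk]
      exact .x _
  · intro a b c' d h hac hab hbc hcd hda
    obtain ⟨p, hp, q, hq, hpq⟩ := hpt a b c' d h
    obtain ⟨k, hk⟩ := hvar _ hac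
    apply Seed.HasValueAtOne.of_mul_x (i := k)
    rw [← hk, hpq]
    have h1 := colourSeparation_ptolemy c a b c' d
    rw [colourSeparation_eq_one_of_ne (hc _ _ (.inr hac)), mul_one] at h1
    rw [h1]
    simpa using ((hbc.mul hda).mul (hfr p hp)).add ((hab.mul hcd).mul (hfr q hq))

/-- The cluster torus of a seed over `𝔽₂` consists of the evaluation at the point where all
variables are `1`. -/
theorem IsSeedTriangulationCorrespondence.exists_clusterTorus_eq
    (hiso : S₀.quiver.NoIsolatedMutable) {τ : S₀.MutationClass → Triangulation n}
    (hτ : IsSeedTriangulationCorrespondence S₀ τ) (S : S₀.MutationClass)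
    {c : Fin (n + 3) → Fin 3} (hc : ∀ i j, (τ S).IsEdge s(i, j) → c i ≠ c j) :
    ∃ φ : S₀.ClusterVariety, S₀.clusterTorus S = {φ} ∧
      ∀ a : S₀.clusterAlgebra, S.1.HasValueAtOne (a : K) (φ a) := by
  obtain ⟨w, hcl, hval⟩ := hτ.exists_hasValueAtOne hiso
  have hcluster : ∀ (S' : S₀.MutationClass), ∀ a ∈ S'.1.cluster, a ∈ S₀.clusterAlgebra :=
    fun S' a ha => Algebra.subset_adjoin (.inl (.inl (Set.mem_iUnion.2 ⟨S', ha⟩)))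
  have hreg : ∀ a ∈ S₀.clusterAlgebra, ∃ v, S.1.HasValueAtOne a v := by
    intro a ha
    induction ha using Algebra.adjoin_induction with
    | mem a ha =>
      rcases ha with (ha | ⟨f, rfl⟩) | ⟨f, rfl⟩
      · obtain ⟨S', ha⟩ := Set.mem_iUnion.1 ha
        rw [hcl] at ha
        obtain ⟨e, he, rfl⟩ := ha
        exact ⟨_, hval S c hc e ((τ S').isDiagonal e he).1⟩
      · exact ⟨1, Seed.hasValueAtOne_inr S f⟩
      · refine ⟨1, .of_mul_x (i := Sum.inr f) ?_⟩
        simp only [Seed.MutationEquivalent.x_inr S.2]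
        rw [inv_mul_cancel₀ (S₀.x_ne_zero _)]
        exact .one
    | algebraMap v => exact ⟨v, .algebraMap v⟩
    | add a b _ _ ha hb =>
      obtain ⟨v, hv⟩ := ha
      obtain ⟨u, hu⟩ := hb
      exact ⟨_, hv.add hu⟩
    | mul a b _ _ ha hb =>
      obtain ⟨v, hv⟩ := ha
      obtain ⟨u, hu⟩ := hb
      exact ⟨_, hv.mul hu⟩
  obtain ⟨φ, hφ⟩ := S.1.exists_evalAtOne hreg
  refine ⟨φ, Set.eq_singleton_iff_unique_mem.2 ⟨?_, fun ψ hψ => ?_⟩, hφ⟩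
  · rintro a ⟨i, hi⟩
    have : φ a = 1 := (hφ a).unique (hi ▸ .x _)
    rw [this]
    exact one_ne_zero
  · have hone : ∀ v : ZMod 2, v ≠ 0 → v = 1 := by decide
    refine AlgHom.ext fun a => Seed.HasValueAtOne.eq_apply ?_ (hφ a)
    rintro (i | f)
    · have hi : S.1.x (Sum.inl i) ∈ S.1.cluster := ⟨i, rfl⟩
      exact ⟨hcluster S _ hi, hone _ (hψ ⟨_, hcluster S _ hi⟩ hi)⟩
    · -- frozen variables are invertible in the cluster algebra
      rw [Seed.MutationEquivalent.x_inr S.2]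
      have h1 : S₀.x (Sum.inr f) ∈ S₀.clusterAlgebra :=
        Algebra.subset_adjoin (.inl (.inr ⟨f, rfl⟩))
      have h2 : (S₀.x (Sum.inr f))⁻¹ ∈ S₀.clusterAlgebra := Algebra.subset_adjoin (.inr ⟨f, rfl⟩)
      refine ⟨h1, hone _ fun h => ?_⟩
      have h3 : (⟨_, h1⟩ * ⟨_, h2⟩ : S₀.clusterAlgebra) = 1 :=
        Subtype.ext (mul_inv_cancel₀ (S₀.x_ne_zero _))
      have h4 := congrArg ψ h3
      rw [map_mul, h, zero_mul, map_one] at h4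
      exact zero_ne_one h4

/-- Two seeds have the same cluster torus over `𝔽₂` if and only if a colouring that is proper on
the triangulation of the first is proper on the triangulation of the second. -/
theorem IsSeedTriangulationCorrespondence.clusterTorus_eq_iff
    (hiso : S₀.quiver.NoIsolatedMutable) {τ : S₀.MutationClass → Triangulation n}
    (hτ : IsSeedTriangulationCorrespondence S₀ τ) (S S' : S₀.MutationClass)
    {c c' : Fin (n + 3) → Fin 3} (hc : ∀ i j, (τ S).IsEdge s(i, j) → c i ≠ c j)
    (hc' : ∀ i j, (τ S').IsEdge s(i, j) → c' i ≠ c' j) :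
    S₀.clusterTorus S = S₀.clusterTorus S' ↔
      ∀ i j, s(i, j) ∈ (τ S').diagonals → c i ≠ c j := by
  obtain ⟨w, hcl, hval⟩ := hτ.exists_hasValueAtOne hiso
  obtain ⟨φ, hφ, hφv⟩ := hτ.exists_clusterTorus_eq hiso S hc
  obtain ⟨φ', hφ', -⟩ := hτ.exists_clusterTorus_eq hiso S' hc'
  -- membership of the first point in the second torus
  have key : φ ∈ S₀.clusterTorus S' ↔ ∀ i j, s(i, j) ∈ (τ S').diagonals → c i ≠ c j := by
    constructor
    · intro h i j hij hcij
      have hmem : w s(i, j) ∈ S'.1.cluster := by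
        rw [hcl]
        exact ⟨_, hij, rfl⟩
      have hA : w s(i, j) ∈ S₀.clusterAlgebra :=
        Algebra.subset_adjoin (.inl (.inl (Set.mem_iUnion.2 ⟨S', hmem⟩)))
      refine h ⟨_, hA⟩ hmem ?_
      rw [(hφv ⟨_, hA⟩).unique (hval S c hc _ ((τ S').isDiagonal _ hij).1), colourSeparation_mk,
        if_pos hcij]
    · intro h a ha
      rw [hcl] at ha
      obtain ⟨e, he, hea⟩ := ha
      have h1 := hval S c hc e ((τ S').isDiagonal e he).1
      rw [hea] at h1
      rw [(hφv a).unique h1]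
      induction e with | _ i j
      rw [colourSeparation_eq_one_of_ne (h i j he)]
      exact one_ne_zero
  rw [← key, hφ, hφ', Set.mem_singleton_iff, Set.singleton_eq_singleton_iff]

end Torus

/-! ### Triangulations as binary trees -/

/-- Triangulations of the polygon with vertices `i, i + 1, …, j` as binary trees: either there is
only the side `{i, i + 1}`, or the root records the apex `k` of the triangle `i, k, j`. -/
inductive TriTree : ℕ → ℕ → Type
  | side {i j : ℕ} (h : i + 1 = j) : TriTree i j
  | node {i j : ℕ} (k : ℕ) (a : TriTree i k) (b : TriTree k j) : TriTree i j

namespace TriTree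

variable {i j k : ℕ}

theorem lt (t : TriTree i j) : i < j := by
  induction t <;> omega

/-- The edges of the triangulation, including the sides of the polygon. -/
def IsEdge : {i j : ℕ} → TriTree i j → Sym2 ℕ → Prop
  | i, j, side _, e => e = s(i, j)
  | i, j, node _ a b, e => e = s(i, j) ∨ a.IsEdge e ∨ b.IsEdge e

@[simp]
theorem isEdge_side (h : i + 1 = j) (e : Sym2 ℕ) : (side h).IsEdge e ↔ e = s(i, j) := Iff.rfl

@[simp]
theorem isEdge_node (a : TriTree i k) (b : TriTree k j) (e : Sym2 ℕ) :
    (node k a b).IsEdge e ↔ e = s(i, j) ∨ a.IsEdge e ∨ b.IsEdge e := Iff.rfl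

@[simp]
theorem isEdge_root (t : TriTree i j) : t.IsEdge s(i, j) := by
  cases t <;> simp

theorem IsEdge.bounds {t : TriTree i j} {p q : ℕ} (h : t.IsEdge s(p, q)) :
    i ≤ p ∧ p ≤ j ∧ i ≤ q ∧ q ≤ j ∧ p ≠ q := by
  induction t with
  | side h' =>
    rw [isEdge_side, Sym2.eq_iff] at h
    omega
  | node k a b iha ihb =>
    have := a.lt
    have := b.lt
    rw [isEdge_node, Sym2.eq_iff] at h
    rcases h with h | h | h
    · omega
    · have := iha h
      omega
    · have := ihb h
      omega

theorem IsEdge.not_cross {t : TriTree i j} {p q r s : ℕ} (h : t.IsEdge s(p, r))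
    (h' : t.IsEdge s(q, s)) (hpq : p < q) (hqr : q < r) (hrs : r < s) : False := by
  induction t with
  | side _ =>
    rw [isEdge_side, Sym2.eq_iff] at h h'
    omega
  | node k a b iha ihb =>
    have h1 := h.bounds
    have h2 := h'.bounds
    rw [isEdge_node, Sym2.eq_iff] at h h'
    rcases h with h | h | h <;> rcases h' with h' | h' | h'
    · omega
    · have := h'.bounds
      omega
    · have := h'.bounds
      omega
    · omega
    · exact iha h h'
    · have := h.bounds
      have := h'.bounds
      omega
    · omega
    · have := h.bounds
      have := h'.bounds
      omega
    · exact ihb h h'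

/-- A chord that is not an edge of the triangulation crosses an edge. -/
theorem exists_isEdge_cross (t : TriTree i j) {p q : ℕ} (hip : i ≤ p) (hpq : p < q) (hqj : q ≤ j) :
    t.IsEdge s(p, q) ∨ ∃ u v, t.IsEdge s(u, v) ∧ ((u < p ∧ p < v ∧ v < q) ∨
      (p < u ∧ u < q ∧ q < v)) := by
  induction t with
  | side h =>
    left
    rw [isEdge_side, Sym2.eq_iff]
    omega
  | @node i j k a b iha ihb =>
    have hk := a.lt
    have hk' := b.lt
    by_cases h1 : q ≤ k
    · rcases iha hip h1 with h | ⟨u, v, h, h'⟩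
      · exact .inl (.inr (.inl h))
      · exact .inr ⟨u, v, .inr (.inl h), h'⟩
    by_cases h2 : k ≤ p
    · rcases ihb h2 hqj with h | ⟨u, v, h, h'⟩
      · exact .inl (.inr (.inr h))
      · exact .inr ⟨u, v, .inr (.inr h), h'⟩
    by_cases h3 : i < p
    · exact .inr ⟨i, k, by simp, by omega⟩
    by_cases h4 : q < j
    · exact .inr ⟨k, j, by simp, by omega⟩
    left
    rw [isEdge_node, Sym2.eq_iff]
    omega

/-! ### Proper colourings of a tree -/

/-- The colouring `c` is proper on the graph of edges of the triangulation. -/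
def Proper {C : Type*} (c : ℕ → C) : {i j : ℕ} → TriTree i j → Prop
  | i, j, side _ => c i ≠ c j
  | i, j, node _ a b => c i ≠ c j ∧ a.Proper c ∧ b.Proper c

@[simp]
theorem proper_side {C : Type*} {c : ℕ → C} (h : i + 1 = j) : (side h).Proper c ↔ c i ≠ c j :=
  Iff.rfl

@[simp]
theorem proper_node {C : Type*} {c : ℕ → C} (a : TriTree i k) (b : TriTree k j) :
    (node k a b).Proper c ↔ c i ≠ c j ∧ a.Proper c ∧ b.Proper c := Iff.rfl

theorem Proper.ne {C : Type*} {c : ℕ → C} {t : TriTree i j} (h : t.Proper c) : c i ≠ c j := by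
  cases t
  · exact h
  · exact h.1

theorem proper_iff {C : Type*} {c : ℕ → C} {t : TriTree i j} :
    t.Proper c ↔ ∀ p q, t.IsEdge s(p, q) → c p ≠ c q := by
  constructor
  · intro h p q hpq
    have aux : ∀ {i j}, c i ≠ c j → s(p, q) = s(i, j) → c p ≠ c q := by
      intro i j hij h
      rcases Sym2.eq_iff.1 h with ⟨rfl, rfl⟩ | ⟨rfl, rfl⟩
      · exact hij
      · exact hij.symm
    induction t with
    | side _ => exact aux h hpq
    | node k a b iha ihb =>
      rcases hpq with hpq | hpq | hpq
      · exact aux h.1 hpq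
      · exact iha h.2.1 hpq
      · exact ihb h.2.2 hpq
  · intro h
    induction t with
    | side _ => exact h _ _ rfl
    | node k a b iha ihb =>
      exact ⟨h _ _ (.inl rfl), iha fun p q hpq => h p q (.inr (.inl hpq)),
        ihb fun p q hpq => h p q (.inr (.inr hpq))⟩

/-- Every triangulation has a proper colouring with given different colours at the endpoints of the
root; together with `Proper.eq`, this colouring is unique. -/
theorem exists_proper (t : TriTree i j) {α β : Fin 3} (h : α ≠ β) :
    ∃ c : ℕ → Fin 3, c i = α ∧ c j = β ∧ t.Proper c := by
  induction t generalizing α β with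
  | @side i j h' =>
    refine ⟨fun m => if m = i then α else β, by simp, ?_, ?_⟩
    · simp [← h']
    · simpa [← h'] using h
  | @node i j k a b iha ihb =>
    have hk := a.lt
    have hk' := b.lt
    obtain ⟨γ, h1, h2⟩ : ∃ γ : Fin 3, α ≠ γ ∧ γ ≠ β := by
      revert α β
      decide
    obtain ⟨c, hc1, hc2, hc⟩ := iha h1
    obtain ⟨c', hc1', hc2', hc'⟩ := ihb h2
    refine ⟨fun m => if m ≤ k then c m else c' m, by simp [hk.le, hc1],
      by simp [hk'.not_ge, hc2'], ?_⟩
    rw [proper_node, proper_iff, proper_iff]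
    rw [proper_iff] at hc hc'
    refine ⟨by simpa [hk.le, hc1, hk'.not_ge, hc2'] using h, fun p q hpq => ?_, fun p q hpq => ?_⟩
    · obtain ⟨-, h1, -, h2, -⟩ := hpq.bounds
      simpa [h1, h2] using hc p q hpq
    · obtain ⟨h1, -, h2, -, -⟩ := hpq.bounds
      have : ∀ p, k ≤ p → (if p ≤ k then c p else c' p) = c' p := by
        intro p hp
        split_ifs with h
        · rw [le_antisymm h hp, hc2, hc1']
        · rfl
      simpa only [this p h1, this q h2] using hc' p q hpq

theorem Proper.eq {c c' : ℕ → Fin 3} {t : TriTree i j} (h : t.Proper c) (h' : t.Proper c')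
    (hi : c i = c' i) (hj : c j = c' j) {m : ℕ} (him : i ≤ m) (hmj : m ≤ j) : c m = c' m := by
  induction t with
  | @side i j h'' =>
    obtain rfl | rfl : m = i ∨ m = j := by omega
    · exact hi
    · exact hj
  | @node i j k a b iha ihb =>
    have hk : c k = c' k := by
      have h1 := h.1
      have h2 := h.2.1.ne
      have h3 := h.2.2.ne
      have h4 := h'.2.1.ne
      have h5 := h'.2.2.ne
      rw [← hi] at h4
      rw [← hj] at h5
      omega
    by_cases hm : m ≤ k
    · exact iha h.2.1 h'.2.1 hi hk him hm
    · exact ihb h.2.2 h'.2.2 hk hj (by omega) hmj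

/-- The apex of the triangle over `ij` has the third colour. -/
theorem Proper.exists_third {c : ℕ → Fin 3} {t : TriTree i j} (h : t.Proper c) (hij : i + 1 < j) :
    ∃ k, i < k ∧ k < j ∧ c k ≠ c i ∧ c k ≠ c j := by
  cases t with
  | side _ => omega
  | node k a b => exact ⟨k, a.lt, b.lt, h.2.1.ne.symm, h.2.2.ne⟩

end TriTree

theorem Nat.exists_last {P : ℕ → Prop} {k j : ℕ} (hk : P k) (hkj : k < j) :
    ∃ m, k ≤ m ∧ m < j ∧ P m ∧ ∀ l, m < l → l < j → ¬ P l := by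
  classical
  have h := Nat.findGreatest_spec (P := P) (m := k) (n := j - 1) (by omega) hk
  refine ⟨Nat.findGreatest P (j - 1), Nat.le_findGreatest (by omega) hk, ?_, h, ?_⟩
  · have := Nat.findGreatest_le (P := P) (j - 1)
    omega
  · intro l h1 h2
    exact Nat.findGreatest_is_greatest h1 (by omega)

namespace TriTree

/-- A polygon whose consecutive vertices have different colours has a triangulation on which the
colouring is proper, provided that all three colours occur. -/
theorem exists_tree {c : ℕ → Fin 3} {i j : ℕ} (hij : i < j)
    (hc : ∀ m, i ≤ m → m < j → c m ≠ c (m + 1)) (hne : c i ≠ c j)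
    (h : j = i + 1 ∨ ∃ k, i < k ∧ k < j ∧ c k ≠ c i ∧ c k ≠ c j) :
    ∃ t : TriTree i j, t.Proper c := by
  induction hd : j - i using Nat.strong_induction_on generalizing i j with
  | _ d ih =>
  have hlt : ∀ k, i < k → k < j → k - i < d ∧ j - k < d := fun k h1 h2 =>
    ⟨by clear h; omega, by clear h; omega⟩
  rcases h with h | ⟨k, hik, hkj, hki, hkj'⟩
  · exact ⟨side h.symm, hne⟩
  -- it suffices to find a suitable apex
  suffices ∃ k, i < k ∧ k < j ∧ c k ≠ c i ∧ c k ≠ c j ∧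
      (k = i + 1 ∨ ∃ l, i < l ∧ l < k ∧ c l ≠ c i ∧ c l ≠ c k) ∧
      (j = k + 1 ∨ ∃ l, k < l ∧ l < j ∧ c l ≠ c k ∧ c l ≠ c j) by
    obtain ⟨k, h1, h2, h3, h4, h5, h6⟩ := this
    obtain ⟨a, ha⟩ := ih (k - i) (hlt k h1 h2).1 h1 (fun m h h' => hc m h (by omega)) h3.symm h5 rfl
    obtain ⟨b, hb⟩ := ih (j - k) (hlt k h1 h2).2 h2 (fun m h h' => hc m (by omega) h') h4 h6 rfl
    exact ⟨node k a b, hne, ha, hb⟩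
  have h1 := hc i le_rfl hij
  -- The last vertex of the third colour is an apex if `i + 1` has the colour of `j`. Otherwise
  -- `i + 1` has the third colour, and it is an apex unless the colour of `i` does not occur after it,
  -- in which case the colours of the vertices between `i` and `j` alternate and `j - 1` is an apex.
  by_cases hcase : c (i + 1) = c j
  · obtain ⟨m, h2, h3, h4, h5⟩ := Nat.exists_last (P := fun m => c m ≠ c i ∧ c m ≠ c j)
      ⟨hki, hkj'⟩ hkj
    have him : m ≠ i + 1 := by
      rintro rfl
      exact h4.2 hcase
    refine ⟨m, by omega, h3, h4.1, h4.2, .inr ⟨i + 1, by omega, by omega, h1.symm, ?_⟩, ?_⟩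
    · rw [hcase]
      exact h4.2.symm
    by_cases h6 : j = m + 1
    · exact .inl h6
    right
    by_cases h7 : c (m + 1) = c j
    · have h8 := hc (m + 1) (by omega) (by omega)
      have h9 : m + 2 ≠ j := by
        rintro rfl
        exact h8 h7
      have h10 := h5 (m + 2) (by omega) (by omega)
      refine ⟨m + 2, by omega, by omega, ?_⟩
      change c (m + 1) ≠ c (m + 2) at h8
      omega
    · have h8 := hc m (by omega) (by omega)
      exact ⟨m + 1, by omega, by omega, h8.symm, h7⟩
  · by_cases h2 : j = i + 1 + 1 ∨ ∃ l, i + 1 < l ∧ l < j ∧ c l = c i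
    · refine ⟨i + 1, by omega, by omega, h1.symm, hcase, .inl rfl, ?_⟩
      refine h2.imp id ?_
      rintro ⟨l, h3, h4, h5⟩
      exact ⟨l, h3, h4, h5 ▸ h1, h5 ▸ hne⟩
    · push Not at h2
      obtain ⟨m, rfl⟩ : ∃ m, j = m + 1 := ⟨j - 1, by omega⟩
      have h3 := hc m (by omega) (by omega)
      have h4 := h2.2 m (by omega) (by omega)
      have h5 := hc (i + 1) (by omega) (by omega)
      have h6 := h2.2 (i + 2) (by omega) (by omega)
      refine ⟨m, by omega, by omega, h4, h3, .inr ⟨i + 2, by omega, ?_, h6, ?_⟩, .inl rfl⟩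
      · have : i + 2 ≠ m := by
          rintro rfl
          change c (i + 1) ≠ c (i + 2) at h5
          omega
        omega
      · change c (i + 1) ≠ c (i + 2) at h5
        omega

end TriTree

/-! ### Hexagonal moves of trees -/

namespace Triangulation

theorem IsHexagonExchange.symm {D D' : Finset (Sym2 (Fin 6))} (h : IsHexagonExchange D D') :
    IsHexagonExchange D' D := by
  obtain ⟨r, h | h | ⟨rfl, rfl⟩⟩ := h
  · exact ⟨r, .inr (.inl h.symm)⟩
  · exact ⟨r, .inl h.symm⟩
  · refine ⟨r + 1, .inr (.inr ⟨rfl, ?_⟩)⟩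
    revert r
    decide

end Triangulation

namespace TriTree

variable {i j k : ℕ}

/-- The triangulation `t'` is obtained from `t` by exchanging the diagonals `D` of the hexagon with
vertices `v 0 < ⋯ < v 5` for the diagonals `D'`. -/
structure IsExchange (v : Fin 6 → ℕ) (D D' : Finset (Sym2 (Fin 6))) (t t' : TriTree i j) :
    Prop where
  strictMono : StrictMono v
  exchange : Triangulation.IsHexagonExchange D D'
  side : ∀ a, t.IsEdge s(v a, v (a + 1)) ∧ t'.IsEdge s(v a, v (a + 1))
  mem : ∀ d ∈ D, t.IsEdge (d.map v)
  mem' : ∀ d ∈ D', t'.IsEdge (d.map v)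
  imp : ∀ e, t.IsEdge e → t'.IsEdge e ∨ ∃ d ∈ D, e = d.map v
  imp' : ∀ e, t'.IsEdge e → t.IsEdge e ∨ ∃ d ∈ D', e = d.map v

theorem IsExchange.symm {v : Fin 6 → ℕ} {D D' : Finset (Sym2 (Fin 6))} {t t' : TriTree i j}
    (h : IsExchange v D D' t t') : IsExchange v D' D t' t :=
  ⟨h.strictMono, h.exchange.symm, fun a => (h.side a).symm, h.mem', h.mem, h.imp', h.imp⟩

theorem IsExchange.left {v : Fin 6 → ℕ} {D D' : Finset (Sym2 (Fin 6))} {a a' : TriTree i k}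
    (h : IsExchange v D D' a a') (b : TriTree k j) :
    IsExchange v D D' (node k a b) (node k a' b) where
  strictMono := h.strictMono
  exchange := h.exchange
  side x := ⟨.inr (.inl (h.side x).1), .inr (.inl (h.side x).2)⟩
  mem d hd := .inr (.inl (h.mem d hd))
  mem' d hd := .inr (.inl (h.mem' d hd))
  imp e := by
    have := h.imp e
    simp only [isEdge_node]
    tauto
  imp' e := by
    have := h.imp' e
    simp only [isEdge_node]
    tauto

theorem IsExchange.right {v : Fin 6 → ℕ} {D D' : Finset (Sym2 (Fin 6))} {b b' : TriTree k j}
    (h : IsExchange v D D' b b') (a : TriTree i k) :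
    IsExchange v D D' (node k a b) (node k a b') where
  strictMono := h.strictMono
  exchange := h.exchange
  side x := ⟨.inr (.inr (h.side x).1), .inr (.inr (h.side x).2)⟩
  mem d hd := .inr (.inr (h.mem d hd))
  mem' d hd := .inr (.inr (h.mem' d hd))
  imp e := by
    have := h.imp e
    simp only [isEdge_node]
    tauto
  imp' e := by
    have := h.imp' e
    simp only [isEdge_node]
    tauto

/-- `t'` is obtained from `t` by a hexagonal move. -/
def HexagonalMove (t t' : TriTree i j) : Prop := ∃ v D D', IsExchange v D D' t t'

/-- `t` and `t'` are connected by a sequence of hexagonal moves. -/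
def Connected (t t' : TriTree i j) : Prop := Relation.ReflTransGen HexagonalMove t t'

theorem Connected.symm {t t' : TriTree i j} (h : Connected t t') : Connected t' t := by
  induction h with
  | refl => exact .refl
  | tail _ h ih =>
    obtain ⟨v, D, D', h⟩ := h
    exact .head ⟨v, D', D, h.symm⟩ ih

theorem Connected.trans {t t' t'' : TriTree i j} (h : Connected t t') (h' : Connected t' t'') :
    Connected t t'' := Relation.ReflTransGen.trans h h'

theorem Connected.left {a a' : TriTree i k} (h : Connected a a') (b : TriTree k j) :
    Connected (node k a b) (node k a' b) := by
  induction h with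
  | refl => exact .refl
  | tail _ h ih =>
    obtain ⟨v, D, D', h⟩ := h
    exact .tail ih ⟨v, D, D', h.left b⟩

theorem Connected.right {b b' : TriTree k j} (h : Connected b b') (a : TriTree i k) :
    Connected (node k a b) (node k a b') := by
  induction h with
  | refl => exact .refl
  | tail _ h ih =>
    obtain ⟨v, D, D', h⟩ := h
    exact .tail ih ⟨v, D, D', h.right a⟩

theorem connected_of_exchange {v : Fin 6 → ℕ} {D D' : Finset (Sym2 (Fin 6))} {t t' : TriTree i j}
    (h : IsExchange v D D' t t') : Connected t t' := .single ⟨v, D, D', h⟩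

theorem strictMono_hexagon {v₀ v₁ v₂ v₃ v₄ v₅ : ℕ} (h₀ : v₀ < v₁) (h₁ : v₁ < v₂) (h₂ : v₂ < v₃)
    (h₃ : v₃ < v₄) (h₄ : v₄ < v₅) : StrictMono ![v₀, v₁, v₂, v₃, v₄, v₅] := by
  rw [Fin.strictMono_iff_lt_succ]
  intro a
  fin_cases a <;> simpa

/-! The hexagonal moves in `v₀v₁v₂v₃v₄v₅` that change the apex of the triangle over `v₀v₅`. A zig-zag
move is named after the antipodal vertices of the hexagon that its zig-zags join. -/

section Moves

variable {v₀ v₁ v₂ v₃ v₄ v₅ : ℕ} (s₀ : TriTree v₀ v₁) (s₁ : TriTree v₁ v₂) (s₂ : TriTree v₂ v₃)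
  (s₃ : TriTree v₃ v₄) (s₄ : TriTree v₄ v₅)

theorem connected_zigzag_one_four :
    Connected (node v₁ s₀ (node v₂ s₁ (node v₄ (node v₃ s₂ s₃) s₄)))
      (node v₄ (node v₃ (node v₁ s₀ (node v₂ s₁ s₂)) s₃) s₄) := by
  refine connected_of_exchange (v := ![v₀, v₁, v₂, v₃, v₄, v₅])
    (D := {s(1, 5), s(2, 5), s(2, 4)}) (D' := {s(0, 4), s(0, 3), s(1, 3)})
    ⟨strictMono_hexagon s₀.lt s₁.lt s₂.lt s₃.lt s₄.lt, by
      unfold Triangulation.IsHexagonExchange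
      decide, fun a => ?_, by simp, by simp, fun e => ?_, fun e => ?_⟩
  · fin_cases a <;> simp [Sym2.eq_swap]
  · simp
    grind
  · simp
    grind

theorem connected_inscribed :
    Connected (node v₁ s₀ (node v₃ (node v₂ s₁ s₂) (node v₄ s₃ s₄)))
      (node v₄ (node v₂ (node v₁ s₀ s₁) (node v₃ s₂ s₃)) s₄) := by
  refine connected_of_exchange (v := ![v₀, v₁, v₂, v₃, v₄, v₅])
    (D := {s(1, 5), s(3, 5), s(1, 3)}) (D' := {s(0, 4), s(2, 4), s(0, 2)})
    ⟨strictMono_hexagon s₀.lt s₁.lt s₂.lt s₃.lt s₄.lt, by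
      unfold Triangulation.IsHexagonExchange
      decide, fun a => ?_, by simp, by simp, fun e => ?_, fun e => ?_⟩
  · fin_cases a <;> simp [Sym2.eq_swap]
  · simp
    grind
  · simp
    grind

theorem connected_zigzag_zero_three :
    Connected (node v₂ (node v₁ s₀ s₁) (node v₃ s₂ (node v₄ s₃ s₄)))
      (node v₄ (node v₁ s₀ (node v₃ (node v₂ s₁ s₂) s₃)) s₄) := by
  refine connected_of_exchange (v := ![v₀, v₁, v₂, v₃, v₄, v₅])
    (D := {s(0, 2), s(2, 5), s(3, 5)}) (D' := {s(0, 4), s(1, 4), s(1, 3)})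
    ⟨strictMono_hexagon s₀.lt s₁.lt s₂.lt s₃.lt s₄.lt, by
      unfold Triangulation.IsHexagonExchange
      decide, fun a => ?_, by simp, by simp, fun e => ?_, fun e => ?_⟩
  · fin_cases a <;> simp [Sym2.eq_swap]
  · simp
    grind
  · simp
    grind

theorem connected_zigzag_two_five :
    Connected (node v₁ s₀ (node v₄ (node v₂ s₁ (node v₃ s₂ s₃)) s₄))
      (node v₃ (node v₂ (node v₁ s₀ s₁) s₂) (node v₄ s₃ s₄)) := by
  refine connected_of_exchange (v := ![v₀, v₁, v₂, v₃, v₄, v₅])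
    (D := {s(1, 5), s(1, 4), s(2, 4)}) (D' := {s(3, 5), s(0, 3), s(0, 2)})
    ⟨strictMono_hexagon s₀.lt s₁.lt s₂.lt s₃.lt s₄.lt, by
      unfold Triangulation.IsHexagonExchange
      decide, fun a => ?_, by simp, by simp, fun e => ?_, fun e => ?_⟩
  · fin_cases a <;> simp [Sym2.eq_swap]
  · simp
    grind
  · simp
    grind

end Moves

end TriTree

/-! ### Trees with the same colouring are connected -/

namespace TriTree

variable {i j k : ℕ}

theorem isEdge_succ (t : TriTree i j) {m : ℕ} (him : i ≤ m) (hmj : m < j) :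
    t.IsEdge s(m, m + 1) := by
  rcases t.exists_isEdge_cross him (Nat.lt_succ_self m) hmj with h | ⟨u, v, -, h⟩
  · exact h
  · omega

theorem Proper.ne_succ {c : ℕ → Fin 3} {t : TriTree i j} (h : t.Proper c) {m : ℕ} (him : i ≤ m)
    (hmj : m < j) : c m ≠ c (m + 1) := proper_iff.1 h _ _ (t.isEdge_succ him hmj)

/-- If the block between the vertices `k` and `l` of the same colour contains both other colours,
then it has a vertex `y` whose colour differs from those of `k` and `k + 1` such that the polygons
over the chords from `k + 1` to `y` and from `y` to `l` can be triangulated. -/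
theorem exists_block_split {c : ℕ → Fin 3} {k l q : ℕ} (hkl : c k = c l)
    (hc : ∀ m, k ≤ m → m < l → c m ≠ c (m + 1)) (hkq : k < q) (hql : q < l) (hq : c q ≠ c k)
    (hq' : c q ≠ c (k + 1)) :
    ∃ y, c y ≠ c k ∧ c y ≠ c (k + 1) ∧ (∃ t : TriTree (k + 1) y, t.Proper c) ∧
      ∃ t : TriTree y l, t.Proper c := by
  classical
  -- `z` is the first vertex with the third colour; if it is not suitable, then the block alternates
  -- after `z` and the last vertex before `l` is suitable
  have hex : ∃ z, k < z ∧ c z ≠ c k ∧ c z ≠ c (k + 1) := ⟨q, hkq, hq, hq'⟩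
  obtain ⟨z, ⟨h1, h2, h3⟩, h4, hzq⟩ : ∃ z, (k < z ∧ c z ≠ c k ∧ c z ≠ c (k + 1)) ∧
      (∀ m, k < m → m < z → ¬ (c m ≠ c k ∧ c m ≠ c (k + 1))) ∧ z ≤ q :=
    ⟨Nat.find hex, Nat.find_spec hex, fun m h h' h'' => Nat.find_min hex h' ⟨h, h''⟩,
      Nat.find_le ⟨hkq, hq, hq'⟩⟩
  clear hex
  have h5 : z ≠ k + 1 := by
    rintro rfl
    exact h3 rfl
  have hk := hc k le_rfl (by omega)
  have hk' : c (k + 1) ≠ c (k + 2) := hc (k + 1) (by omega) (by omega)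
  have hz := hc z (by omega) (by omega)
  by_cases h6 : l = z + 1 ∨ ∃ m, z < m ∧ m < l ∧ c m = c (k + 1)
  · refine ⟨z, h2, h3, exists_tree (by clear h6; omega) (fun m h h' => hc m (by omega) (by omega)) h3.symm ?_,
      exists_tree (by omega) (fun m h h' => hc m (by omega) h') (hkl ▸ h2) ?_⟩
    · by_cases h7 : z = k + 2
      · exact .inl h7
      · have := h4 (k + 2) (by omega) (by clear h6; omega)
        clear h6
        exact .inr ⟨k + 2, by omega, by omega, hk'.symm, by omega⟩
    · refine h6.imp id ?_
      rintro ⟨m, h7, h8, h9⟩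
      exact ⟨m, h7, h8, h9 ▸ h3.symm, by rw [h9, ← hkl]; exact hk.symm⟩
  · push Not at h6
    obtain ⟨m, rfl⟩ : ∃ m, l = m + 1 := ⟨l - 1, by omega⟩
    have hm := hc m (by omega) (by omega)
    rw [← hkl] at hm
    have h7 := h6.2 m (by omega) (by omega)
    have h8 := h6.2 (z + 1) (by omega) (by omega)
    have h9 : z + 1 ≠ m := by
      rintro rfl
      omega
    exact ⟨m, hm, h7, exists_tree (by omega) (fun m h h' => hc m (by omega) (by omega)) h7.symm
      (.inr ⟨z + 1, by omega, by omega, h8, by omega⟩), side rfl, by rwa [proper_side, ← hkl]⟩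

/-- Any two triangulations on which a colouring is proper are connected by hexagonal moves.

Let `k < k'` be the apices of the triangles over the root; they have the same colour. By induction
the triangulations of the polygons on either side of a root triangle may be changed arbitrarily, so
it suffices to find one move that takes the apex from `k` to `k'`, or an apex between them. If both
other colours occur between `k` and `k'`, two vertices of this block and `i, k, k', j` span the hexagon of
a zig-zag move or an inscribed triangle move. Otherwise the block alternates; then `k + 2` is an
intermediate apex, or `k' = k + 2` and there is a zig-zag move whose hexagon contains `k + 1` and one
vertex outside the block. -/
theorem Proper.connected {c : ℕ → Fin 3} {i j : ℕ} {t t' : TriTree i j} (ht : t.Proper c)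
    (ht' : t'.Proper c) : Connected t t' := by
  induction hd : j - i using Nat.strong_induction_on generalizing i j with
  | _ d ih =>
  have ihl : ∀ k, k < j → ∀ {a a' : TriTree i k}, a.Proper c → a'.Proper c → Connected a a' := by
    intro k hk a a' ha ha'
    have := a.lt
    exact ih (k - i) (by omega) ha ha' rfl
  have ihr : ∀ k, i < k → ∀ {b b' : TriTree k j}, b.Proper c → b'.Proper c → Connected b b' := by
    intro k hk b b' hb hb'
    have := b.lt
    exact ih (j - k) (by omega) hb hb' rfl
  clear ih hd
  have hne := ht.ne
  have hsucc : ∀ m, i ≤ m → m < j → c m ≠ c (m + 1) := fun m h h' => ht.ne_succ h h'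
  -- induction on the distance of the apices
  have key : ∀ (g k k' : ℕ) (a : TriTree i k) (b : TriTree k j) (a' : TriTree i k')
      (b' : TriTree k' j), k' - k = g → k < k' → a.Proper c → b.Proper c → a'.Proper c →
      b'.Proper c → Connected (node k a b) (node k' a' b') := by
    intro g
    induction g using Nat.strong_induction_on with
    | _ g ihg =>
    intro k k' a b a' b' hg hkk' ha hb ha' hb'
    have hik := a.lt
    have hkj := b.lt
    have hik' := a'.lt
    have hkj' := b'.lt
    have h1 := ha.ne
    have h2 := hb.ne
    have h3 := ha'.ne
    have h4 := hb'.ne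
    have hkc : c k = c k' := by omega
    have hs := hsucc k hik.le hkj
    have hk2 : k + 1 < k' := by
      have : k + 1 ≠ k' := by
        rintro rfl
        exact hs hkc
      omega
    have hs1 : c (k + 1) ≠ c (k + 2) := hsucc (k + 1) (by omega) (by omega)
    have hs₁ : (side rfl : TriTree k (k + 1)).Proper c := hs
    by_cases hi : ∃ q, k < q ∧ q < k' ∧ c q = c i
    · by_cases hj : ∃ q, k < q ∧ q < k' ∧ c q = c j
      · -- both other colours occur between `k` and `k'`
        obtain ⟨y, hy, hy', ⟨s₂, hs₂⟩, s₃, hs₃⟩ : ∃ y, c y ≠ c k ∧ c y ≠ c (k + 1) ∧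
            (∃ t : TriTree (k + 1) y, t.Proper c) ∧ ∃ t : TriTree y k', t.Proper c := by
          have hc' : ∀ m, k ≤ m → m < k' → c m ≠ c (m + 1) := fun m h h' =>
            hsucc m (by omega) (by omega)
          by_cases h : c (k + 1) = c i
          · obtain ⟨q, hq1, hq2, hq3⟩ := hj
            exact exists_block_split hkc hc' hq1 hq2 (by omega) (by omega)
          · obtain ⟨q, hq1, hq2, hq3⟩ := hi
            exact exists_block_split hkc hc' hq1 hq2 (by omega) (by omega)
        clear hi hj
        by_cases h : c (k + 1) = c i
        · refine ((ihr k hik (b' := node (k + 1) (side rfl) (node k' (node y s₂ s₃) b')) hb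
            ?_).right a).trans ((connected_zigzag_one_four ..).trans ((ihl k' hkj' ?_ ha').left b'))
          all_goals
            simp only [proper_node]
            and_intros <;> first | assumption | omega
        · refine ((ihr k hik (b' := node y (node (k + 1) (side rfl) s₂) (node k' s₃ b')) hb
            ?_).right a).trans ((connected_inscribed ..).trans ((ihl k' hkj' ?_ ha').left b'))
          all_goals
            simp only [proper_node]
            and_intros <;> first | assumption | omega
      · -- between `k` and `k'` only the colours of `k` and `i` occur
        clear hi
        push Not at hj
        have hj1 := hj (k + 1) (by omega) hk2
        by_cases h : k' = k + 2
        · -- the apex `x` over the edge `ik` has the colour of `j`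
          subst h
          have hs₂ : (side rfl : TriTree (k + 1) (k + 2)).Proper c := hs1
          cases a with
          | side h =>
            subst h
            obtain ⟨q, hq1, hq2, hq3, hq4⟩ := ha'.exists_third (by omega)
            have : q ≠ i + 1 := by
              rintro rfl
              omega
            obtain rfl : q = i + 1 + 1 := by omega
            omega
          | node x a₁ a₂ =>
            obtain ⟨-, ha₁, ha₂⟩ := ha
            have hx := ha₁.ne
            have hx' := ha₂.ne
            refine ((ihr k hik (b' := node (k + 1) (side rfl) (node (k + 2) (side rfl) b')) hb
              ?_).right _).trans ((connected_zigzag_zero_three ..).trans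
                ((ihl (k + 2) hkj' ?_ ha').left b'))
            all_goals
              simp only [proper_node]
              and_intros <;> first | assumption | omega
        · -- `k + 2` is an intermediate apex
          have hj2 := hj (k + 2) (by omega) (by omega)
          have hs2 : c (k + 2) ≠ c (k + 3) := hsucc (k + 2) (by omega) (by omega)
          have hk3 : k + 3 ≠ k' := by
            rintro rfl
            omega
          have hj3 := hj (k + 3) (by omega) (by omega)
          obtain ⟨q, hq1, hq2, hq3, hq4⟩ := ha'.exists_third (by omega)
          have hqk : q ≠ k := by
            rintro rfl
            omega
          have hqk' : q < k := by
            by_contra hq5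
            have := hj q (by omega) hq2
            omega
          obtain ⟨a'', ha''⟩ := exists_tree (c := c) (i := i) (j := k + 2) (by omega)
            (fun m h h' => hsucc m h (by omega)) (by omega)
            (.inr ⟨q, hq1, by omega, hq3, by omega⟩)
          obtain ⟨b'', hb''⟩ := exists_tree (c := c) (i := k + 2) (j := j) (by omega)
            (fun m h h' => hsucc m (by omega) h') (by omega)
            (.inr ⟨k + 3, by omega, by omega, by omega, by omega⟩)
          exact (ihg _ (by omega) k (k + 2) a b a'' b'' rfl (by omega) ha hb ha'' hb'').trans
            (ihg _ (by omega) (k + 2) k' a'' b'' a' b' rfl (by omega) ha'' hb'' ha' hb')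
    · -- between `k` and `k'` only the colours of `k` and `j` occur
      push Not at hi
      have hi1 := hi (k + 1) (by omega) hk2
      by_cases h : k' = k + 2
      · -- the apex `y` over the edge `k'j` has the colour of `i`
        subst h
        have hs₂ : (side rfl : TriTree (k + 1) (k + 2)).Proper c := hs1
        cases b' with
        | side h =>
          subst h
          obtain ⟨q, hq1, hq2, hq3, hq4⟩ := hb.exists_third (by omega)
          have : q ≠ k + 1 := by
            rintro rfl
            omega
          obtain rfl : q = k + 2 := by omega
          omega
        | node y b₁ b₂ =>
          obtain ⟨-, hb₁, hb₂⟩ := hb'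
          have hy := hb₁.ne
          have hy' := hb₂.ne
          refine ((ihr k hik (b' := node y (node (k + 1) (side rfl) (node (k + 2) (side rfl) b₁)) b₂)
            hb ?_).right _).trans ((connected_zigzag_two_five ..).trans
              ((ihl (k + 2) hkj' ?_ ha').left _))
          all_goals
            simp only [proper_node]
            and_intros <;> first | assumption | omega
      · -- `k + 2` is an intermediate apex
        have hi2 := hi (k + 2) (by omega) (by omega)
        obtain ⟨q, hq1, hq2, hq3, hq4⟩ := hb.exists_third (by omega)
        have hqk : k' ≤ q := by
          by_contra hq5
          have := hi q hq1 (by omega)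
          omega
        obtain ⟨a'', ha''⟩ := exists_tree (c := c) (i := i) (j := k + 2) (by omega)
          (fun m h h' => hsucc m h (by omega)) (by omega)
          (.inr ⟨k + 1, by omega, by omega, by omega, by omega⟩)
        obtain ⟨b'', hb''⟩ := exists_tree (c := c) (i := k + 2) (j := j) (by omega)
          (fun m h h' => hsucc m (by omega) h') (by omega)
          (.inr ⟨q, by omega, hq2, by omega, hq4⟩)
        exact (ihg _ (by omega) k (k + 2) a b a'' b'' rfl (by omega) ha hb ha'' hb'').trans
          (ihg _ (by omega) (k + 2) k' a'' b'' a' b' rfl (by omega) ha'' hb'' ha' hb')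
  cases t with
  | side h =>
    cases t' with
    | side _ => exact .refl
    | node k a b =>
      have := a.lt
      have := b.lt
      omega
  | node k a b =>
    cases t' with
    | side _ =>
      have := a.lt
      have := b.lt
      omega
    | node k' a' b' =>
      rcases lt_trichotomy k k' with h | rfl | h
      · exact key _ k k' a b a' b' rfl h ht.2.1 ht.2.2 ht'.2.1 ht'.2.2
      · exact ((ihl k b.lt ht.2.1 ht'.2.1).left b).trans ((ihr k a.lt ht.2.2 ht'.2.2).right a')
      · exact (key _ k' k a' b' a b rfl h ht'.2.1 ht'.2.2 ht.2.1 ht.2.2).symm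

end TriTree

/-! ### Triangulations and trees -/

namespace Triangulation

variable {n : ℕ}

/-- The tree `t` has the same edges as the triangulation `T`. -/
def IsTree (T : Triangulation n) (t : TriTree 0 (n + 2)) : Prop :=
  ∀ i j : Fin (n + 3), T.IsEdge s(i, j) ↔ t.IsEdge s(i.val, j.val)

/-- The tree is built by taking the apices of the triangles of `T`. It contains all edges of `T`, as
its edges cross every other chord. -/
theorem exists_isTree (T : Triangulation n) : ∃ t, T.IsTree t := by
  have key : ∀ i j : Fin (n + 3), i < j → T.IsEdge s(i, j) →
      ∃ t : TriTree i.val j.val, ∀ p q : Fin (n + 3), t.IsEdge s(p.val, q.val) →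
        T.IsEdge s(p, q) := by
    intro i j
    induction hd : j.val - i.val using Nat.strong_induction_on generalizing i j with
    | _ d ih =>
    intro hij h
    have haux : ∀ p q : Fin (n + 3), s(p.val, q.val) = s(i.val, j.val) → T.IsEdge s(p, q) := by
      intro p q hpq
      have : s(p, q) = s(i, j) := Sym2.map.injective Fin.val_injective hpq
      rwa [this]
    by_cases hs : i.val + 1 = j.val
    · exact ⟨.side hs, haux⟩
    obtain ⟨k, hk, hik, hkj⟩ := h.exists_apex (l := ⟨i + 1, by omega⟩) (by
      unfold Cyc3
      simp only [Fin.lt_def]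
      omega)
    have hk' : i < k ∧ k < j := by
      unfold Cyc3 at hk
      omega
    obtain ⟨a, ha⟩ := ih (k.val - i.val) (by omega) i k rfl hk'.1 hik
    obtain ⟨b, hb⟩ := ih (j.val - k.val) (by omega) k j rfl hk'.2 hkj
    exact ⟨.node k a b, fun p q hpq => hpq.elim (haux p q) (Or.elim · (ha p q) (hb p q))⟩
  obtain ⟨t, ht⟩ := key 0 (Fin.last (n + 2)) (Fin.last_pos) (.inl (by simp [isSide_mk]))
  have hconv : ∀ i j : Fin (n + 3), i < j → T.IsEdge s(i, j) → t.IsEdge s(i.val, j.val) := by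
    intro i j hij h
    rcases t.exists_isEdge_cross (Nat.zero_le _) hij (show j.val ≤ n + 2 by omega) with
      h' | ⟨u, v, huv, h'⟩
    · exact h'
    · obtain ⟨-, hu, -, hv, -⟩ := huv.bounds
      simp only [Fin.val_last] at hu hv
      have h1 := ht ⟨u, by omega⟩ ⟨v, by omega⟩ huv
      exfalso
      rcases h' with h' | h'
      · exact h1.not_cyc4 h (.inl h')
      · exact h.not_cyc4 h1 (.inl h')
  refine ⟨t, fun i j => ⟨fun h => ?_, ht i j⟩⟩
  rcases lt_or_gt_of_ne h.ne with h' | h'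
  · exact hconv i j h' h
  · rw [Sym2.eq_swap]
    exact hconv j i h' h.symm

end Triangulation

/-- The chords recorded by a tree do not cross, and every other chord crosses one of them. -/
theorem TriTree.exists_isTree {n : ℕ} (t : TriTree 0 (n + 2)) :
    ∃ T : Triangulation n, T.IsTree t := by
  classical
  have hnc : ∀ e f : Sym2 (Fin (n + 3)), t.IsEdge (e.map Fin.val) → t.IsEdge (f.map Fin.val) →
      ¬ Crosses e f := by
    rintro e f he hf ⟨a, b, c, d, h1, h2, h3, ⟨rfl, rfl⟩ | ⟨rfl, rfl⟩⟩
    · exact he.not_cross hf h1 h2 h3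
    · exact hf.not_cross he h1 h2 h3
  have hmax : ∀ i j : Fin (n + 3), i < j →
      (∀ f, IsDiagonal f → t.IsEdge (f.map Fin.val) → ¬ Crosses s(i, j) f) →
      t.IsEdge s(i.val, j.val) := by
    intro i j hij h
    rcases t.exists_isEdge_cross (Nat.zero_le _) hij (show j.val ≤ n + 2 by omega) with
      h' | ⟨u, v, huv, h'⟩
    · exact h'
    · obtain ⟨-, hu, -, hv, -⟩ := huv.bounds
      have hc : Crosses s(i, j) s((⟨u, by omega⟩ : Fin (n + 3)), ⟨v, by omega⟩) := by
        rw [crosses_mk]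
        unfold Cyc4
        simp only [Fin.lt_def]
        omega
      refine absurd hc (h _ ?_ huv)
      unfold IsDiagonal
      refine ⟨?_, fun hs => not_crosses_of_isSide hs hc.symm⟩
      simp only [Sym2.mk_isDiag_iff, Fin.mk.injEq]
      omega
  have hmax' : ∀ i j : Fin (n + 3), i ≠ j →
      (∀ f, IsDiagonal f → t.IsEdge (f.map Fin.val) → ¬ Crosses s(i, j) f) →
      t.IsEdge s(i.val, j.val) := by
    intro i j hij h
    rcases lt_or_gt_of_ne hij with h' | h'
    · exact hmax i j h' h
    · rw [Sym2.eq_swap]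
      exact hmax j i h' fun f => by
        rw [Sym2.eq_swap]
        exact h f
  refine ⟨⟨{e | IsDiagonal e ∧ t.IsEdge (e.map Fin.val)}, ?_, ?_, ?_⟩, ?_⟩
  · intro e he
    exact (Finset.mem_filter.1 he).2.1
  · intro e he f hf
    exact hnc e f (Finset.mem_filter.1 he).2.2 (Finset.mem_filter.1 hf).2.2
  · intro e he hf
    refine Finset.mem_filter.2 ⟨Finset.mem_univ _, he, ?_⟩
    induction e with | _ i j
    refine hmax' i j (by simpa using he.1) fun f h1 h2 => hf f ?_
    exact Finset.mem_filter.2 ⟨Finset.mem_univ _, h1, h2⟩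
  · intro i j
    constructor
    · rintro (h | h)
      · refine hmax' i j ?_ fun f _ _ => not_crosses_of_isSide h
        rintro rfl
        rw [isSide_mk] at h
        omega
      · exact (Finset.mem_filter.1 h).2.2
    · intro h
      by_cases hs : IsSide s(i, j)
      · exact .inl hs
      · refine .inr (Finset.mem_filter.2 ⟨Finset.mem_univ _, ⟨?_, hs⟩, h⟩)
        have := h.bounds
        rw [Sym2.mk_isDiag_iff, Fin.ext_iff]
        omega

namespace Triangulation

variable {n : ℕ}

/-- Every diagonal of a hexagon that is removed by a move crosses one that is added. -/
theorem IsHexagonExchange.exists_cyc4 {D D' : Finset (Sym2 (Fin 6))} (h : IsHexagonExchange D D')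
    {e : Sym2 (Fin 6)} (he : e ∈ D) :
    ∃ a b c d, e = s(a, c) ∧ s(b, d) ∈ D' ∧ Cyc4 a b c d := by
  obtain ⟨r, ⟨rfl, rfl⟩ | ⟨rfl, rfl⟩ | ⟨rfl, rfl⟩⟩ := h
  · simp only [zigzag, Finset.mem_insert, Finset.mem_singleton] at he
    rcases he with rfl | rfl | rfl
    · refine ⟨r, r + 1, r + 2, r + 3, rfl, by simp [zigzag'], ?_⟩
      revert r; unfold Cyc4; decide
    · refine ⟨r + 2, r - 2, r - 1, r + 1, rfl, by simp [zigzag'], ?_⟩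
      revert r; unfold Cyc4; decide
    · refine ⟨r + 3, r - 2, r - 1, r, Sym2.eq_swap, by simp [zigzag'], ?_⟩
      revert r; unfold Cyc4; decide
  · simp only [zigzag', Finset.mem_insert, Finset.mem_singleton] at he
    rcases he with rfl | rfl | rfl
    · refine ⟨r - 2, r - 1, r, r + 3, Sym2.eq_swap, by simp [zigzag], ?_⟩
      revert r; unfold Cyc4; decide
    · refine ⟨r - 2, r - 1, r + 1, r + 2, rfl, by simp [zigzag], ?_⟩
      revert r; unfold Cyc4; decide
    · refine ⟨r + 1, r + 2, r + 3, r, rfl, by simp [zigzag], ?_⟩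
      revert r; unfold Cyc4; decide
  · simp only [inscribed, Finset.mem_insert, Finset.mem_singleton] at he
    rcases he with rfl | rfl | rfl
    · refine ⟨r, r + 1, r + 2, r + 1 + 2, rfl, by simp [inscribed], ?_⟩
      revert r; unfold Cyc4; decide
    · refine ⟨r + 2, r + 1 + 2, r + 4, r + 1 + 4, rfl, by simp [inscribed], ?_⟩
      revert r; unfold Cyc4; decide
    · refine ⟨r + 4, r + 1 + 4, r, r + 1, rfl, by simp [inscribed], ?_⟩
      revert r; unfold Cyc4; decide

theorem IsTree.hexagonalMove {T T' : Triangulation n} {t t' : TriTree 0 (n + 2)}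
    (hT : T.IsTree t) (hT' : T'.IsTree t') (h : t.HexagonalMove t') : T.HexagonalMove T' := by
  obtain ⟨u, D, D', h⟩ := h
  have hu : ∀ a, u a < n + 3 := by
    intro a
    have := (h.side a).1.bounds
    omega
  let v : Fin 6 → Fin (n + 3) := fun a => ⟨u a, hu a⟩
  have hv : StrictMono v := fun a b hab => h.strictMono hab
  have hmap : ∀ d : Sym2 (Fin 6), (d.map v).map Fin.val = d.map u := by
    intro d
    rw [Sym2.map_map]
    rfl
  have hE : ∀ e : Sym2 (Fin (n + 3)), T.IsEdge e ↔ t.IsEdge (e.map Fin.val) := by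
    intro e
    induction e with | _ i j
    exact hT i j
  have hE' : ∀ e : Sym2 (Fin (n + 3)), T'.IsEdge e ↔ t'.IsEdge (e.map Fin.val) := by
    intro e
    induction e with | _ i j
    exact hT' i j
  have hcyc : ∀ {a b c d}, Cyc4 a b c d → Cyc4 (v a) (v b) (v c) (v d) := by
    intro a b c d h
    unfold Cyc4 at *
    simpa only [hv.lt_iff_lt] using h
  have hmem : ∀ e ∈ D.image (Sym2.map v), T.IsEdge e := by
    intro e he
    obtain ⟨d, hd, rfl⟩ := Finset.mem_image.1 he
    rw [hE, hmap]
    exact h.mem d hd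
  have hmem' : ∀ e ∈ D'.image (Sym2.map v), T'.IsEdge e := by
    intro e he
    obtain ⟨d, hd, rfl⟩ := Finset.mem_image.1 he
    rw [hE', hmap]
    exact h.mem' d hd
  have hcross : ∀ {D D' : Finset (Sym2 (Fin 6))}, IsHexagonExchange D D' →
      ∀ e ∈ D.image (Sym2.map v), IsDiagonal e ∧ ∃ f ∈ D'.image (Sym2.map v), Crosses e f := by
    intro D D' hD e he
    obtain ⟨d, hd, rfl⟩ := Finset.mem_image.1 he
    obtain ⟨p, q, r, s, rfl, hs, hpqrs⟩ := hD.exists_cyc4 hd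
    exact ⟨(hcyc hpqrs).isDiagonal, _, Finset.mem_image_of_mem _ hs,
      crosses_mk.2 (.inl (hcyc hpqrs))⟩
  have hinj : Function.Injective (Sym2.map (Fin.val : Fin (n + 3) → ℕ)) :=
    Sym2.map.injective Fin.val_injective
  refine ⟨v, hv, fun a => (hE _).2 (h.side a).1, D, D', h.exchange, fun e he =>
    (hmem e he).mem_diagonals (hcross h.exchange e he).1, ?_⟩
  ext e
  rw [Finset.mem_union, Finset.mem_sdiff]
  constructor
  · intro he
    rcases h.imp' _ ((hE' e).1 (.inr he)) with h1 | ⟨d, hd, h1⟩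
    · refine .inl ⟨((hE e).2 h1).mem_diagonals (T'.isDiagonal e he), fun h2 => ?_⟩
      obtain ⟨-, f, hf, hef⟩ := hcross h.exchange e h2
      exact IsEdge.not_crosses (.inr he) (hmem' f hf) hef
    · rw [← hmap] at h1
      exact .inr (Finset.mem_image.2 ⟨d, hd, (hinj h1).symm⟩)
  · rintro (⟨he, hne⟩ | he)
    · rcases h.imp _ ((hE e).1 (.inr he)) with h1 | ⟨d, hd, h1⟩
      · exact ((hE' e).2 h1).mem_diagonals (T.isDiagonal e he)
      · rw [← hmap] at h1
        exact absurd (Finset.mem_image.2 ⟨d, hd, (hinj h1).symm⟩) hne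
    · exact (hmem' e he).mem_diagonals (hcross h.exchange.symm e he).1

theorem IsTree.eq {T T' : Triangulation n} {t : TriTree 0 (n + 2)} (hT : T.IsTree t)
    (hT' : T'.IsTree t) : T = T' := by
  refine eq_of_subset fun e he => ?_
  have hd := T.isDiagonal e he
  induction e with | _ i j
  exact IsEdge.mem_diagonals ((hT' i j).2 ((hT i j).1 (.inr he))) hd

theorem IsTree.hexagonallyConnected {T T' : Triangulation n} {t t' : TriTree 0 (n + 2)}
    (hT : T.IsTree t) (hT' : T'.IsTree t') (h : t.Connected t') : T.HexagonallyConnected T' := by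
  induction h generalizing T' with
  | refl =>
    rw [hT.eq hT']
    exact .refl
  | @tail t₁ t₂ _ h ih =>
    obtain ⟨T₁, hT₁⟩ := t₁.exists_isTree
    exact .tail (ih hT₁) (hT₁.hexagonalMove hT' h)

/-! ### Proper colourings of triangulations -/

/-- The colouring `c` is proper on the graph formed by the edges of `T`. -/
def Proper {C : Type*} (T : Triangulation n) (c : Fin (n + 3) → C) : Prop :=
  ∀ i j, T.IsEdge s(i, j) → c i ≠ c j

theorem IsTree.proper_iff {C : Type*} {T : Triangulation n} {t : TriTree 0 (n + 2)}
    (hT : T.IsTree t) {c : ℕ → C} : t.Proper c ↔ T.Proper fun i => c i := by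
  rw [TriTree.proper_iff]
  constructor
  · exact fun h i j hij => h i j ((hT i j).1 hij)
  · intro h p q hpq
    obtain ⟨-, hp, -, hq, -⟩ := hpq.bounds
    exact h ⟨p, by omega⟩ ⟨q, by omega⟩ ((hT _ _).2 hpq)

theorem exists_extension {C : Type*} (c : Fin (n + 3) → C) :
    ∃ c' : ℕ → C, (fun i : Fin (n + 3) => c' i) = c :=
  ⟨fun m => c ⟨min m (n + 2), by omega⟩, funext fun i => congrArg c (Fin.ext (by simp; omega))⟩

theorem exists_proper (T : Triangulation n) {α β : Fin 3} (h : α ≠ β) :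
    ∃ c : Fin (n + 3) → Fin 3, c 0 = α ∧ c (Fin.last (n + 2)) = β ∧ T.Proper c := by
  obtain ⟨t, ht⟩ := T.exists_isTree
  obtain ⟨c, h0, h1, hc⟩ := t.exists_proper h
  exact ⟨fun i => c i, h0, h1, ht.proper_iff.1 hc⟩

theorem Proper.eq {T : Triangulation n} {c c' : Fin (n + 3) → Fin 3} (hc : T.Proper c)
    (hc' : T.Proper c') (h0 : c 0 = c' 0) (h1 : c (Fin.last (n + 2)) = c' (Fin.last (n + 2))) :
    c = c' := by
  obtain ⟨t, ht⟩ := T.exists_isTree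
  obtain ⟨u, rfl⟩ := exists_extension c
  obtain ⟨u', rfl⟩ := exists_extension c'
  funext i
  exact (ht.proper_iff.2 hc).eq (ht.proper_iff.2 hc') h0 h1 (Nat.zero_le _) (by omega)

theorem Proper.hexagonallyConnected {T T' : Triangulation n} {c : Fin (n + 3) → Fin 3}
    (h : T.Proper c) (h' : T'.Proper c) : T.HexagonallyConnected T' := by
  obtain ⟨t, ht⟩ := T.exists_isTree
  obtain ⟨t', ht'⟩ := T'.exists_isTree
  obtain ⟨u, rfl⟩ := exists_extension c
  exact ht.hexagonallyConnected ht' ((ht.proper_iff.2 h).connected (ht'.proper_iff.2 h'))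

/-- A colouring of a hexagon with three colours that is proper before a move is proper after it. -/
theorem IsHexagonExchange.ne {D D' : Finset (Sym2 (Fin 6))} (h : IsHexagonExchange D D')
    {c : Fin 6 → Fin 3} (hside : ∀ a, c a ≠ c (a + 1)) (hD : ∀ a b, s(a, b) ∈ D → c a ≠ c b)
    {a b : Fin 6} (hab : s(a, b) ∈ D') : c a ≠ c b := by
  have hsymm : ∀ {x y : Fin 6}, s(a, b) = s(x, y) → c x ≠ c y → c a ≠ c b := by
    intro x y h hne
    rcases Sym2.eq_iff.1 h with ⟨rfl, rfl⟩ | ⟨rfl, rfl⟩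
    · exact hne
    · exact hne.symm
  have hr : ∀ r : Fin 6, r + 1 + 1 = r + 2 ∧ r + 2 + 1 = r + 3 ∧ r + 3 + 1 = r + 4 ∧
      r + 4 + 1 = r + 5 ∧ r + 5 + 1 = r ∧ r - 1 = r + 5 ∧ r - 2 = r + 4 ∧ r + 1 + 2 = r + 3 ∧
      r + 1 + 4 = r + 5 := by decide
  obtain ⟨r, h⟩ := h
  obtain ⟨r1, r2, r3, r4, r5, r6, r7, r8, r9⟩ := hr r
  have h0 := hside r
  have h1 := hside (r + 1)
  have h2 := hside (r + 2)
  have h3 := hside (r + 3)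
  have h4 := hside (r + 4)
  have h5 := hside (r + 5)
  rw [r1] at h1
  rw [r2] at h2
  rw [r3] at h3
  rw [r4] at h4
  rw [r5] at h5
  rcases h with ⟨rfl, rfl⟩ | ⟨rfl, rfl⟩ | ⟨rfl, rfl⟩
  · have e1 := hD r (r + 2) (by simp [zigzag])
    have e2 := hD (r + 2) (r - 1) (by simp [zigzag])
    have e3 := hD (r - 1) (r + 3) (by simp [zigzag])
    simp only [zigzag', Finset.mem_insert, Finset.mem_singleton] at hab
    rw [r6] at e2 e3
    rw [r7] at hab
    rcases hab with h | h | h <;> refine hsymm h ?_ <;> omega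
  · have e1 := hD r (r - 2) (by simp [zigzag'])
    have e2 := hD (r - 2) (r + 1) (by simp [zigzag'])
    have e3 := hD (r + 1) (r + 3) (by simp [zigzag'])
    simp only [zigzag, Finset.mem_insert, Finset.mem_singleton] at hab
    rw [r7] at e1 e2
    rw [r6] at hab
    rcases hab with h | h | h <;> refine hsymm h ?_ <;> omega
  · have e1 := hD r (r + 2) (by simp [inscribed])
    have e2 := hD (r + 2) (r + 4) (by simp [inscribed])
    have e3 := hD (r + 4) r (by simp [inscribed])
    simp only [inscribed, Finset.mem_insert, Finset.mem_singleton] at hab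
    rw [r8, r9] at hab
    rcases hab with h | h | h <;> refine hsymm h ?_ <;> omega

theorem Proper.of_hexagonallyConnected {T T' : Triangulation n} {c : Fin (n + 3) → Fin 3}
    (hc : T.Proper c) (h : T.HexagonallyConnected T') : T'.Proper c := by
  induction h with
  | refl => exact hc
  | @tail T₁ T₂ _ h ih =>
    obtain ⟨v, -, hside, D, D', hD, hsub, heq⟩ := h
    rintro i j (hij | hij)
    · exact ih i j (.inl hij)
    · rw [heq, Finset.mem_union, Finset.mem_sdiff] at hij
      rcases hij with hij | hij
      · exact ih i j (.inr hij.1)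
      · obtain ⟨d, hd, hij⟩ := Finset.mem_image.1 hij
        induction d with | _ a b
        have hne : c (v a) ≠ c (v b) := hD.ne (c := fun a => c (v a))
          (fun a => ih _ _ (hside a))
          (fun a b hab => ih _ _ (.inr (hsub (Finset.mem_image_of_mem _ hab)))) hd
        rcases Sym2.eq_iff.1 hij with ⟨rfl, rfl⟩ | ⟨rfl, rfl⟩
        · exact hne
        · exact hne.symm

end Triangulation

/-! ### Colourings by the projective line over the field with two elements -/

theorem exists_projectiveLine_equiv : Nonempty (ℙ (ZMod 2) (Fin 2 → ZMod 2) ≃ Fin 3) := by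
  have h : Nat.card (ℙ (ZMod 2) (Fin 2 → ZMod 2)) = 3 := by
    rw [Projectivization.card_of_finrank_two _ _ (by simp), Nat.card_zmod]
  have : Finite (ℙ (ZMod 2) (Fin 2 → ZMod 2)) := Nat.finite_of_card_ne_zero (by omega)
  exact ⟨Finite.equivFinOfCardEq h⟩

theorem projZero_ne_projInfty : projZero (ZMod 2) ≠ projInfty (ZMod 2) := by
  intro h
  obtain ⟨a, ha⟩ := (Projectivization.mk_eq_mk_iff' _ _ _ _ _).1 h
  simpa using congrFun ha 0

/-- The unique proper colouring of a triangulation by the projective line over `𝔽₂`. -/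
theorem Triangulation.exists_properColourings_eq {n : ℕ} (T : Triangulation n) :
    ∃ y : polygonVariety (ZMod 2) n, T.properColourings (ZMod 2) = {y} := by
  obtain ⟨e⟩ := exists_projectiveLine_equiv
  obtain ⟨c, h0, h1, hc⟩ := T.exists_proper (e.injective.ne projZero_ne_projInfty)
  refine ⟨⟨fun i => e.symm (c i), by simp [h0], by simp [h1], fun i => ?_⟩, ?_⟩
  · refine e.symm.injective.ne (hc _ _ (.inl ?_))
    simp [isSide_mk]
  · refine Set.eq_singleton_iff_unique_mem.2
      ⟨fun i j hij => e.symm.injective.ne (hc i j hij), fun y hy => Subtype.ext ?_⟩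
    have hy' : T.Proper fun i => e (y.1 i) := fun i j hij => e.injective.ne (hy i j hij)
    have := hy'.eq hc (by rw [h0, y.2.1]) (by rw [h1, y.2.2.1])
    exact funext fun i => e.eq_symm_apply.2 (congrFun this i)

theorem theorem1p2 {n m : ℕ} (hn : 1 ≤ n) {K : Type*} [Field K] [Algebra (ZMod 2) K]
    (S₀ : Seed (ZMod 2) K (Fin n) (Fin m))
    (hA : S₀.quiver.IsTypeA n) (hiso : S₀.quiver.NoIsolatedMutable) :
    -- seeds, up to relabelling, correspond to triangulations of the `(n+3)`-gon
    (∃ τ : S₀.MutationClass → Triangulation n, IsSeedTriangulationCorrespondence S₀ τ) ∧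
    -- each cluster torus is a point `pt S` of the cluster manifold, and seeds have the same
    -- point if and only if their triangulations are connected by hexagonal moves
    (∃ pt : S₀.MutationClass → S₀.clusterManifold,
      (∀ S, S₀.clusterTorus S = {(pt S : S₀.ClusterVariety)}) ∧
      ∀ τ : S₀.MutationClass → Triangulation n, IsSeedTriangulationCorrespondence S₀ τ →
        ∀ S S', pt S = pt S' ↔ (τ S).HexagonallyConnected (τ S')) ∧
    -- each triangulation has a unique colouring `c T`, and triangulations have the same
    -- colouring if and only if they are connected by hexagonal moves
    (∃ c : Triangulation n → polygonVariety (ZMod 2) n,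
      (∀ T, T.properColourings (ZMod 2) = {c T}) ∧
      ∀ T T', c T = c T' ↔ T.HexagonallyConnected T') := by
  obtain ⟨τ, hτ⟩ := Seed.exists_correspondence hA hiso
  have hcol : ∀ T : Triangulation n, ∃ c : Fin (n + 3) → Fin 3, c 0 = 0 ∧
      c (Fin.last (n + 2)) = 1 ∧ T.Proper c := fun T => T.exists_proper (by decide)
  refine ⟨⟨τ, hτ⟩, ?_, ?_⟩
  · have htorus : ∀ S : S₀.MutationClass, ∃ φ : S₀.ClusterVariety, S₀.clusterTorus S = {φ} := by
      intro S
      obtain ⟨c, -, -, hc⟩ := hcol (τ S)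
      obtain ⟨φ, hφ, -⟩ := hτ.exists_clusterTorus_eq hiso S hc
      exact ⟨φ, hφ⟩
    choose φ hφ using htorus
    have hmem : ∀ S, φ S ∈ S₀.clusterManifold := fun S =>
      Set.mem_iUnion.2 ⟨S, by rw [hφ]; rfl⟩
    refine ⟨fun S => ⟨φ S, hmem S⟩, hφ, fun σ hσ S S' => ?_⟩
    obtain ⟨c, -, -, hc⟩ := hcol (σ S)
    obtain ⟨c', -, -, hc'⟩ := hcol (σ S')
    rw [Subtype.mk.injEq, ← Set.singleton_eq_singleton_iff, ← hφ, ← hφ,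
      hσ.clusterTorus_eq_iff hiso S S' hc hc']
    constructor
    · intro h
      refine hc.hexagonallyConnected ?_
      rintro i j (hij | hij)
      · exact hc i j (.inl hij)
      · exact h i j hij
    · exact fun h i j hij => hc.of_hexagonallyConnected h i j (.inr hij)
  · choose y hy using fun T : Triangulation n => T.exists_properColourings_eq
    obtain ⟨e⟩ := exists_projectiveLine_equiv
    have hyT : ∀ T : Triangulation n, T.Proper fun i => e ((y T).1 i) := by
      intro T i j hij
      have : y T ∈ T.properColourings (ZMod 2) := by
        rw [hy]
        rfl
      exact e.injective.ne (this i j hij)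
    refine ⟨y, hy, fun T T' => ⟨fun h => ?_, fun h => ?_⟩⟩
    · have := hyT T'
      rw [← h] at this
      exact (hyT T).hexagonallyConnected this
    · have h1 : y T ∈ T'.properColourings (ZMod 2) := fun i j hij hne =>
        (hyT T).of_hexagonallyConnected h i j hij (congrArg e hne)
      rw [hy] at h1
      exact h1
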